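/- **Setting.** Let $n\ge 3$ and let $\bar M$ be a smooth (respectively real analytic) $n$-manifold without boundary; "regular" means smooth (respectively real analytic). A *velocity dominated solution* of the Einstein--scalar field equations on $(0,\infty)\times\bar M$ (with vanishing cosmological constant, in units where Einstein's equations read $G=T$) consists of families, depending regularly on $(t,x)\in(0,\infty)\times\bar M$, of Riemannian metrics ${}^0g$, symmetric covariant $2$-tensor fields ${}^0k$ and functions ${}^0\phi$ on $\bar M$ such that, with ${}^0K^a{}_b={}^0k^a{}_b$ (indices raised with ${}^0g$), $\mathrm{tr}\,{}^0k=\mathrm{tr}\,{}^0K$, ${}^0\rho=\tfrac12(\partial_t{}^0\phi)^2$, ${}^0j=-\partial_t{}^0\phi\, d\,{}^0\phi$, ${}^0S=\tfrac12(\partial_t{}^0\phi)^2\,{}^0g$ and $\nabla$ the Levi-Civita connection of ${}^0g$, $$-{}^0k_{ab}{}^0k^{ab}+(\mathrm{tr}\,{}^0k)^2=2\,{}^0\rho,\qquad \nabla^a\,{}^0k_{ab}-\partial_b(\mathrm{tr}\,{}^0k)={}^0j_b,\qquad \partial_t{}^0g_{ab}=-2\,{}^0k_{ab},$$ $$\partial_t{}^0k^a{}_b=(\mathrm{tr}\,{}^0k)\,{}^0k^a{}_b-\Big({}^0S^a{}_b-\tfrac{1}{n-1}\delta^a_b\,\mathrm{tr}\,{}^0S\Big)-\tfrac{1}{n-1}{}^0\rho\,\delta^a_b,\qquad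 \partial_t^2\,{}^0\phi-(\mathrm{tr}\,{}^0k)\,\partial_t{}^0\phi=0 .$$ *Non-degenerate quiescent initial data on the singularity* $(\bar M,\bar h,\mathscr K,\Phi_a,\Phi_b)$ for the Einstein--scalar field equations (with a cosmological constant, whose value does not enter) consist of a smooth Riemannian metric $\bar h$, a smooth $(1,1)$-tensor field $\mathscr K$ and smooth functions $\Phi_a,\Phi_b$ on the $n$-manifold $\bar M$, $n\ge 3$, such that (1) $\mathrm{tr}\,\mathscr K=1$ and $\mathscr K$ is symmetric with respect to $\bar h$; (2) $\mathrm{tr}\,\mathscr K^2+\Phi_a^2=1$ and $\mathrm{div}_{\bar h}\mathscr K=\Phi_a\,d\Phi_b$; (3) the eigenvalues $p_1<\dots<p_n$ of $\mathscr K$ are distinct at each point; (4) for local eigenvector fields $\mathscr X_A$ with $\mathscr K\mathscr X_A=p_A\mathscr X_A$, $\bar h(\mathscr X_A,\mathscr X_A)=1$ and $[\mathscr X_B,\mathscr X_C]=\gamma^A_{BC}\mathscr X_A$, the function $(\gamma^A_{BC})^2$ vanishes in a neighbourhood of each $x$ with $1+p_A(x)-p_B(x)-p_C(x)\le 0$.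 **Proposition.** (i) Let $({}^0g,{}^0k,{}^0\phi)$ be a velocity dominated solution on $(0,\infty)\times\bar M$ with $\mathrm{tr}\,{}^0k$ nowhere zero. Then there are a regular function $C\le 0$ on $\bar M$ and a velocity dominated solution $(g',k',\phi')$ on $(0,\infty)\times\bar M$ with $\mathrm{tr}\,k'=-t^{-1}$ such that ${}^0g(t,x)=g'(t-C(x),x)$, ${}^0k(t,x)=k'(t-C(x),x)$ and ${}^0\phi(t,x)=\phi'(t-C(x),x)$ for all $t>0$ and $x\in\bar M$. Thus, after adjusting the time, $\mathrm{tr}\,{}^0k=-t^{-1}$ can be assumed. (ii) Let $({}^0g,{}^0k,{}^0\phi)$ be a velocity dominated solution on $(0,\infty)\times\bar M$ with $\mathrm{tr}\,{}^0k=-t^{-1}$. Then $\mathscr K:=-t\cdot{}^0K$ is independent of $t$ and regular, and its eigenvalues are real. Moreover $\partial_t(t\,\partial_t{}^0\phi)=0$, and there are regular functions $\Phi_a,\Phi_b$ on $\bar M$ such that ${}^0\phi=\Phi_a\ln t+\Phi_b$. (iii) Assume, in addition to the hypotheses of (ii), that the eigenvalues $p_1<\dots<p_n$ of $\mathscr K$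 are distinct at each point. Then each point of $\bar M$ has an open neighbourhood on which there are regular eigenvector fields $\bar{\mathscr X}_A$ of $\mathscr K$ corresponding to $p_A$, $A=1,\dots,n$, and there is a regular Riemannian metric $\bar h$ on $\bar M$ such that, for every such local frame $\{\bar{\mathscr X}_A\}$, on an open set $U$, with dual coframe $\{\bar{\mathscr Y}^A\}$, there are regular functions $\alpha_A>0$ on $U$ with $${}^0g=\sum_A\alpha_A^2\,t^{2p_A}\,\bar{\mathscr Y}^A\otimes\bar{\mathscr Y}^A\quad (t>0),\qquad \bar h=\sum_A\alpha_A^2\,\bar{\mathscr Y}^A\otimes\bar{\mathscr Y}^A\qquad\text{on } U .$$ In particular, $\sum_A\alpha_A^2\,\bar{\mathscr Y}^A\otimes\bar{\mathscr Y}^A$ does not depend on the choice of local frame. If moreover $1+p_1-p_{n-1}-p_n>0$ on $\bar M$, then $(\bar M,\bar h,\mathscr K,\Phi_a,\Phi_b)$ are non-degenerate quiescent initial data on the singularity for the Einstein--scalar field equations with vanishing cosmological constant. -/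

import Mathlib

open Set Filter Topology Bundle
open scoped Manifold ContDiff

noncomputable section

namespace VelocityDominated

/-! ### Tensor fields on an `n`-dimensional manifold -/

/-- Fields of covariant `2`-tensors (no symmetry or regularity required). -/
abbrev BilinField (n : ℕ) (M : Type*) [TopologicalSpace M]
    [ChartedSpace (EuclideanSpace ℝ (Fin n)) M] : Type _ :=
  ∀ x : M, TangentSpace (𝓡 n) x →L[ℝ] TangentSpace (𝓡 n) x →L[ℝ] ℝ

/-- `(1,1)`-tensor fields, as fields of endomorphisms of the tangent spaces. -/
abbrev EndField (n : ℕ) (M : Type*) [TopologicalSpace M]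
    [ChartedSpace (EuclideanSpace ℝ (Fin n)) M] : Type _ :=
  ∀ x : M, TangentSpace (𝓡 n) x →L[ℝ] TangentSpace (𝓡 n) x

/-- Vector fields. -/
abbrev VecField (n : ℕ) (M : Type*) [TopologicalSpace M]
    [ChartedSpace (EuclideanSpace ℝ (Fin n)) M] : Type _ :=
  ∀ x : M, TangentSpace (𝓡 n) x

/-- One-forms. -/
abbrev OneForm (n : ℕ) (M : Type*) [TopologicalSpace M]
    [ChartedSpace (EuclideanSpace ℝ (Fin n)) M] : Type _ :=
  ∀ x : M, TangentSpace (𝓡 n) x →L[ℝ] ℝ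

section Regularity

variable {n : ℕ} {M : Type*} [TopologicalSpace M] [ChartedSpace (EuclideanSpace ℝ (Fin n)) M]
  [IsManifold (𝓡 n) ∞ M]

/-- `X` is of class `C^r` on `U`. -/
def VecField.RegularOn (r : WithTop ℕ∞) (X : VecField n M) (U : Set M) : Prop :=
  ContMDiffOn (𝓡 n) ((𝓡 n).prod 𝓘(ℝ, EuclideanSpace ℝ (Fin n))) r
    (fun x ↦ TotalSpace.mk' (EuclideanSpace ℝ (Fin n)) x (X x)) U

/-- `b` is of class `C^r`. -/
def BilinField.Regular (r : WithTop ℕ∞) (b : BilinField n M) : Prop :=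
  ContMDiff (𝓡 n)
    ((𝓡 n).prod 𝓘(ℝ, EuclideanSpace ℝ (Fin n) →L[ℝ] EuclideanSpace ℝ (Fin n) →L[ℝ] ℝ)) r
    (fun x ↦ TotalSpace.mk' (EuclideanSpace ℝ (Fin n) →L[ℝ] EuclideanSpace ℝ (Fin n) →L[ℝ] ℝ)
      (E := fun x : M ↦ TangentSpace (𝓡 n) x →L[ℝ] TangentSpace (𝓡 n) x →L[ℝ] ℝ) x (b x))

/-- `K` is of class `C^r`. -/
def EndField.Regular (r : WithTop ℕ∞) (K : EndField n M) : Prop :=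
  ContMDiff (𝓡 n)
    ((𝓡 n).prod 𝓘(ℝ, EuclideanSpace ℝ (Fin n) →L[ℝ] EuclideanSpace ℝ (Fin n))) r
    (fun x ↦ TotalSpace.mk' (EuclideanSpace ℝ (Fin n) →L[ℝ] EuclideanSpace ℝ (Fin n))
      (E := fun x : M ↦ TangentSpace (𝓡 n) x →L[ℝ] TangentSpace (𝓡 n) x) x (K x))

/-- The family `b t`, `t > 0`, of covariant `2`-tensor fields is of class `C^r` jointly in
`(t, x) ∈ (0, ∞) × M`. -/
def RegularFamily (r : WithTop ℕ∞) (b : ℝ → BilinField n M) : Prop :=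
  ContMDiffOn (𝓘(ℝ, ℝ).prod (𝓡 n))
    ((𝓡 n).prod 𝓘(ℝ, EuclideanSpace ℝ (Fin n) →L[ℝ] EuclideanSpace ℝ (Fin n) →L[ℝ] ℝ)) r
    (fun q : ℝ × M ↦
      TotalSpace.mk' (EuclideanSpace ℝ (Fin n) →L[ℝ] EuclideanSpace ℝ (Fin n) →L[ℝ] ℝ)
        (E := fun x : M ↦ TangentSpace (𝓡 n) x →L[ℝ] TangentSpace (𝓡 n) x →L[ℝ] ℝ)
        q.2 (b q.1 q.2))
    (Ioi 0 ×ˢ univ)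

/-- `h` is a Riemannian metric of class `C^r`. -/
structure IsRiemannianMetric (r : WithTop ℕ∞) (h : BilinField n M) : Prop where
  regular : h.Regular r
  symm : ∀ x v w, h x v w = h x w v
  pos : ∀ x v, v ≠ 0 → 0 < h x v v

end Regularity

section Geometry

variable {n : ℕ} {M : Type*} [TopologicalSpace M] [ChartedSpace (EuclideanSpace ℝ (Fin n)) M]

/-- Raise an index: for a (pointwise nondegenerate, symmetric) `g` and a symmetric `b`, this is the
endomorphism field `b^a_c = g^{ad} b_{dc}`, i.e. `g (raise g b v, w) = b (v, w)`. -/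
def raise (g b : BilinField n M) : EndField n M :=
  fun x ↦ (g x).inverse ∘L b x

/-- The trace of a `(1,1)`-tensor field. -/
def tr (K : EndField n M) (x : M) : ℝ :=
  LinearMap.trace ℝ (TangentSpace (𝓡 n) x) (K x : TangentSpace (𝓡 n) x →ₗ[ℝ] TangentSpace (𝓡 n) x)

/-- The trace of the square of a `(1,1)`-tensor field, `K^a_b K^b_a`. -/
def trSq (K : EndField n M) (x : M) : ℝ :=
  tr (fun y ↦ K y ∘L K y) x

end Geometry

section Divergence

variable {n : ℕ} {M : Type*} [TopologicalSpace M] [ChartedSpace (EuclideanSpace ℝ (Fin n)) M]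
  [IsManifold (𝓡 n) ∞ M]

/-- The coordinate vector field `∂_a` of the preferred chart at `x₀`. -/
def coordField (x₀ : M) (a : Fin n) : VecField n M :=
  fun y ↦ (trivializationAt (EuclideanSpace ℝ (Fin n)) (TangentSpace (𝓡 n)) x₀).symmL ℝ y
    (EuclideanSpace.single a (1 : ℝ))

/-- The coordinate one-form `dx^a` of the preferred chart at `x₀`. -/
def coordForm (x₀ : M) (a : Fin n) : OneForm n M :=
  fun y ↦ (EuclideanSpace.proj a : EuclideanSpace ℝ (Fin n) →L[ℝ] ℝ) ∘L
    (trivializationAt (EuclideanSpace ℝ (Fin n)) (TangentSpace (𝓡 n)) x₀).continuousLinearMapAt ℝ y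

/-- `∂_a` is the image of the standard basis vector under the derivative of the inverse chart. -/
theorem coordField_eq (x₀ y : M) (a : Fin n)
    (hy : y ∈ (chartAt (EuclideanSpace ℝ (Fin n)) x₀).source) :
    coordField x₀ a y =
      mfderivWithin 𝓘(ℝ, EuclideanSpace ℝ (Fin n)) (𝓡 n) (extChartAt (𝓡 n) x₀).symm
        (range (𝓡 n)) (extChartAt (𝓡 n) x₀ y) (EuclideanSpace.single a (1 : ℝ)) := by
  unfold coordField
  rw [TangentBundle.symmL_trivializationAt hy]
  rfl

/-- `dx^a` is the `a`-th component of the derivative of the chart. -/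
theorem coordForm_eq (x₀ y : M) (a : Fin n) (v : TangentSpace (𝓡 n) y)
    (hy : y ∈ (chartAt (EuclideanSpace ℝ (Fin n)) x₀).source) :
    coordForm x₀ a y v =
      (EuclideanSpace.proj a : EuclideanSpace ℝ (Fin n) →L[ℝ] ℝ)
        (mfderiv (𝓡 n) 𝓘(ℝ, EuclideanSpace ℝ (Fin n)) (extChartAt (𝓡 n) x₀) y v) := by
  rw [← TangentBundle.continuousLinearMapAt_trivializationAt hy]
  rfl

/-- The partial derivative `∂_a f` at `x₀`, in the preferred chart at `x₀`. -/
def partialD (x₀ : M) (a : Fin n) (f : M → ℝ) : ℝ :=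
  mvfderiv (𝓡 n) f x₀ (coordField x₀ a x₀)

/-- The coordinate components `g_{ab}` at `y`, in the preferred chart at `x₀`. -/
def gram (g : BilinField n M) (x₀ y : M) : Matrix (Fin n) (Fin n) ℝ :=
  Matrix.of fun a b ↦ g y (coordField x₀ a y) (coordField x₀ b y)

/-- The Christoffel symbols `Γ^a_{bc}` of the Levi-Civita connection of `g` at `x₀`, in the
preferred chart at `x₀`. -/
def christoffel (g : BilinField n M) (x₀ : M) (a b c : Fin n) : ℝ :=
  (1 / 2) * ∑ d, (gram g x₀ x₀)⁻¹ a d *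
    (partialD x₀ b (fun y ↦ gram g x₀ y d c) + partialD x₀ c (fun y ↦ gram g x₀ y d b)
      - partialD x₀ d (fun y ↦ gram g x₀ y b c))

/-- The coordinate components `K^a_b` at `y`, in the preferred chart at `x₀`. -/
def comp (K : EndField n M) (x₀ y : M) (a b : Fin n) : ℝ :=
  coordForm x₀ a y (K y (coordField x₀ b y))

/-- The divergence `(div_g K)_b = ∇_a K^a_b` with respect to the Levi-Civita connection `∇` of
`g`, i.e. `∂_a K^a_b + Γ^a_{ac} K^c_b - Γ^c_{ab} K^a_c` in local coordinates. -/
def divergence (g : BilinField n M) (K : EndField n M) : OneForm n M :=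
  fun x ↦ ∑ b, (∑ a, (partialD x a (fun y ↦ comp K x y a b)
      + ∑ c, (christoffel g x a a c * comp K x x c b
        - christoffel g x c a b * comp K x x a c))) • coordForm x b x

end Divergence

/-! ### The velocity dominated Einstein-scalar field equations -/

section Equations

variable {n : ℕ} {M : Type*} [TopologicalSpace M] [ChartedSpace (EuclideanSpace ℝ (Fin n)) M]

/-- The energy density `ρ = (∂_t φ)² / 2`. -/
def energyDensity (φ : ℝ → M → ℝ) (t : ℝ) (x : M) : ℝ :=
  (1 / 2) * (deriv (fun s ↦ φ s x) t) ^ 2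

/-- The momentum density `j = - ∂_t φ dφ`. -/
def momentumDensity (φ : ℝ → M → ℝ) (t : ℝ) : OneForm n M :=
  fun x ↦ -(deriv (fun s ↦ φ s x) t) • mvfderiv (𝓡 n) (φ t) x

/-- The velocity dominated stress tensor `S = (∂_t φ)² g / 2`. -/
def stress (g : ℝ → BilinField n M) (φ : ℝ → M → ℝ) (t : ℝ) : BilinField n M :=
  fun x ↦ ((1 / 2) * (deriv (fun s ↦ φ s x) t) ^ 2) • g t x

/-- The Weingarten map `K^a_b = g^{ac} k_{cb}`. -/
def weingarten (g k : ℝ → BilinField n M) (t : ℝ) : EndField n M :=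
  raise (g t) (k t)

variable [IsManifold (𝓡 n) ∞ M]

/-- `(g, k, φ)` is a velocity dominated solution of class `C^r` of the Einstein-scalar field
equations on `(0, ∞) × M`, with vanishing cosmological constant, in units where Einstein's equations
read `G = T`. -/
structure IsSolution (r : WithTop ℕ∞) (g k : ℝ → BilinField n M) (φ : ℝ → M → ℝ) : Prop where
  regular_g : RegularFamily r g
  regular_k : RegularFamily r k
  regular_φ : ContMDiffOn (𝓘(ℝ, ℝ).prod (𝓡 n)) 𝓘(ℝ, ℝ) r
    (fun q : ℝ × M ↦ φ q.1 q.2) (Ioi 0 ×ˢ univ)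
  symm_g : ∀ t > 0, ∀ x v w, g t x v w = g t x w v
  pos_g : ∀ t > 0, ∀ x v, v ≠ 0 → 0 < g t x v v
  symm_k : ∀ t > 0, ∀ x v w, k t x v w = k t x w v
  /-- `- k_{ab} k^{ab} + (tr k)² = 2 ρ`. -/
  hamiltonian : ∀ t > 0, ∀ x,
    -trSq (weingarten g k t) x + (tr (weingarten g k t) x) ^ 2 = 2 * energyDensity φ t x
  /-- `∇^a k_{ab} - ∂_b (tr k) = j_b`. -/
  momentum : ∀ t > 0, ∀ x,
    divergence (g t) (weingarten g k t) x - mvfderiv (𝓡 n) (tr (weingarten g k t)) x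
      = momentumDensity φ t x
  /-- `∂_t g_{ab} = - 2 k_{ab}`. -/
  evol_g : ∀ t > 0, ∀ x v w, HasDerivAt (fun s ↦ g s x v w) (-2 * k t x v w) t
  /-- `∂_t k^a_b = (tr k) k^a_b - (S^a_b - (tr S) δ^a_b / (n - 1)) - ρ δ^a_b / (n - 1)`. -/
  evol_k : ∀ t > 0, ∀ x v, HasDerivAt (fun s ↦ weingarten g k s x v)
    (tr (weingarten g k t) x • weingarten g k t x v
      - (raise (g t) (stress g φ t) x v
          - (tr (raise (g t) (stress g φ t)) x / ((n : ℝ) - 1)) • v)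
      - (energyDensity φ t x / ((n : ℝ) - 1)) • v) t
  /-- `∂_t² φ - (tr k) ∂_t φ = 0`. -/
  evol_φ : ∀ t > 0, ∀ x,
    deriv (fun s ↦ deriv (fun u ↦ φ u x) s) t
      - tr (weingarten g k t) x * deriv (fun s ↦ φ s x) t = 0

end Equations

/-! ### Eigenframes and initial data on the singularity -/

section Data

variable {n : ℕ} {M : Type*} [TopologicalSpace M] [ChartedSpace (EuclideanSpace ℝ (Fin n)) M]

/-- At each point the eigenvalues of `K` are real and distinct, and are `p 0 < ⋯ < p (n - 1)`. -/
structure HasDistinctEigenvalues (K : EndField n M) (p : Fin n → M → ℝ) : Prop where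
  strictMono : ∀ x, StrictMono fun A ↦ p A x
  eigenvalue : ∀ A x, Module.End.HasEigenvalue
    (K x : TangentSpace (𝓡 n) x →ₗ[ℝ] TangentSpace (𝓡 n) x) (p A x)

instance tangentSpaceFinite (x : M) : Module.Finite ℝ (TangentSpace (𝓡 n) x) :=
  inferInstanceAs (Module.Finite ℝ (EuclideanSpace ℝ (Fin n)))

/-- At each point, all complex roots of the characteristic polynomial of `K` are real. -/
def HasRealEigenvalues (K : EndField n M) : Prop :=
  ∀ x, ∀ z : ℂ,
    ((LinearMap.charpoly (K x : TangentSpace (𝓡 n) x →ₗ[ℝ] TangentSpace (𝓡 n) x)).map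
      (algebraMap ℝ ℂ)).IsRoot z → z.im = 0

/-- `Y` is the coframe dual to the frame `X` on `U`. -/
def IsDualCoframe (X : Fin n → VecField n M) (Y : Fin n → OneForm n M) (U : Set M) : Prop :=
  ∀ x ∈ U, ∀ A B, Y A x (X B x) = if A = B then 1 else 0

/-- The tensor field `∑_A c_A Y^A ⊗ Y^A` at `x`, evaluated on `v` and `w`. -/
def diagForm (c : Fin n → ℝ) (Y : Fin n → OneForm n M) (x : M) (v w : TangentSpace (𝓡 n) x) : ℝ :=
  ∑ A, c A * (Y A x v * Y A x w)

variable [IsManifold (𝓡 n) ∞ M]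

/-- On the open set `U`, each `X A` is a `C^r` eigenvector field of `K` corresponding to `p A`. -/
structure IsEigenframe (r : WithTop ℕ∞) (K : EndField n M) (p : Fin n → M → ℝ)
    (X : Fin n → VecField n M) (U : Set M) : Prop where
  isOpen : IsOpen U
  regular : ∀ A, (X A).RegularOn r U
  ne_zero : ∀ A, ∀ x ∈ U, X A x ≠ 0
  eigen : ∀ A, ∀ x ∈ U, K x (X A x) = p A x • X A x

/-- `(M, h, K, Φa, Φb)` are non-degenerate quiescent initial data on the singularity for the
Einstein-scalar field equations with a cosmological constant (whose value does not enter). -/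
structure IsQuiescentData (h : BilinField n M) (K : EndField n M) (Φa Φb : M → ℝ) : Prop where
  dim : 3 ≤ n
  metric : IsRiemannianMetric ∞ h
  regular_K : K.Regular ∞
  regular_Φa : ContMDiff (𝓡 n) 𝓘(ℝ, ℝ) ∞ Φa
  regular_Φb : ContMDiff (𝓡 n) 𝓘(ℝ, ℝ) ∞ Φb
  trace : ∀ x, tr K x = 1
  symm : ∀ x v w, h x (K x v) w = h x v (K x w)
  hamiltonian : ∀ x, trSq K x + Φa x ^ 2 = 1
  momentum : ∀ x, divergence h K x = Φa x • mvfderiv (𝓡 n) Φb x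
  /-- The eigenvalues `p` are distinct, and for each `h`-normalised local eigenframe `X` the squares
  `𝒪^A_{BC} = (γ^A_{BC})²`, where `[X_B, X_C] = γ^A_{BC} X_A`, vanish in a neighbourhood of each
  point at which `1 + p_A - p_B - p_C ≤ 0`. -/
  eigenvalues : ∃ p : Fin n → M → ℝ, HasDistinctEigenvalues K p ∧
    ∀ (U : Set M) (X : Fin n → VecField n M) (Y : Fin n → OneForm n M),
      IsEigenframe ∞ K p X U → (∀ A, ∀ x ∈ U, h x (X A x) (X A x) = 1) → IsDualCoframe X Y U →
      ∀ A B C, ∀ x ∈ U, 1 + p A x - p B x - p C x ≤ 0 →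
        ∀ᶠ y in 𝓝 x, (Y A y (VectorField.mlieBracket (𝓡 n) (X B) (X C) y)) ^ 2 = 0

end Data

end VelocityDominated

end

/-! The stress tensor is a multiple of the metric, so the matter terms in the evolution equation
cancel and the Weingarten map obeys `∂_t K = (tr K) K`. At each point the evolution is thus an
explicitly solvable ODE. The trace `θ` satisfies `θ' = θ²`, so `t + 1/θ` is a function `C` of `x`
alone, and `C ≤ 0` because `θ` would otherwise blow up at `t = C`. Then `(t - C) K` is conserved,
and with `𝒦 = -(t - C) K` integration gives `g = g(1)(exp(2 (log (t - C) - log (1 - C)) 𝒦) ·, ·)`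
and `φ = φ(1) + Φa (log (t - C) - log (1 - C))`, where `Φa = (t - C) ∂_t φ`.

This suggests the data on the singularity: `h = g(1)(exp(-2 log (1 - C) 𝒦) ·, ·)` and `Φb = φ(1) -
Φa log (1 - C)`. The normalised solution is rebuilt from them as `h(t^(2𝒦) ·, ·)`, `Φa log t + Φb`.
All equations but one are pointwise in `x` and pass over at once. The exception is the momentum
constraint, since `C` varies with `x`. Its behaviour is governed by `divergence_expMetric`: for `h'
= h(exp(f K) ·, ·)` with `K` self-adjoint and `tr K = 1`, one has `div' K = div K + ½ df∘K - ½ (tr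
K²) df - ¼ f d(tr K²)`. The formula holds although `K` and its derivatives need not commute: the
divergence of a self-adjoint tensor involves derivatives of the metric only through traces, and
there the derivative of the exponential simplifies (`tracial_fderiv_exp`). It is used twice: in
`divergence_dataMetric` to carry the constraint from `t = 1` to the singularity, and in
`isSolution_model` to carry it from the singularity to every `t`.

For `tr K = -1/t` one has `C = 0` and `h = g(1)`. Self-adjointness makes the eigenvalues of `𝒦`
real. If they are distinct, the implicit function theorem makes them regular, products of the
factors `𝒦 - p_B` produce regular eigenvectors, and orthogonality of eigenvectors diagonalises `h`
and `t^(2𝒦)` simultaneously. Under the final inequality, the bracket condition on the data is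
required only for `B = C`, where the bracket is zero. -/

open Set Filter Topology Bundle
open scoped Manifold ContDiff

noncomputable section

namespace VelocityDominated

/-! ### Coordinate frames and matrices of tensor fields. -/

section Frame

variable {n : ℕ} {M : Type*} [TopologicalSpace M] [ChartedSpace (EuclideanSpace ℝ (Fin n)) M]
  [IsManifold (𝓡 n) ∞ M]

/-- The coordinate frame of the preferred chart at `x₀`, as a basis of the tangent space at `y`. -/
def frame (x₀ y : M) (hy : y ∈ (chartAt (EuclideanSpace ℝ (Fin n)) x₀).source) :
    Module.Basis (Fin n) ℝ (TangentSpace (𝓡 n) y) :=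
  (EuclideanSpace.basisFun (Fin n) ℝ).toBasis.map
    ((trivializationAt (EuclideanSpace ℝ (Fin n)) (TangentSpace (𝓡 n)) x₀).continuousLinearEquivAt
      ℝ y hy).symm.toLinearEquiv

theorem frame_apply (x₀ y : M) (hy : y ∈ (chartAt (EuclideanSpace ℝ (Fin n)) x₀).source)
    (a : Fin n) : frame x₀ y hy a = coordField x₀ a y := by
  have := (trivializationAt (EuclideanSpace ℝ (Fin n)) (TangentSpace (𝓡 n))
    x₀).symm_continuousLinearEquivAt_eq (R := ℝ) (b := y) hy
  rw [coordField, ← this]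
  simp [frame]

theorem frame_repr (x₀ y : M) (hy : y ∈ (chartAt (EuclideanSpace ℝ (Fin n)) x₀).source)
    (v : TangentSpace (𝓡 n) y) (a : Fin n) : (frame x₀ y hy).repr v a = coordForm x₀ a y v := by
  have := (trivializationAt (EuclideanSpace ℝ (Fin n)) (TangentSpace (𝓡 n))
    x₀).coe_continuousLinearEquivAt_eq (R := ℝ) (b := y) hy
  rw [coordForm, ContinuousLinearMap.comp_apply, ← this]
  simp [frame]

/-- The components of `K` in the coordinate frame, as a matrix. -/
def compMatrix (K : EndField n M) (x₀ y : M) : Matrix (Fin n) (Fin n) ℝ :=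
  Matrix.of fun a b ↦ comp K x₀ y a b

theorem compMatrix_eq_toMatrix (K : EndField n M) (x₀ y : M)
    (hy : y ∈ (chartAt (EuclideanSpace ℝ (Fin n)) x₀).source) :
    compMatrix K x₀ y = LinearMap.toMatrix (frame x₀ y hy) (frame x₀ y hy)
      (K y : TangentSpace (𝓡 n) y →ₗ[ℝ] TangentSpace (𝓡 n) y) := by
  ext a b
  rw [LinearMap.toMatrix_apply, frame_repr, frame_apply]
  rfl

theorem tr_eq_trace_compMatrix (K : EndField n M) (x₀ y : M)
    (hy : y ∈ (chartAt (EuclideanSpace ℝ (Fin n)) x₀).source) :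
    tr K y = (compMatrix K x₀ y).trace := by
  rw [compMatrix_eq_toMatrix K x₀ y hy, tr, LinearMap.trace_eq_matrix_trace ℝ (frame x₀ y hy)]

theorem compMatrix_comp (K L : EndField n M) (x₀ y : M)
    (hy : y ∈ (chartAt (EuclideanSpace ℝ (Fin n)) x₀).source) :
    compMatrix (fun z ↦ K z ∘L L z) x₀ y = compMatrix K x₀ y * compMatrix L x₀ y := by
  rw [compMatrix_eq_toMatrix K x₀ y hy, compMatrix_eq_toMatrix L x₀ y hy,
    ← LinearMap.toMatrix_comp (frame x₀ y hy) (frame x₀ y hy) (frame x₀ y hy),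
    compMatrix_eq_toMatrix _ x₀ y hy]
  rfl

theorem compMatrix_smul (c : M → ℝ) (K : EndField n M) (x₀ y : M) :
    compMatrix (fun z ↦ c z • K z) x₀ y = c y • compMatrix K x₀ y := by
  ext a b
  simp [compMatrix, comp, coordForm]

/-- The endomorphism acts on the first argument of the form, hence the transpose and its position on
the left. -/
theorem gram_comp (g : BilinField n M) (K : EndField n M) (x₀ y : M)
    (hy : y ∈ (chartAt (EuclideanSpace ℝ (Fin n)) x₀).source) :
    gram (fun z ↦ g z ∘L K z) x₀ y = (compMatrix K x₀ y).transpose * gram g x₀ y := by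
  ext a b
  have h := (frame x₀ y hy).sum_repr (K y (coordField x₀ a y))
  simp only [frame_repr, frame_apply] at h
  simp only [gram, Matrix.of_apply, ContinuousLinearMap.comp_apply, Matrix.mul_apply,
    Matrix.transpose_apply, compMatrix, comp]
  conv_lhs => rw [← h]
  simp only [map_sum, map_smul, _root_.sum_apply, _root_.smul_apply,
    smul_eq_mul]

theorem gram_isSymm (g : BilinField n M) (x₀ y : M) (hg : ∀ v w, g y v w = g y w v) :
    (gram g x₀ y).transpose = gram g x₀ y := by
  ext a b
  exact hg _ _

theorem gram_posDef (g : BilinField n M) (x₀ y : M) (hg : ∀ v w, g y v w = g y w v)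
    (hpos : ∀ v, v ≠ 0 → 0 < g y v v)
    (hy : y ∈ (chartAt (EuclideanSpace ℝ (Fin n)) x₀).source) :
    (gram g x₀ y).PosDef := by
  refine Matrix.PosDef.of_dotProduct_mulVec_pos ?_ fun v hv ↦ ?_
  · rw [Matrix.IsHermitian, Matrix.conjTranspose_eq_transpose_of_trivial]
    exact gram_isSymm g x₀ y hg
  · have h0 : ∑ a, v a • frame x₀ y hy a ≠ 0 := by
      intro h
      apply hv
      ext a
      exact Fintype.linearIndependent_iff.1 (frame x₀ y hy).linearIndependent v h a
    have := hpos _ h0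
    simp only [frame_apply, map_sum, map_smul, _root_.sum_apply,
      _root_.smul_apply, smul_eq_mul] at this
    simp only [dotProduct, Matrix.mulVec, gram, Matrix.of_apply, star_trivial, Finset.mul_sum]
    refine this.trans_eq (Finset.sum_congr rfl fun a _ ↦ ?_)
    rw [Finset.mul_sum]
    exact Finset.sum_congr rfl fun b _ ↦ by rw [hg]; ring

end Frame

/-! ### Regularity of tensor fields through their components. -/

section Coordinates

variable {n : ℕ} {M : Type*} [TopologicalSpace M] [ChartedSpace (EuclideanSpace ℝ (Fin n)) M]
  [IsManifold (𝓡 n) ∞ M]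
  {F : Type*} [NormedAddCommGroup F] [NormedSpace ℝ F] {H : Type*} [TopologicalSpace H]
  {I : ModelWithCorners ℝ F H} {N : Type*} [TopologicalSpace N] [ChartedSpace H N]
  {r : WithTop ℕ∞}

/-- A family of vectors is of class `C^r` iff its coordinates are. -/
theorem contMDiffWithinAt_euclidean_of_apply {v : N → EuclideanSpace ℝ (Fin n)} {s : Set N} {q₀ : N}
    (h : ∀ a, ContMDiffWithinAt I 𝓘(ℝ, ℝ) r (fun q ↦ v q a) s q₀) :
    ContMDiffWithinAt I 𝓘(ℝ, EuclideanSpace ℝ (Fin n)) r v s q₀ := by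
  have key : v = fun q ↦ ∑ a, v q a • EuclideanSpace.single a (1 : ℝ) := by
    funext q
    ext b
    simp [Pi.single_apply]
  rw [key]
  exact ContMDiffWithinAt.sum fun a _ ↦ (h a).smul contMDiffWithinAt_const

/-- A family of linear maps is of class `C^r` if its values on the basis vectors are. -/
theorem contMDiffWithinAt_clm_of_apply {V : Type*} [NormedAddCommGroup V] [NormedSpace ℝ V]
    {A : N → EuclideanSpace ℝ (Fin n) →L[ℝ] V} {s : Set N} {q₀ : N}
    (h : ∀ a, ContMDiffWithinAt I 𝓘(ℝ, V) r (fun q ↦ A q (EuclideanSpace.single a (1 : ℝ))) s q₀) :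
    ContMDiffWithinAt I 𝓘(ℝ, EuclideanSpace ℝ (Fin n) →L[ℝ] V) r A s q₀ := by
  have key : A = fun q ↦ ∑ a, ContinuousLinearMap.smulRightL ℝ (EuclideanSpace ℝ (Fin n)) V
      (EuclideanSpace.proj a) (A q (EuclideanSpace.single a (1 : ℝ))) := by
    funext q
    refine ContinuousLinearMap.coe_injective ((EuclideanSpace.basisFun (Fin n) ℝ).toBasis.ext fun b ↦ ?_)
    simp
  rw [key]
  exact ContMDiffWithinAt.sum fun a _ ↦
    (ContinuousLinearMap.contMDiff _).contMDiffAt.comp_contMDiffWithinAt q₀ (h a)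

/-- A family of endomorphisms is of class `C^r` iff its coordinate components are. -/
theorem contMDiffWithinAt_end_iff {f : N → M}
    {K : ∀ q : N, TangentSpace (𝓡 n) (f q) →L[ℝ] TangentSpace (𝓡 n) (f q)} {s : Set N} {q₀ : N}
    (hf : ContMDiffWithinAt I (𝓡 n) r f s q₀) :
    ContMDiffWithinAt I ((𝓡 n).prod 𝓘(ℝ, EuclideanSpace ℝ (Fin n) →L[ℝ] EuclideanSpace ℝ (Fin n))) r
      (fun q ↦ TotalSpace.mk' (EuclideanSpace ℝ (Fin n) →L[ℝ] EuclideanSpace ℝ (Fin n))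
        (E := fun x : M ↦ TangentSpace (𝓡 n) x →L[ℝ] TangentSpace (𝓡 n) x) (f q) (K q)) s q₀ ↔
    ∀ a b, ContMDiffWithinAt I 𝓘(ℝ, ℝ) r
      (fun q ↦ coordForm (f q₀) a (f q) (K q (coordField (f q₀) b (f q)))) s q₀ := by
  rw [contMDiffWithinAt_hom_bundle]
  constructor
  · rintro ⟨-, h⟩ a b
    exact ((EuclideanSpace.proj a :
      EuclideanSpace ℝ (Fin n) →L[ℝ] ℝ).contMDiff.contMDiffAt).comp_contMDiffWithinAt q₀
        (h.clm_apply (contMDiffWithinAt_const (c := EuclideanSpace.single b (1 : ℝ))))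
  · intro h
    exact ⟨hf, contMDiffWithinAt_clm_of_apply fun b ↦
      contMDiffWithinAt_euclidean_of_apply fun a ↦ h a b⟩

/-- The coordinate expression of a bilinear form. -/
theorem inCoordinates_bilin {x₀ y : M} (hy : y ∈ (chartAt (EuclideanSpace ℝ (Fin n)) x₀).source)
    (b : TangentSpace (𝓡 n) y →L[ℝ] TangentSpace (𝓡 n) y →L[ℝ] ℝ) (u v : EuclideanSpace ℝ (Fin n)) :
    ContinuousLinearMap.inCoordinates (EuclideanSpace ℝ (Fin n)) (fun x : M ↦ TangentSpace (𝓡 n) x)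
      (EuclideanSpace ℝ (Fin n) →L[ℝ] ℝ) (fun x : M ↦ TangentSpace (𝓡 n) x →L[ℝ] ℝ)
      x₀ y x₀ y b u v =
    b ((trivializationAt (EuclideanSpace ℝ (Fin n)) (TangentSpace (𝓡 n)) x₀).symmL ℝ y u)
      ((trivializationAt (EuclideanSpace ℝ (Fin n)) (TangentSpace (𝓡 n)) x₀).symmL ℝ y v) := by
  have hy' : y ∈ (trivializationAt (EuclideanSpace ℝ (Fin n) →L[ℝ] ℝ)
      (fun x : M ↦ TangentSpace (𝓡 n) x →L[ℝ] ℝ) x₀).baseSet := by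
    rw [hom_trivializationAt_baseSet]
    exact ⟨hy, mem_univ _⟩
  rw [ContinuousLinearMap.inCoordinates, ContinuousLinearMap.comp_apply,
    ContinuousLinearMap.comp_apply, Trivialization.continuousLinearMapAt_apply,
    Trivialization.linearMapAt_apply, if_pos hy', hom_trivializationAt_apply,
    ContinuousLinearMap.inCoordinates, ContinuousLinearMap.comp_apply,
    ContinuousLinearMap.comp_apply, Trivialization.continuousLinearMapAt_apply,
    Trivialization.linearMapAt_apply]
  exact if_pos (mem_univ y)

theorem contMDiffWithinAt_bilin_iff {f : N → M}
    {g : ∀ q : N, TangentSpace (𝓡 n) (f q) →L[ℝ] TangentSpace (𝓡 n) (f q) →L[ℝ] ℝ}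
    {s : Set N} {q₀ : N} (hf : ContMDiffWithinAt I (𝓡 n) r f s q₀) :
    ContMDiffWithinAt I ((𝓡 n).prod 𝓘(ℝ, EuclideanSpace ℝ (Fin n) →L[ℝ] EuclideanSpace ℝ (Fin n) →L[ℝ] ℝ)) r
      (fun q ↦ TotalSpace.mk' (EuclideanSpace ℝ (Fin n) →L[ℝ] EuclideanSpace ℝ (Fin n) →L[ℝ] ℝ)
        (E := fun x : M ↦ TangentSpace (𝓡 n) x →L[ℝ] TangentSpace (𝓡 n) x →L[ℝ] ℝ) (f q) (g q)) s q₀ ↔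
    ∀ a b, ContMDiffWithinAt I 𝓘(ℝ, ℝ) r
      (fun q ↦ g q (coordField (f q₀) a (f q)) (coordField (f q₀) b (f q))) s q₀ := by
  have hmem : ∀ᶠ q in 𝓝[s] q₀,
      f q ∈ (chartAt (EuclideanSpace ℝ (Fin n)) (f q₀)).source :=
    hf.continuousWithinAt.preimage_mem_nhdsWithin
      ((chartAt (EuclideanSpace ℝ (Fin n)) (f q₀)).open_source.mem_nhds (mem_chart_source _ _))
  rw [contMDiffWithinAt_hom_bundle]
  constructor
  · rintro ⟨-, h⟩ a b
    have h' := (h.clm_apply (contMDiffWithinAt_const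
      (c := EuclideanSpace.single a (1 : ℝ)))).clm_apply
        (contMDiffWithinAt_const (c := EuclideanSpace.single b (1 : ℝ)))
    refine h'.congr_of_eventuallyEq ?_ ?_
    · filter_upwards [hmem] with q hq
      exact (inCoordinates_bilin hq _ _ _).symm
    · exact (inCoordinates_bilin (mem_chart_source _ _) _ _ _).symm
  · intro h
    refine ⟨hf, contMDiffWithinAt_clm_of_apply fun a ↦ contMDiffWithinAt_clm_of_apply fun b ↦ ?_⟩
    refine (h a b).congr_of_eventuallyEq ?_ ?_
    · filter_upwards [hmem] with q hq
      exact inCoordinates_bilin hq _ _ _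
    · exact inCoordinates_bilin (mem_chart_source _ _) _ _ _

end Coordinates

/-! ### The exponential in a Banach algebra and its derivative under a trace. -/

section Exp

theorem exp_smul_mul_comm {𝔹 : Type*} [NormedRing 𝔹] [NormedAlgebra ℝ 𝔹] (L : 𝔹) (c : ℝ) :
    NormedSpace.exp (c • L) * L = L * NormedSpace.exp (c • L) :=
  (((Commute.refl L).smul_left c).exp_left).eq

variable {𝔸 : Type*} [NormedRing 𝔸] [CompleteSpace 𝔸]

theorem contDiff_normedSpace_exp [NormedAlgebra ℝ 𝔸] {r : WithTop ℕ∞} :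
    ContDiff ℝ r (NormedSpace.exp : 𝔸 → 𝔸) :=
  AnalyticOnNhd.contDiff fun x _ ↦ NormedSpace.exp_analytic (𝕂 := ℝ) x

theorem hasFDerivAt_normedSpace_exp [NormedAlgebra ℝ 𝔸] (x : 𝔸) :
    HasFDerivAt (NormedSpace.exp : 𝔸 → 𝔸) (fderiv ℝ NormedSpace.exp x) x :=
  (NormedSpace.exp_analytic (𝕂 := ℝ) x).differentiableAt.hasFDerivAt

theorem exp_mul_exp_neg_self [NormedAlgebra ℝ 𝔸] (L : 𝔸) :
    NormedSpace.exp L * NormedSpace.exp (-L) = 1 := by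
  let : NormedAlgebra ℚ 𝔸 := NormedAlgebra.restrictScalars ℚ ℝ 𝔸
  rw [← NormedSpace.exp_add_of_commute ((Commute.refl _).neg_right)]
  simp

theorem exp_neg_self_mul_exp [NormedAlgebra ℝ 𝔸] (L : 𝔸) :
    NormedSpace.exp (-L) * NormedSpace.exp L = 1 := by
  let : NormedAlgebra ℚ 𝔸 := NormedAlgebra.restrictScalars ℚ ℝ 𝔸
  rw [← NormedSpace.exp_add_of_commute ((Commute.refl _).neg_left)]
  simp

theorem exp_eq_exp_half_mul [NormedAlgebra ℝ 𝔸] (L : 𝔸) :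
    NormedSpace.exp L = NormedSpace.exp ((1 / 2 : ℝ) • L) * NormedSpace.exp ((1 / 2 : ℝ) • L) := by
  let : NormedAlgebra ℚ 𝔸 := NormedAlgebra.restrictScalars ℚ ℝ 𝔸
  rw [← NormedSpace.exp_add_of_commute (Commute.refl _), ← add_smul]
  norm_num

/-- The directional derivative of the exponential, up to commutators. -/
theorem tracial_fderiv_exp [NormedAlgebra ℝ 𝔸] (T : 𝔸 →L[ℝ] ℝ) (hT : ∀ a b, T (a * b) = T (b * a))
    (L D X : 𝔸) (hX : Commute L X) :
    T (fderiv ℝ NormedSpace.exp L D * NormedSpace.exp (-L) * X) = T (D * X) := by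
  let : NormedAlgebra ℚ 𝔸 := NormedAlgebra.restrictScalars ℚ ℝ 𝔸
  set f : ℝ → ℝ := fun s ↦
    T (fderiv ℝ NormedSpace.exp (s • L) D * NormedSpace.exp (-(s • L)) * X) with hf
  -- Differentiating `exp A = exp (A/2) * exp (A/2)` at `2sL` gives `(P F + F P)/2`, where `P = exp
  -- (sL)` and `F` is the derivative at `sL`. With `Q = P⁻¹`, cyclicity of `T` and commutation of
  -- `X` with `P` turn both terms, multiplied by `Q Q X`, into `T (F Q X)`.
  have half : ∀ s : ℝ, f (2 * s) = f s := by
    intro s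
    have h1 : (NormedSpace.exp : 𝔸 → 𝔸) =
        fun A ↦ NormedSpace.exp ((1 / 2 : ℝ) • A) * NormedSpace.exp ((1 / 2 : ℝ) • A) :=
      funext exp_eq_exp_half_mul
    have e : (1 / 2 : ℝ) • ((2 * s) • L) = s • L := by
      rw [smul_smul]
      congr 1
      ring
    have h2 : HasFDerivAt (fun A : 𝔸 ↦ NormedSpace.exp ((1 / 2 : ℝ) • A))
        ((fderiv ℝ NormedSpace.exp (s • L)).comp
          ((1 / 2 : ℝ) • ContinuousLinearMap.id ℝ 𝔸)) ((2 * s) • L) := by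
      rw [← e]
      exact (hasFDerivAt_normedSpace_exp _).comp _
        ((ContinuousLinearMap.id ℝ 𝔸).hasFDerivAt.const_smul (1 / 2 : ℝ))
    have h3 := (h2.mul' h2).fderiv
    rw [e] at h3
    have h4 := congrArg (fun A : 𝔸 →L[ℝ] 𝔸 ↦ A D)
      ((congrArg (fun F ↦ fderiv ℝ F ((2 * s) • L)) h1).trans h3)
    have e' : NormedSpace.exp (-((2 * s) • L)) =
        NormedSpace.exp (-(s • L)) * NormedSpace.exp (-(s • L)) := by
      rw [← NormedSpace.exp_add_of_commute (Commute.refl _), ← neg_add, ← add_smul, two_mul]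
    have hPQ := exp_mul_exp_neg_self (s • L)
    have hQP := exp_neg_self_mul_exp (s • L)
    have hPX : NormedSpace.exp (s • L) * X = X * NormedSpace.exp (s • L) :=
      ((hX.smul_left s).exp_left).eq
    simp only [ContinuousLinearMap.comp_apply, _root_.add_apply, _root_.smul_apply,
      ContinuousLinearMap.id_apply, map_smul, smul_eq_mul, MulOpposite.smul_eq_mul_unop,
      MulOpposite.unop_op] at h4
    simp only [hf, h4, e']
    generalize NormedSpace.exp (s • L) = P at *
    generalize NormedSpace.exp (-(s • L)) = Q at *
    generalize (fderiv ℝ NormedSpace.exp (s • L)) D = F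
    have t1 : T (P * F * (Q * Q) * X) = T (F * Q * X) := by
      rw [show P * F * (Q * Q) * X = P * (F * (Q * Q) * X) by simp only [mul_assoc],
        hT, show F * (Q * Q) * X * P = F * Q * (Q * (X * P)) by
          simp only [mul_assoc], ← hPX, ← mul_assoc Q P, hQP, one_mul]
    have t2 : T (F * P * (Q * Q) * X) = T (F * Q * X) := by
      rw [show F * P * (Q * Q) * X = F * (P * Q) * Q * X by simp only [mul_assoc], hPQ, mul_one]
    simp only [add_mul, map_add, mul_smul_comm, smul_mul_assoc, map_smul, t1, t2, smul_eq_mul]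
    ring
  have hcont : Continuous f := by
    have c1 : Continuous fun s : ℝ ↦ fderiv ℝ NormedSpace.exp (s • L) D :=
      (((contDiff_normedSpace_exp (r := 1)).continuous_fderiv one_ne_zero).comp
        (continuous_id.smul continuous_const)).clm_apply continuous_const
    have c2 : Continuous fun s : ℝ ↦ NormedSpace.exp (-(s • L)) :=
      NormedSpace.exp_continuous.comp (continuous_id.smul continuous_const).neg
    exact T.continuous.comp ((c1.mul c2).mul continuous_const)
  have hiter : ∀ k : ℕ, f 1 = f ((1 / 2 : ℝ) ^ k) := by
    intro k
    induction k with
    | zero => simp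
    | succ k ih =>
      rw [ih, ← show 2 * (1 / 2 : ℝ) ^ (k + 1) = (1 / 2) ^ k by rw [pow_succ]; ring]
      exact half _
  have hlim : Tendsto (fun k : ℕ ↦ f ((1 / 2 : ℝ) ^ k)) atTop (𝓝 (f 0)) :=
    (hcont.tendsto 0).comp (tendsto_pow_atTop_nhds_zero_of_lt_one (by norm_num) (by norm_num))
  -- Invariance under halving and continuity force `f 1 = f 0`, and at `0` the derivative of the
  -- exponential is the identity.
  have h10 : f 1 = f 0 := tendsto_nhds_unique (tendsto_const_nhds.congr hiter) hlim
  have h0 : fderiv ℝ (NormedSpace.exp : 𝔸 → 𝔸) 0 = 1 :=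
    (hasFDerivAt_exp_zero (𝕂 := ℝ) (𝔸 := 𝔸)).fderiv
  simpa [hf, h0] using h10

theorem AlgHom.map_normedSpace_exp {𝔹 : Type*} [NormedRing 𝔹] [NormedAlgebra ℝ 𝔹]
    [NormedAlgebra ℝ 𝔸] [FiniteDimensional ℝ 𝔸] (F : 𝔸 →ₐ[ℝ] 𝔹) (x : 𝔸) :
    F (NormedSpace.exp x) = NormedSpace.exp (F x) :=
  let : NormedAlgebra ℚ 𝔸 := NormedAlgebra.restrictScalars ℚ ℝ 𝔸
  let : NormedAlgebra ℚ 𝔹 := NormedAlgebra.restrictScalars ℚ ℝ 𝔹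
  NormedSpace.map_exp F (LinearMap.continuous_of_finiteDimensional F.toLinearMap) x

end Exp

/-! ### Regularity of matrix exponentials, inverses and products, entry by entry. -/

section MatrixExp

variable {n : ℕ}

attribute [local instance] Matrix.linftyOpNormedRing Matrix.linftyOpNormedAlgebra

/-- Derivative of the exponential of a curve of matrices. -/
theorem hasDerivAt_matrix_exp {L : ℝ → Matrix (Fin n) (Fin n) ℝ} {D : Matrix (Fin n) (Fin n) ℝ}
    {t : ℝ} (hL : ∀ i j, HasDerivAt (fun s ↦ L s i j) (D i j) t) :
    ∃ D' : Matrix (Fin n) (Fin n) ℝ,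
      (∀ i j, HasDerivAt (fun s ↦ NormedSpace.exp (L s) i j) (D' i j) t) ∧
      ∀ X, Commute (L t) X → (D' * NormedSpace.exp (-L t) * X).trace = (D * X).trace := by
  have hL' : HasDerivAt L D t := by
    have key : L = fun s ↦ ∑ i, ∑ j, L s i j • Matrix.single i j (1 : ℝ) := by
      funext s
      conv_lhs => rw [Matrix.matrix_eq_sum_single (L s)]
      simp
    have key' : D = ∑ i, ∑ j, D i j • Matrix.single i j (1 : ℝ) := by
      conv_lhs => rw [Matrix.matrix_eq_sum_single D]
      simp
    rw [key, key']
    exact HasDerivAt.fun_sum fun i _ ↦ HasDerivAt.fun_sum fun j _ ↦ (hL i j).smul_const _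
  refine ⟨fderiv ℝ NormedSpace.exp (L t) D, fun i j ↦ ?_, fun X hX ↦ ?_⟩
  · exact ((LinearMap.toContinuousLinearMap (Matrix.entryLinearMap ℝ ℝ i j)).hasFDerivAt.comp_hasDerivAt t
      ((hasFDerivAt_normedSpace_exp (L t)).comp_hasDerivAt t hL'))
  · exact tracial_fderiv_exp (LinearMap.toContinuousLinearMap (Matrix.traceLinearMap (Fin n) ℝ ℝ))
      (fun a b ↦ Matrix.trace_mul_comm a b) (L t) D X hX

variable {F : Type*} [NormedAddCommGroup F] [NormedSpace ℝ F] {H : Type*} [TopologicalSpace H]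
  {I : ModelWithCorners ℝ F H} {N : Type*} [TopologicalSpace N] [ChartedSpace H N]
  {r : WithTop ℕ∞}

theorem contMDiffWithinAt_comp_sum {𝔹 ι : Type*} [NormedAddCommGroup 𝔹] [NormedSpace ℝ 𝔹]
    [Fintype ι] {a : N → ι → ℝ} {s : Set N} {q₀ : N} (e : ι → 𝔹) {Ψ : 𝔹 → 𝔹} (l : 𝔹 →L[ℝ] ℝ)
    (hΨ : ContDiffAt ℝ r Ψ (∑ i, a q₀ i • e i))
    (ha : ∀ i, ContMDiffWithinAt I 𝓘(ℝ, ℝ) r (fun q ↦ a q i) s q₀) :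
    ContMDiffWithinAt I 𝓘(ℝ, ℝ) r (fun q ↦ l (Ψ (∑ i, a q i • e i))) s q₀ :=
  l.contMDiff.contMDiffAt.comp_contMDiffWithinAt q₀
    (hΨ.contMDiffAt.comp_contMDiffWithinAt q₀
      (f := fun q ↦ ∑ i, a q i • e i)
      (ContMDiffWithinAt.sum fun i _ ↦ (ha i).smul contMDiffWithinAt_const))

theorem contMDiffWithinAt_matrix_map {A : N → Matrix (Fin n) (Fin n) ℝ} {s : Set N} {q₀ : N}
    {Ψ : Matrix (Fin n) (Fin n) ℝ → Matrix (Fin n) (Fin n) ℝ} (hΨ : ContDiffAt ℝ r Ψ (A q₀))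
    (hA : ∀ i j, ContMDiffWithinAt I 𝓘(ℝ, ℝ) r (fun q ↦ A q i j) s q₀) (i j : Fin n) :
    ContMDiffWithinAt I 𝓘(ℝ, ℝ) r (fun q ↦ Ψ (A q) i j) s q₀ := by
  have key : ∀ q, A q = ∑ ij : Fin n × Fin n, A q ij.1 ij.2 • Matrix.single ij.1 ij.2 (1 : ℝ) := by
    intro q
    rw [Fintype.sum_prod_type]
    conv_lhs => rw [Matrix.matrix_eq_sum_single (A q)]
    simp
  rw [key q₀] at hΨ
  have := contMDiffWithinAt_comp_sum (I := I) (s := s)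
    (a := fun q (ij : Fin n × Fin n) ↦ A q ij.1 ij.2)
    (fun ij : Fin n × Fin n ↦ Matrix.single ij.1 ij.2 (1 : ℝ))
    (LinearMap.toContinuousLinearMap (Matrix.entryLinearMap ℝ ℝ i j)) hΨ (fun ij ↦ hA ij.1 ij.2)
  simp only [← key] at this
  exact this

theorem contMDiffWithinAt_matrix_exp {A : N → Matrix (Fin n) (Fin n) ℝ} {s : Set N} {q₀ : N}
    (hA : ∀ i j, ContMDiffWithinAt I 𝓘(ℝ, ℝ) r (fun q ↦ A q i j) s q₀) (i j : Fin n) :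
    ContMDiffWithinAt I 𝓘(ℝ, ℝ) r (fun q ↦ NormedSpace.exp (A q) i j) s q₀ :=
  contMDiffWithinAt_matrix_map contDiff_normedSpace_exp.contDiffAt hA i j

theorem contMDiffWithinAt_matrix_inv {A : N → Matrix (Fin n) (Fin n) ℝ} {s : Set N} {q₀ : N}
    (hA : ∀ i j, ContMDiffWithinAt I 𝓘(ℝ, ℝ) r (fun q ↦ A q i j) s q₀) (h0 : IsUnit (A q₀))
    (i j : Fin n) : ContMDiffWithinAt I 𝓘(ℝ, ℝ) r (fun q ↦ (A q)⁻¹ i j) s q₀ := by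
  refine contMDiffWithinAt_matrix_map (Ψ := fun B ↦ B⁻¹) ?_ hA i j
  obtain ⟨u, hu⟩ := h0
  rw [← hu]
  have := contDiffAt_ringInverse ℝ u (n := r)
  rwa [show (fun B : Matrix (Fin n) (Fin n) ℝ ↦ B⁻¹) = Ring.inverse from
    funext fun B ↦ Matrix.nonsing_inv_eq_ringInverse B]

theorem contMDiffWithinAt_matrix_mul {A B : N → Matrix (Fin n) (Fin n) ℝ} {s : Set N} {q₀ : N}
    (hA : ∀ i j, ContMDiffWithinAt I 𝓘(ℝ, ℝ) r (fun q ↦ A q i j) s q₀)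
    (hB : ∀ i j, ContMDiffWithinAt I 𝓘(ℝ, ℝ) r (fun q ↦ B q i j) s q₀)
    (i j : Fin n) : ContMDiffWithinAt I 𝓘(ℝ, ℝ) r (fun q ↦ (A q * B q) i j) s q₀ := by
  simp only [Matrix.mul_apply]
  exact ContMDiffWithinAt.sum fun k _ ↦ (hA i k).mul (hB k j)

end MatrixExp

/-! ### Matrices of exponentials and invertibility of definite forms. -/

section LinearAlgebra

variable {n : ℕ}

attribute [local instance] Matrix.linftyOpNormedRing Matrix.linftyOpNormedAlgebra

local notation "𝔼" => EuclideanSpace ℝ (Fin n)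

theorem toMatrix_exp (B : Module.Basis (Fin n) ℝ 𝔼) (K : 𝔼 →L[ℝ] 𝔼) :
    LinearMap.toMatrix B B (NormedSpace.exp K : 𝔼 →L[ℝ] 𝔼) =
      NormedSpace.exp (LinearMap.toMatrix B B (K : 𝔼 →ₗ[ℝ] 𝔼)) := by
  let F : (𝔼 →L[ℝ] 𝔼) →ₐ[ℝ] Matrix (Fin n) (Fin n) ℝ :=
    ((LinearMap.toMatrixAlgEquiv B).toAlgHom).comp
      (Module.End.toContinuousLinearMap 𝔼).symm.toAlgHom
  exact AlgHom.map_normedSpace_exp F K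

/-- Definiteness gives injectivity, and the space and its dual have equal dimension. -/
theorem isInvertible_of_pos (b : 𝔼 →L[ℝ] 𝔼 →L[ℝ] ℝ) (hb : ∀ v, v ≠ 0 → 0 < b v v) :
    b.IsInvertible := by
  have hinj : Function.Injective b := by
    rw [injective_iff_map_eq_zero]
    intro v hv
    by_contra h
    have := hb v h
    rw [hv] at this
    simp at this
  have hdim : Module.finrank ℝ 𝔼 = Module.finrank ℝ (𝔼 →L[ℝ] ℝ) := by
    rw [← LinearEquiv.finrank_eq (LinearMap.toContinuousLinearMap (𝕜 := ℝ) (E := 𝔼) (F' := ℝ))]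
    exact (Subspace.dual_finrank_eq (K := ℝ) (V := 𝔼)).symm
  exact ⟨(LinearEquiv.ofInjectiveOfFinrankEq b.toLinearMap hinj hdim).toContinuousLinearEquiv, by
    ext; rfl⟩

end LinearAlgebra


/-! ### Exponentials of self-adjoint endomorphisms and raising of indices. -/

section ExpField

variable {n : ℕ}

local notation "𝔼" => EuclideanSpace ℝ (Fin n)

/-- Each power of `A` is self-adjoint, and the exponential series may be summed inside the form. -/
theorem exp_selfAdjoint (b : 𝔼 →L[ℝ] 𝔼 →L[ℝ] ℝ) (A : 𝔼 →L[ℝ] 𝔼)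
    (hA : ∀ v w, b (A v) w = b v (A w)) (v w : 𝔼) :
    b (NormedSpace.exp A v) w = b v (NormedSpace.exp A w) := by
  have hpow : ∀ k v w, b ((A ^ k) v) w = b v ((A ^ k) w) := by
    intro k
    induction k with
    | zero => simp
    | succ k ih =>
      intro v w
      rw [pow_succ, mul_apply_eq_comp, ih, hA, ← mul_apply_eq_comp,
        ← pow_succ', pow_succ]
  have hs := NormedSpace.exp_series_hasSum_exp' (𝕂 := ℝ) A
  have h1 := hs.mapL ((b.flip w).comp (ContinuousLinearMap.apply ℝ 𝔼 v))
  have h2 := hs.mapL ((b v).comp (ContinuousLinearMap.apply ℝ 𝔼 w))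
  refine h1.unique ?_
  convert! h2 using 1
  funext k
  simp only [map_smul]
  exact congrArg _ (hpow k v w)

theorem exp_apply_ne_zero (A : 𝔼 →L[ℝ] 𝔼) {v : 𝔼} (hv : v ≠ 0) : NormedSpace.exp A v ≠ 0 := by
  intro h
  apply hv
  have := congrArg (fun B : 𝔼 →L[ℝ] 𝔼 ↦ B v) (exp_neg_self_mul_exp A)
  simpa [h] using this.symm

/-- Writing `exp A` as the square of `exp (A/2)` and moving one factor across gives `b u u` with `u
= exp (A/2) v ≠ 0`. -/
theorem exp_pos_of_selfAdjoint (b : 𝔼 →L[ℝ] 𝔼 →L[ℝ] ℝ) (A : 𝔼 →L[ℝ] 𝔼)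
    (hA : ∀ v w, b (A v) w = b v (A w)) (hb : ∀ v, v ≠ 0 → 0 < b v v) {v : 𝔼} (hv : v ≠ 0) :
    0 < b (NormedSpace.exp A v) v := by
  rw [exp_eq_exp_half_mul A, mul_apply_eq_comp, exp_selfAdjoint b _ (by simpa using hA)]
  exact hb _ (exp_apply_ne_zero _ hv)

theorem exp_apply_eigenvector {V : Type*} [NormedAddCommGroup V] [NormedSpace ℝ V]
    [CompleteSpace V] (A : V →L[ℝ] V) {v : V} {c : ℝ} (hv : A v = c • v) :
    NormedSpace.exp A v = Real.exp c • v := by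
  have hpow : ∀ k, (A ^ k) v = c ^ k • v := by
    intro k
    induction k with
    | zero => simp
    | succ k ih =>
      rw [pow_succ, mul_apply_eq_comp, hv, map_smul, ih, smul_smul, pow_succ']
  have h1 := (NormedSpace.exp_series_hasSum_exp' (𝕂 := ℝ) A).mapL (ContinuousLinearMap.apply ℝ V v)
  have h2 := (NormedSpace.exp_series_hasSum_exp' (𝕂 := ℝ) c).smul_const v
  rw [← Real.exp_eq_exp_ℝ] at h2
  refine h1.unique ?_
  convert! h2 using 1
  funext k
  simp [hpow, smul_smul]

theorem exp_smul_apply_comm (A : 𝔼 →L[ℝ] 𝔼) (c : ℝ) (v : 𝔼) :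
    NormedSpace.exp (c • A) (A v) = A (NormedSpace.exp (c • A) v) :=
  congrArg (fun B : 𝔼 →L[ℝ] 𝔼 ↦ B v) (exp_smul_mul_comm A c)

theorem hasDerivAt_exp_smul_apply {V : Type*} [NormedAddCommGroup V] [NormedSpace ℝ V]
    [CompleteSpace V] (A : V →L[ℝ] V) {u : ℝ → ℝ} {u' t : ℝ} (hu : HasDerivAt u u' t)
    (v : V) : HasDerivAt (fun s ↦ NormedSpace.exp (u s • A) v)
      (u' • A (NormedSpace.exp (u t • A) v)) t := by
  have := ((hasDerivAt_exp_smul_const' (𝕂 := ℝ) A (u t)).scomp t hu).clm_apply (hasDerivAt_const t v)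
  simpa using this

variable {M : Type*} [TopologicalSpace M] [ChartedSpace (EuclideanSpace ℝ (Fin n)) M]

/-- The exponential of a field of endomorphisms. -/
def expField (K : EndField n M) : EndField n M :=
  fun x ↦ (NormedSpace.exp (K x : 𝔼 →L[ℝ] 𝔼) : 𝔼 →L[ℝ] 𝔼)

/-- Positivity is essential here: `inverse` takes the default value zero on a map that is not
invertible, and only for an invertible `g x` does `raise` raise an index. -/
theorem raise_apply (g b : BilinField n M) (x : M) (hg : ∀ v, v ≠ 0 → 0 < g x v v)
    (v w : TangentSpace (𝓡 n) x) : g x (raise g b x v) w = b x v w := by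
  have h1 : (g x) ((g x).inverse (b x v)) = b x v :=
    (isInvertible_of_pos (g x) hg).self_apply_inverse (b x v)
  exact congrArg (fun f ↦ f w) h1

theorem raise_comp (g : BilinField n M) (K : EndField n M) (x : M)
    (hg : ∀ v, v ≠ 0 → 0 < g x v v) :
    raise g (fun y ↦ g y ∘L K y) x = K x := by
  ext1 v
  exact (isInvertible_of_pos (g x) hg).inverse_apply_self (K x v)

variable [IsManifold (𝓡 n) ∞ M]

theorem compMatrix_expField (K : EndField n M) (x₀ y : M)
    (hy : y ∈ (chartAt (EuclideanSpace ℝ (Fin n)) x₀).source) :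
    compMatrix (expField K) x₀ y = NormedSpace.exp (compMatrix K x₀ y) := by
  rw [compMatrix_eq_toMatrix _ x₀ y hy, compMatrix_eq_toMatrix K x₀ y hy]
  exact toMatrix_exp (frame x₀ y hy) (K y)

end ExpField

/-! ### Partial derivatives along coordinate lines and the divergence in coordinates. -/

section Divergence

variable {n : ℕ} {M : Type*} [TopologicalSpace M] [ChartedSpace (EuclideanSpace ℝ (Fin n)) M]

/-- The coordinate line through `x` in the direction `∂_a`. -/
def coordLine (x : M) (a : Fin n) (ε : ℝ) : M :=
  (extChartAt (𝓡 n) x).symm (extChartAt (𝓡 n) x x + ε • EuclideanSpace.single a (1 : ℝ))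

theorem coordLine_zero (x : M) (a : Fin n) : coordLine x a 0 = x := by
  simp [coordLine]

theorem coordLine_mem_source (x : M) (a : Fin n) :
    ∀ᶠ ε in 𝓝 (0 : ℝ), coordLine x a ε ∈ (chartAt (EuclideanSpace ℝ (Fin n)) x).source := by
  have hc : ContinuousAt (coordLine x a) 0 := by
    have h1 : ContinuousAt (extChartAt (𝓡 n) x).symm
        (extChartAt (𝓡 n) x x + (0 : ℝ) • EuclideanSpace.single a (1 : ℝ)) := by
      simpa using continuousAt_extChartAt_symm (I := 𝓡 n) x
    exact h1.comp (f := fun ε : ℝ ↦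
      extChartAt (𝓡 n) x x + ε • EuclideanSpace.single a (1 : ℝ)) (by fun_prop)
  apply hc.preimage_mem_nhds
  rw [coordLine_zero]
  exact (chartAt (EuclideanSpace ℝ (Fin n)) x).open_source.mem_nhds (mem_chart_source _ x)

variable [IsManifold (𝓡 n) ∞ M]

/-- Partial derivatives are derivatives along coordinate lines. -/
theorem hasDerivAt_coordLine (x : M) (a : Fin n) {f : M → ℝ}
    (hf : MDifferentiableAt (𝓡 n) 𝓘(ℝ, ℝ) f x) :
    HasDerivAt (fun ε ↦ f (coordLine x a ε)) (partialD x a f) 0 := by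
  set e : EuclideanSpace ℝ (Fin n) := EuclideanSpace.single a 1
  have hinv : (extChartAt (𝓡 n) x).symm (extChartAt (𝓡 n) x x) = x := extChartAt_to_inv x
  have hsymm : MDifferentiableAt 𝓘(ℝ, EuclideanSpace ℝ (Fin n)) (𝓡 n) (extChartAt (𝓡 n) x).symm
      (extChartAt (𝓡 n) x x) := by
    have := mdifferentiableWithinAt_extChartAt_symm (I := 𝓡 n) (mem_extChartAt_target (I := 𝓡 n) x)
    rwa [modelWithCornersSelf_coe, range_id, mdifferentiableWithinAt_univ] at this
  have hf' : MDifferentiableAt (𝓡 n) 𝓘(ℝ, ℝ) f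
      ((extChartAt (𝓡 n) x).symm (extChartAt (𝓡 n) x x)) := by
    rwa [hinv]
  have hcomp := hf'.comp _ hsymm
  have hD : HasFDerivAt (f ∘ (extChartAt (𝓡 n) x).symm)
      (fderiv ℝ (f ∘ (extChartAt (𝓡 n) x).symm) (extChartAt (𝓡 n) x x))
      (extChartAt (𝓡 n) x x) := hcomp.differentiableAt.hasFDerivAt
  have hval : fderiv ℝ (f ∘ (extChartAt (𝓡 n) x).symm) (extChartAt (𝓡 n) x x) e =
      partialD x a f := by
    have h1 := mfderiv_comp_apply (extChartAt (𝓡 n) x x) hf' hsymm e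
    rw [mfderiv_eq_fderiv] at h1
    rw [partialD, coordField_eq x x a (mem_chart_source _ x)]
    simp only [modelWithCornersSelf_coe, range_id, mfderivWithin_univ]
    have h2 : ∀ (y : M) (w : EuclideanSpace ℝ (Fin n)), y = x →
        (mfderiv (𝓡 n) 𝓘(ℝ, ℝ) f y : EuclideanSpace ℝ (Fin n) →L[ℝ] ℝ) w =
          (mfderiv (𝓡 n) 𝓘(ℝ, ℝ) f x : EuclideanSpace ℝ (Fin n) →L[ℝ] ℝ) w := by
      rintro y w rfl
      rfl
    exact h1.trans (h2 _ _ hinv)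
  have hline : HasDerivAt (fun ε : ℝ ↦ extChartAt (𝓡 n) x x + ε • e) e 0 := by
    simpa using ((hasDerivAt_id (0 : ℝ)).smul_const e).const_add (extChartAt (𝓡 n) x x)
  rw [← hval]
  have hD' : HasFDerivAt (f ∘ (extChartAt (𝓡 n) x).symm)
      (fderiv ℝ (f ∘ (extChartAt (𝓡 n) x).symm) (extChartAt (𝓡 n) x x))
      (extChartAt (𝓡 n) x x + (0 : ℝ) • e) := by
    rwa [zero_smul, add_zero]
  exact hD'.comp_hasDerivAt (f := fun ε : ℝ ↦ extChartAt (𝓡 n) x x + ε • e) 0 hline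

theorem partialD_eq_of_hasDerivAt (x : M) (a : Fin n) {f : M → ℝ} {c : ℝ}
    (hf : MDifferentiableAt (𝓡 n) 𝓘(ℝ, ℝ) f x)
    (hc : HasDerivAt (fun ε ↦ f (coordLine x a ε)) c 0) : partialD x a f = c :=
  (hasDerivAt_coordLine x a hf).unique hc

theorem coordForm_coordField (x : M) (a b : Fin n) :
    coordForm x a x (coordField x b x) = if a = b then 1 else 0 := by
  rw [← frame_repr x x (mem_chart_source _ x), ← frame_apply x x (mem_chart_source _ x)]
  simp [Finsupp.single_apply, eq_comm]

theorem oneForm_ext {x : M} {θ η : TangentSpace (𝓡 n) x →L[ℝ] ℝ}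
    (h : ∀ b, θ (coordField x b x) = η (coordField x b x)) : θ = η := by
  refine ContinuousLinearMap.coe_injective ((frame x x (mem_chart_source _ x)).ext fun b ↦ ?_)
  rw [frame_apply]
  exact h b

/-- The matrix of the partial derivatives of the metric components. -/
def gramD (g : BilinField n M) (x : M) (c : Fin n) : Matrix (Fin n) (Fin n) ℝ :=
  Matrix.of fun a b ↦ partialD x c fun y ↦ gram g x y a b

theorem divergence_coordField_eq_sum (g : BilinField n M) (K : EndField n M) (x : M) (b : Fin n) :
    divergence g K x (coordField x b x) =
      ∑ a, (partialD x a (fun y ↦ comp K x y a b)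
      + ∑ c, (christoffel g x a a c * comp K x x c b
        - christoffel g x c a b * comp K x x a c)) := by
  simp [divergence, coordForm_coordField]

/-- The first and third derivative terms are exchanged by swapping `a` and `d`, so they cancel
against a symmetric `N`. This is applied to `N = G⁻¹` and to `N = K G⁻¹`, which reduces all
Christoffel terms of the divergence to traces. -/
theorem sum_symm_mul_christoffel {N : Matrix (Fin n) (Fin n) ℝ}
    {dG : Fin n → Matrix (Fin n) (Fin n) ℝ} (hN : N.transpose = N) (b : Fin n) :
    ∑ a, ∑ d, N a d * (dG a d b + dG b d a - dG d a b) = (N * dG b).trace := by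
  have hN' : ∀ a d, N a d = N d a := fun a d ↦ (congrFun (congrFun hN a) d).symm
  have h : ∑ a, ∑ d, N a d * dG d a b = ∑ a, ∑ d, N a d * dG a d b := by
    rw [Finset.sum_comm]
    exact Finset.sum_congr rfl fun a _ ↦ Finset.sum_congr rfl fun d _ ↦ by rw [hN']
  simp only [mul_sub, mul_add, Finset.sum_sub_distrib, Finset.sum_add_distrib, h]
  simp only [Matrix.trace, Matrix.diag_apply, Matrix.mul_apply]
  ring

/-- The components of the divergence of a self-adjoint endomorphism field. -/
theorem divergence_coordField (g : BilinField n M) (K : EndField n M) (x : M) (b : Fin n)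
    (hg : ∀ v w, g x v w = g x w v) (hu : IsUnit (gram g x x))
    (hK : (compMatrix K x x).transpose * gram g x x = gram g x x * compMatrix K x x) :
    divergence g K x (coordField x b x) =
      ∑ a, partialD x a (fun y ↦ comp K x y a b)
      + (1 / 2) * ∑ c, ((gram g x x)⁻¹ * gramD g x c).trace * compMatrix K x x c b
      - (1 / 2) * (compMatrix K x x * (gram g x x)⁻¹ * gramD g x b).trace := by
  have hG : (gram g x x).transpose = gram g x x := gram_isSymm g x x hg
  have hGi : ((gram g x x)⁻¹).transpose = (gram g x x)⁻¹ := by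
    rw [Matrix.transpose_nonsing_inv, hG]
  -- Symmetry of `K^{ab}`, that is, self-adjointness with an index raised.
  have hN : (compMatrix K x x * (gram g x x)⁻¹).transpose = compMatrix K x x * (gram g x x)⁻¹ := by
    rw [Matrix.transpose_mul, hGi]
    have hd := (Matrix.isUnit_iff_isUnit_det _).1 hu
    calc _ = (gram g x x)⁻¹ * ((compMatrix K x x).transpose * gram g x x) * (gram g x x)⁻¹ := by
          rw [mul_assoc, mul_assoc, Matrix.mul_nonsing_inv _ hd, mul_one]
      _ = _ := by
          rw [hK, ← mul_assoc, Matrix.nonsing_inv_mul _ hd, one_mul]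
  rw [divergence_coordField_eq_sum]
  generalize hGe : (gram g x x)⁻¹ = Gi at *
  have hκ : ∀ a c, comp K x x a c = compMatrix K x x a c := fun _ _ ↦ rfl
  have hdG : ∀ c a b, partialD x c (fun y ↦ gram g x y a b) = gramD g x c a b := fun _ _ _ ↦ rfl
  simp only [christoffel, hκ, hdG, hGe]
  generalize compMatrix K x x = κ at *
  generalize gramD g x = dG at *
  have t1 : ∀ c, ∑ a, (1 / 2) * ∑ d, Gi a d * (dG a d c + dG c d a - dG d a c) =
      (1 / 2) * (Gi * dG c).trace := by
    intro c
    rw [← sum_symm_mul_christoffel hGi c, Finset.mul_sum]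
  have t2 : ∑ a, ∑ c, (1 / 2) * (∑ d, Gi c d * (dG a d b + dG b d a - dG d a b)) * κ a c =
      (1 / 2) * (κ * Gi * dG b).trace := by
    rw [← sum_symm_mul_christoffel hN b, Finset.mul_sum]
    refine Finset.sum_congr rfl fun a _ ↦ ?_
    simp only [Matrix.mul_apply, Finset.sum_mul, Finset.mul_sum]
    rw [Finset.sum_comm]
    exact Finset.sum_congr rfl fun _ _ ↦ Finset.sum_congr rfl fun _ _ ↦ by ring
  rw [Finset.sum_add_distrib]
  simp only [Finset.sum_sub_distrib]
  rw [t2, Finset.sum_comm]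
  simp only [← Finset.sum_mul, t1]
  rw [Finset.mul_sum]
  simp only [mul_assoc, ← Finset.mul_sum]
  ring

end Divergence

/-! ### Change of the divergence when the metric is twisted by an exponential. -/

section DivergenceTransformation

variable {n : ℕ} {M : Type*} [TopologicalSpace M] [ChartedSpace (EuclideanSpace ℝ (Fin n)) M]

theorem smul_selfAdjoint (g : BilinField n M) (f : M → ℝ) (K : EndField n M) (y : M)
    (hK : ∀ v w, g y (K y v) w = g y v (K y w)) (v w : TangentSpace (𝓡 n) y) :
    g y ((f y • K y) v) w = g y v ((f y • K y) w) := by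
  simp only [_root_.smul_apply, map_smul, hK]

/-- The metric `g (exp (f K) ·, ·)`. -/
def expMetric (g : BilinField n M) (f : M → ℝ) (K : EndField n M) : BilinField n M :=
  fun y ↦ g y ∘L expField (fun z ↦ f z • K z) y

theorem expMetric_symm (g : BilinField n M) (f : M → ℝ) (K : EndField n M) (y : M)
    (hg : ∀ v w, g y v w = g y w v) (hK : ∀ v w, g y (K y v) w = g y v (K y w))
    (v w : TangentSpace (𝓡 n) y) : expMetric g f K y v w = expMetric g f K y w v := by
  have h := exp_selfAdjoint (g y) (f y • K y) (smul_selfAdjoint g f K y hK) v w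
  exact h.trans (hg _ _)

theorem expMetric_pos (g : BilinField n M) (f : M → ℝ) (K : EndField n M) (y : M)
    (hg : ∀ v, v ≠ 0 → 0 < g y v v) (hK : ∀ v w, g y (K y v) w = g y v (K y w))
    (v : TangentSpace (𝓡 n) y) (hv : v ≠ 0) : 0 < expMetric g f K y v v :=
  exp_pos_of_selfAdjoint (g y) (f y • K y) (smul_selfAdjoint g f K y hK) hg hv

/-- `K` commutes with `exp (f K)`, so twisting the metric preserves self-adjointness of `K`. -/
theorem expMetric_selfAdjoint (g : BilinField n M) (f : M → ℝ) (K : EndField n M) (y : M)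
    (hK : ∀ v w, g y (K y v) w = g y v (K y w)) (v w : TangentSpace (𝓡 n) y) :
    expMetric g f K y (K y v) w = expMetric g f K y v (K y w) := by
  have h1 : expMetric g f K y (K y v) w = g y (K y (expField (fun z ↦ f z • K z) y v)) w :=
    congrArg (fun u ↦ g y u w) (exp_smul_apply_comm (K y) (f y) v)
  rw [h1, hK]
  rfl

variable [IsManifold (𝓡 n) ∞ M]

theorem oneForm_comp_coordField (K : EndField n M) (x : M) (θ : TangentSpace (𝓡 n) x →L[ℝ] ℝ)
    (b : Fin n) :
    θ (K x (coordField x b x)) = ∑ a, θ (coordField x a x) * comp K x x a b := by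
  have h := (frame x x (mem_chart_source _ x)).sum_repr (K x (coordField x b x))
  simp only [frame_repr, frame_apply] at h
  conv_lhs => rw [← h]
  simp only [map_sum, map_smul, smul_eq_mul, comp]
  exact Finset.sum_congr rfl fun _ _ ↦ mul_comm _ _

/-- Leibniz rule: the Christoffel terms are linear over functions, so only the partial derivative
contributes `df ∘ K`. -/
theorem divergence_smul (g : BilinField n M) (K : EndField n M) (f : M → ℝ) (x : M)
    (hf : MDifferentiableAt (𝓡 n) 𝓘(ℝ, ℝ) f x)
    (hK : ∀ a b, MDifferentiableAt (𝓡 n) 𝓘(ℝ, ℝ) (fun y ↦ comp K x y a b) x) :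
    divergence g (fun y ↦ f y • K y) x = f x • divergence g K x + mvfderiv (𝓡 n) f x ∘L K x := by
  have hc : ∀ y a b, comp (fun y ↦ f y • K y) x y a b = f y * comp K x y a b := by
    intro y a b
    simp [comp]
  refine oneForm_ext fun b ↦ ?_
  rw [_root_.add_apply, _root_.smul_apply, ContinuousLinearMap.comp_apply,
    oneForm_comp_coordField, divergence_coordField_eq_sum, divergence_coordField_eq_sum,
    smul_eq_mul, Finset.mul_sum, ← Finset.sum_add_distrib]
  refine Finset.sum_congr rfl fun a _ ↦ ?_
  have hp : partialD x a (fun y ↦ f y * comp K x y a b) =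
      partialD x a f * comp K x x a b + f x * partialD x a fun y ↦ comp K x y a b := by
    refine partialD_eq_of_hasDerivAt x a (hf.mul (hK a b)) ?_
    have := (hasDerivAt_coordLine x a hf).mul (hasDerivAt_coordLine x a (hK a b))
    simpa only [coordLine_zero] using! this
  simp only [hc, hp]
  rw [show mvfderiv (𝓡 n) f x (coordField x a x) = partialD x a f from rfl, mul_add, Finset.mul_sum]
  have : ∀ c, christoffel g x a a c * (f x * comp K x x c b)
      - christoffel g x c a b * (f x * comp K x x a c) =
      f x * (christoffel g x a a c * comp K x x c b - christoffel g x c a b * comp K x x a c) :=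
    fun c ↦ by ring
  simp only [this]
  ring

theorem gram_expMetric (g : BilinField n M) (f : M → ℝ) (K : EndField n M) (x₀ y : M)
    (hy : y ∈ (chartAt (EuclideanSpace ℝ (Fin n)) x₀).source) :
    gram (expMetric g f K) x₀ y =
      (NormedSpace.exp (f y • compMatrix K x₀ y)).transpose * gram g x₀ y := by
  refine (gram_comp g (expField fun z ↦ f z • K z) x₀ y hy).trans ?_
  rw [compMatrix_expField _ x₀ y hy, compMatrix_smul]

theorem compMatrix_transpose_mul_gram (g : BilinField n M) (K : EndField n M) (x₀ y : M)
    (hy : y ∈ (chartAt (EuclideanSpace ℝ (Fin n)) x₀).source)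
    (hg : ∀ v w, g y v w = g y w v) (hK : ∀ v w, g y (K y v) w = g y v (K y w)) :
    (compMatrix K x₀ y).transpose * gram g x₀ y = gram g x₀ y * compMatrix K x₀ y := by
  have h : gram (fun z ↦ g z ∘L K z) x₀ y = (gram (fun z ↦ g z ∘L K z) x₀ y).transpose := by
    ext a b
    exact (hK _ _).trans (hg _ _)
  rw [gram_comp g K x₀ y hy] at h
  rw [h, Matrix.transpose_mul, Matrix.transpose_transpose, gram_isSymm g x₀ y hg]

theorem trSq_eq_trace (K : EndField n M) (x₀ y : M)
    (hy : y ∈ (chartAt (EuclideanSpace ℝ (Fin n)) x₀).source) :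
    trSq K y = (compMatrix K x₀ y * compMatrix K x₀ y).trace := by
  rw [trSq, tr_eq_trace_compMatrix _ x₀ y hy, compMatrix_comp K K x₀ y hy]

/-- The partial derivatives of the components of `K`. -/
def compD (K : EndField n M) (x : M) (c : Fin n) : Matrix (Fin n) (Fin n) ℝ :=
  Matrix.of fun a b ↦ partialD x c fun y ↦ comp K x y a b

theorem trace_compD (K : EndField n M) (x : M) (c : Fin n) (hK1 : ∀ y, tr K y = 1)
    (hK : ∀ a b, MDifferentiableAt (𝓡 n) 𝓘(ℝ, ℝ) (fun y ↦ comp K x y a b) x) :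
    (compD K x c).trace = 0 := by
  have h1 : HasDerivAt (fun ε ↦ ∑ a, comp K x (coordLine x c ε) a a) (compD K x c).trace 0 :=
    HasDerivAt.fun_sum fun a _ ↦ hasDerivAt_coordLine x c (hK a a)
  refine h1.unique ((hasDerivAt_const (0 : ℝ) (1 : ℝ)).congr_of_eventuallyEq ?_)
  filter_upwards [coordLine_mem_source x c] with ε hε
  rw [← hK1 (coordLine x c ε), tr_eq_trace_compMatrix K x _ hε]
  rfl

theorem mdifferentiableAt_trSq (K : EndField n M) (x : M)
    (hK : ∀ a b, MDifferentiableAt (𝓡 n) 𝓘(ℝ, ℝ) (fun y ↦ comp K x y a b) x) :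
    MDifferentiableAt (𝓡 n) 𝓘(ℝ, ℝ) (trSq K) x := by
  have h : MDifferentiableAt (𝓡 n) 𝓘(ℝ, ℝ)
      (fun y ↦ ∑ a, ∑ b, comp K x y a b * comp K x y b a) x := by
    have h' : MDifferentiableAt (𝓡 n) 𝓘(ℝ, ℝ) (∑ a, ∑ b,
        (fun y ↦ comp K x y a b) * (fun y ↦ comp K x y b a)) x :=
      MDifferentiableAt.sum fun a _ ↦ MDifferentiableAt.sum fun b _ ↦ (hK a b).mul (hK b a)
    convert! h' using 1
    funext y
    simp [Finset.sum_apply]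
  refine h.congr_of_eventuallyEq ?_
  filter_upwards [(chartAt (EuclideanSpace ℝ (Fin n)) x).open_source.mem_nhds
    (mem_chart_source _ x)] with y hy
  rw [trSq_eq_trace K x y hy]
  rfl

theorem partialD_trSq (K : EndField n M) (x : M) (c : Fin n)
    (hK : ∀ a b, MDifferentiableAt (𝓡 n) 𝓘(ℝ, ℝ) (fun y ↦ comp K x y a b) x) :
    partialD x c (trSq K) = 2 * (compD K x c * compMatrix K x x).trace := by
  refine partialD_eq_of_hasDerivAt x c (mdifferentiableAt_trSq K x hK) ?_
  have h1 : HasDerivAt (fun ε ↦ ∑ a, ∑ b, comp K x (coordLine x c ε) a b *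
      comp K x (coordLine x c ε) b a) (∑ a, ∑ b, (compD K x c a b * comp K x x b a +
        comp K x x a b * compD K x c b a)) 0 := by
    refine HasDerivAt.fun_sum fun a _ ↦ HasDerivAt.fun_sum fun b _ ↦ ?_
    have := (hasDerivAt_coordLine x c (hK a b)).mul (hasDerivAt_coordLine x c (hK b a))
    simpa only [coordLine_zero] using! this
  have h2 : ∑ a, ∑ b, (compD K x c a b * comp K x x b a + comp K x x a b * compD K x c b a) =
      2 * (compD K x c * compMatrix K x x).trace := by
    simp only [Finset.sum_add_distrib]
    rw [two_mul]
    congr 1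
    rw [Finset.sum_comm]
    exact Finset.sum_congr rfl fun _ _ ↦ Finset.sum_congr rfl fun _ _ ↦ mul_comm _ _
  rw [← h2]
  refine h1.congr_of_eventuallyEq ?_
  filter_upwards [coordLine_mem_source x c] with ε hε
  rw [trSq_eq_trace K x _ hε]
  rfl

/-- The partial derivatives of `g (exp (f K) ·, ·)`. -/
theorem gramD_expMetric (g : BilinField n M) (f : M → ℝ) (K : EndField n M) (x : M) (c : Fin n)
    (hg : ∀ a b, ContMDiffAt (𝓡 n) 𝓘(ℝ, ℝ) 1 (fun y ↦ gram g x y a b) x)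
    (hf : ContMDiffAt (𝓡 n) 𝓘(ℝ, ℝ) 1 f x)
    (hK : ∀ a b, ContMDiffAt (𝓡 n) 𝓘(ℝ, ℝ) 1 (fun y ↦ comp K x y a b) x) :
    ∃ D' : Matrix (Fin n) (Fin n) ℝ,
      gramD (expMetric g f K) x c = D'.transpose * gram g x x +
        (NormedSpace.exp (f x • compMatrix K x x)).transpose * gramD g x c ∧
      ∀ X, Commute (compMatrix K x x) X →
        (D' * NormedSpace.exp (-(f x • compMatrix K x x)) * X).trace =
          partialD x c f * (compMatrix K x x * X).trace + f x * (compD K x c * X).trace := by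
  have hfd := hf.mdifferentiableAt one_ne_zero
  have hgd := fun a b ↦ (hg a b).mdifferentiableAt one_ne_zero
  have hKd := fun a b ↦ (hK a b).mdifferentiableAt one_ne_zero
  have hL : ∀ i j, HasDerivAt (fun ε ↦ (f (coordLine x c ε) • compMatrix K x (coordLine x c ε)) i j)
      ((partialD x c f • compMatrix K x x + f x • compD K x c) i j) 0 := by
    intro i j
    have := (hasDerivAt_coordLine x c hfd).mul (hasDerivAt_coordLine x c (hKd i j))
    simpa only [coordLine_zero] using! this
  -- No closed form for the derivative `D'` is available, as `K` and its partial derivatives need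
  -- not commute; only its traces against matrices commuting with `K` are recorded.
  obtain ⟨D', hD', htr⟩ := hasDerivAt_matrix_exp hL
  simp only [coordLine_zero] at htr
  refine ⟨D', ?_, fun X hX ↦ ?_⟩
  · ext i j
    have hsm : ContMDiffAt (𝓡 n) 𝓘(ℝ, ℝ) 1 (fun y ↦ gram (expMetric g f K) x y i j) x := by
      have h1 := contMDiffWithinAt_matrix_exp (I := 𝓡 n) (s := univ) (q₀ := x) (r := 1)
        (A := fun y ↦ f y • compMatrix K x y)
        (fun i j ↦ (hf.mul (hK i j)).contMDiffWithinAt)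
      have h2 := contMDiffWithinAt_matrix_mul (I := 𝓡 n) (s := univ) (q₀ := x) (r := 1)
        (A := fun y ↦ (NormedSpace.exp (f y • compMatrix K x y)).transpose)
        (B := fun y ↦ gram g x y) (fun i j ↦ h1 j i) (fun i j ↦ (hg i j).contMDiffWithinAt) i j
      refine (contMDiffWithinAt_univ.1 h2).congr_of_eventuallyEq ?_
      filter_upwards [(chartAt (EuclideanSpace ℝ (Fin n)) x).open_source.mem_nhds
        (mem_chart_source _ x)] with y hy
      rw [gram_expMetric g f K x y hy]
    refine partialD_eq_of_hasDerivAt x c (hsm.mdifferentiableAt one_ne_zero) ?_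
    have h3 : HasDerivAt (fun ε ↦ ∑ k, NormedSpace.exp (f (coordLine x c ε) •
        compMatrix K x (coordLine x c ε)) k i * gram g x (coordLine x c ε) k j)
        (∑ k, (D' k i * gram g x x k j +
          NormedSpace.exp (f x • compMatrix K x x) k i * gramD g x c k j)) 0 := by
      refine HasDerivAt.fun_sum fun k _ ↦ ?_
      have := (hD' k i).mul (hasDerivAt_coordLine x c (hgd k j))
      simpa only [coordLine_zero] using! this
    have h4 : ∑ k, (D' k i * gram g x x k j +
          NormedSpace.exp (f x • compMatrix K x x) k i * gramD g x c k j) =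
        (D'.transpose * gram g x x +
        (NormedSpace.exp (f x • compMatrix K x x)).transpose * gramD g x c) i j := by
      rw [Finset.sum_add_distrib]
      rfl
    rw [← h4]
    refine h3.congr_of_eventuallyEq ?_
    filter_upwards [coordLine_mem_source x c] with ε hε
    rw [gram_expMetric g f K x _ hε]
    rfl
  · rw [htr X (hX.smul_left _)]
    simp [add_mul, Matrix.trace_add, Matrix.trace_smul]

/-- The divergence of `K` with respect to `g (exp (f K) ·, ·)`. -/
theorem divergence_expMetric (g : BilinField n M) (f : M → ℝ) (K : EndField n M) (x : M)
    (hsymm : ∀ v w, g x v w = g x w v) (hpos : ∀ v, v ≠ 0 → 0 < g x v v)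
    (hself : ∀ v w, g x (K x v) w = g x v (K x w)) (hK1 : ∀ y, tr K y = 1)
    (hg : ∀ a b, ContMDiffAt (𝓡 n) 𝓘(ℝ, ℝ) 1 (fun y ↦ gram g x y a b) x)
    (hf : ContMDiffAt (𝓡 n) 𝓘(ℝ, ℝ) 1 f x)
    (hK : ∀ a b, ContMDiffAt (𝓡 n) 𝓘(ℝ, ℝ) 1 (fun y ↦ comp K x y a b) x) :
    divergence (expMetric g f K) K x = divergence g K x + (1 / 2 : ℝ) • (mvfderiv (𝓡 n) f x ∘L K x)
      - ((1 / 2) * trSq K x) • mvfderiv (𝓡 n) f x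
      - ((1 / 4) * f x) • mvfderiv (𝓡 n) (trSq K) x := by
  have hx := mem_chart_source (EuclideanSpace ℝ (Fin n)) x
  have hKd := fun a b ↦ (hK a b).mdifferentiableAt one_ne_zero
  have hu : IsUnit (gram g x x) := (gram_posDef g x x hsymm hpos hx).isUnit
  have hu' : IsUnit (gram (expMetric g f K) x x) :=
    (gram_posDef _ x x (expMetric_symm g f K x hsymm hself)
      (expMetric_pos g f K x hpos hself) hx).isUnit
  have hκ := compMatrix_transpose_mul_gram g K x x hx hsymm hself
  have hκ' := compMatrix_transpose_mul_gram (expMetric g f K) K x x hx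
    (expMetric_symm g f K x hsymm hself) (expMetric_selfAdjoint g f K x hself)
  choose D hD htr using fun c ↦ gramD_expMetric g f K x c hg hf hK
  refine oneForm_ext fun b ↦ ?_
  simp only [_root_.add_apply, _root_.sub_apply, _root_.smul_apply, ContinuousLinearMap.comp_apply]
  rw [oneForm_comp_coordField, divergence_coordField _ K x b hsymm hu hκ,
    divergence_coordField _ K x b (expMetric_symm g f K x hsymm hself) hu' hκ']
  simp only [hD, gram_expMetric g f K x x hx]
  have hp : ∀ (h : M → ℝ) a, mvfderiv (𝓡 n) h x (coordField x a x) = partialD x a h :=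
    fun _ _ ↦ rfl
  simp only [hp, partialD_trSq K x _ hKd, trSq_eq_trace K x x hx]
  have htr1 : (compMatrix K x x).trace = 1 := by rw [← tr_eq_trace_compMatrix K x x hx, hK1]
  have htrD := fun c ↦ trace_compD K x c hK1 hKd
  have hPE : (NormedSpace.exp (-(f x • compMatrix K x x))).transpose *
      (NormedSpace.exp (f x • compMatrix K x x)).transpose = 1 := by
    have hc : Commute (f x • compMatrix K x x) (-(f x • compMatrix K x x)) :=
      (Commute.refl (f x • compMatrix K x x)).neg_right
    rw [← Matrix.transpose_mul, ← Matrix.exp_add_of_commute _ _ hc]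
    simp
  set E := NormedSpace.exp (f x • compMatrix K x x)
  set P := NormedSpace.exp (-(f x • compMatrix K x x))
  set G := gram g x x
  set κ := compMatrix K x x
  have hcomp : ∀ a, comp K x x a b = κ a b := fun _ ↦ rfl
  have hGi : G * G⁻¹ = 1 := Matrix.mul_nonsing_inv _ ((Matrix.isUnit_iff_isUnit_det _).1 hu)
  have hGi' : G⁻¹ * G = 1 := Matrix.nonsing_inv_mul _ ((Matrix.isUnit_iff_isUnit_det _).1 hu)
  -- Here `P = E⁻¹`. This places `P` next to the derivative `D` of `E`, which is the form in which
  -- the trace identity `htr` applies.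
  have hinv : (E.transpose * G)⁻¹ = G⁻¹ * P.transpose := by
    refine Matrix.inv_eq_left_inv ?_
    rw [mul_assoc, ← mul_assoc P.transpose, hPE, one_mul, hGi']
  -- The trace identity with `X = 1`. Since `tr K = 1` is constant, `tr (∂K) = 0` and only `∂f` is
  -- left.
  have a1 : ∀ c, ((E.transpose * G)⁻¹ * ((D c).transpose * G + E.transpose * gramD g x c)).trace =
      (G⁻¹ * gramD g x c).trace + partialD x c f := by
    intro c
    have := htr c 1 (Commute.one_right _)
    simp only [mul_one, htr1, htrD, mul_zero, add_zero] at this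
    rw [← this, hinv, mul_add, Matrix.trace_add, add_comm]
    congr 1
    · rw [mul_assoc, ← mul_assoc P.transpose, hPE, one_mul]
    · rw [mul_assoc, Matrix.trace_mul_comm, mul_assoc, mul_assoc, hGi, mul_one,
        ← Matrix.trace_transpose (D c * P), Matrix.transpose_mul]
  -- The trace identity with `X = K`. The term `tr (∂K K)` is half of `∂ (tr K²)`, whence the
  -- coefficient `1/4` in the final formula.
  have a2 : (κ * (E.transpose * G)⁻¹ * ((D b).transpose * G + E.transpose * gramD g x b)).trace =
      (κ * G⁻¹ * gramD g x b).trace + (partialD x b f * (κ * κ).trace +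
        f x * (compD K x b * κ).trace) := by
    have h1 : G * (κ * G⁻¹) = κ.transpose := by rw [← mul_assoc, ← hκ, mul_assoc, hGi, mul_one]
    rw [← htr b κ (Commute.refl _), hinv, mul_add, Matrix.trace_add, add_comm]
    congr 1
    · rw [show κ * (G⁻¹ * P.transpose) * (E.transpose * gramD g x b) =
        κ * G⁻¹ * (P.transpose * E.transpose) * gramD g x b by simp only [mul_assoc], hPE, mul_one]
    · rw [← Matrix.trace_transpose (D b * P * κ), Matrix.transpose_mul, Matrix.transpose_mul,
        show κ * (G⁻¹ * P.transpose) * ((D b).transpose * G) =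
          (κ * G⁻¹) * (P.transpose * (D b).transpose) * G by simp only [mul_assoc],
        Matrix.trace_mul_comm, ← mul_assoc, h1]
  simp only [a1, a2, hcomp, add_mul, Finset.sum_add_distrib, smul_eq_mul]
  ring

end DivergenceTransformation

/-! ### Integration of the evolution equations for the metric and the Weingarten map. -/

section Evolution

/-- A function on `(0, ∞)` with vanishing derivative is constant. -/
theorem eq_of_hasDerivAt_zero {F : Type*} [NormedAddCommGroup F] [NormedSpace ℝ F] {f : ℝ → F}
    (h : ∀ t > 0, HasDerivAt f 0 t) {s t : ℝ} (hs : 0 < s) (ht : 0 < t) : f s = f t :=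
  isOpen_Ioi.is_const_of_deriv_eq_zero isPreconnected_Ioi
    (fun x hx ↦ (h x hx).differentiableAt.differentiableWithinAt) (fun x hx ↦ (h x hx).deriv) hs ht

variable {n : ℕ}

local notation "𝔼" => EuclideanSpace ℝ (Fin n)

theorem hasDerivAt_clm_comp {F : Type*} [NormedAddCommGroup F] [NormedSpace ℝ F] (l : F →L[ℝ] ℝ)
    {u : ℝ → F} {u' : F} {t : ℝ} (hu : HasDerivAt u u' t) : HasDerivAt (fun s ↦ l (u s)) (l u') t :=
  l.hasFDerivAt.comp_hasDerivAt t hu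

/-- The quantity `(s - c) W s` is conserved, and `s - c > 0` because `c ≤ 0`. -/
theorem eq_smul_of_hasDerivAt {F : Type*} [NormedAddCommGroup F] [NormedSpace ℝ F] {W : ℝ → F}
    {c : ℝ} (hc : c ≤ 0) (hW : ∀ s > 0, HasDerivAt W (-(s - c)⁻¹ • W s) s) {t : ℝ} (ht : 0 < t) :
    W t = -(t - c)⁻¹ • (c - 1) • W 1 := by
  have h0 : ∀ s > 0, HasDerivAt (fun s ↦ (s - c) • W s) 0 s := by
    intro s hs
    have h1 := ((hasDerivAt_id s).sub_const c).smul (hW s hs)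
    convert! h1 using 1
    have : s - c ≠ 0 := by linarith
    simp [smul_smul, this]
  have h1 : (t - c) • W t = (1 - c) • W 1 := eq_of_hasDerivAt_zero h0 ht one_pos
  have hne : t - c ≠ 0 := by linarith
  rw [neg_smul, ← smul_neg, ← neg_smul, neg_sub, ← h1, smul_smul, inv_mul_cancel₀ hne, one_smul]

section FiniteDimensional

variable {V : Type*} [NormedAddCommGroup V] [NormedSpace ℝ V] [FiniteDimensional ℝ V]

/-- A product rule for a form whose derivative is known only on fixed pairs of vectors; expanding
the moving vector in a basis reduces it to scalars. -/
theorem hasDerivAt_bilin_apply {b : ℝ → V →L[ℝ] V →L[ℝ] ℝ} {b' : V →L[ℝ] V →L[ℝ] ℝ} {t : ℝ}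
    (hb : ∀ v w, HasDerivAt (fun s ↦ b s v w) (b' v w) t) {u : ℝ → V} {u' : V}
    (hu : HasDerivAt u u' t) (w : V) :
    HasDerivAt (fun s ↦ b s (u s) w) (b' (u t) w + b t u' w) t := by
  let B := Module.finBasis ℝ V
  have key : ∀ (β : V →L[ℝ] V →L[ℝ] ℝ) (v : V), β v w = ∑ a, B.coord a v * β (B a) w := by
    intro β v
    conv_lhs => rw [← B.sum_repr v]
    simp only [map_sum, map_smul, _root_.sum_apply, _root_.smul_apply, smul_eq_mul]
    rfl
  rw [key b', key (b t), ← Finset.sum_add_distrib, funext fun s ↦ key (b s) (u s)]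
  refine HasDerivAt.fun_sum fun a _ ↦ ?_
  have h1 : HasDerivAt (fun s ↦ B.coord a (u s)) (B.coord a u') t :=
    hasDerivAt_clm_comp (LinearMap.toContinuousLinearMap (B.coord a)) hu
  have := h1.mul (hb (B a) w)
  rw [add_comm]
  exact this

/-- With `μ s = 2 (log (s - c) - log (1 - c))`, the quantity `b s (exp (-μ s K) u) w` is conserved
and equals `b 1 u w`, since `μ 1 = 0`. Taking `u = exp (μ t K) v` gives the formula. -/
theorem bilin_eq_of_hasDerivAt {b : ℝ → V →L[ℝ] V →L[ℝ] ℝ} {K : V →L[ℝ] V} {c : ℝ} (hc : c ≤ 0)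
    (hb : ∀ s > 0, ∀ v w, HasDerivAt (fun s ↦ b s v w) ((2 * (s - c)⁻¹) * b s (K v) w) s)
    {t : ℝ} (ht : 0 < t) (v w : V) :
    b t v w =
      b 1 (NormedSpace.exp ((2 * (Real.log (t - c) - Real.log (1 - c))) • K) v) w := by
  have : CompleteSpace V := FiniteDimensional.complete ℝ V
  set μ : ℝ → ℝ := fun s ↦ 2 * (Real.log (s - c) - Real.log (1 - c)) with hμ
  have hμ' : ∀ s > 0, HasDerivAt (fun s ↦ -μ s) (-(2 * (s - c)⁻¹)) s := by
    intro s hs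
    have hne : s - c ≠ 0 := by linarith
    have := ((((hasDerivAt_id s).sub_const c).log hne).sub_const (Real.log (1 - c))).const_mul 2
    convert! this.neg using 1
    simp
  have h0 : ∀ u w : V, ∀ s > 0, HasDerivAt (fun s ↦ b s (NormedSpace.exp ((-μ s) • K) u) w) 0 s := by
    intro u w s hs
    have h1 := hasDerivAt_bilin_apply (b' := (2 * (s - c)⁻¹) • (b s ∘L K))
      (fun v w ↦ hb s hs v w) (hasDerivAt_exp_smul_apply K (hμ' s hs) u) w
    convert! h1 using 1
    simp
  have h1 : ∀ u w : V, b t (NormedSpace.exp ((-μ t) • K) u) w = b 1 u w := by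
    intro u w
    have := eq_of_hasDerivAt_zero (h0 u w) ht one_pos
    simpa [hμ] using this
  have h3 : NormedSpace.exp ((-μ t) • K) (NormedSpace.exp (μ t • K) v) = v := by
    have := congrArg (fun B : V →L[ℝ] V ↦ B v) (exp_neg_self_mul_exp (μ t • K))
    simpa using this
  rw [← h1, h3]

end FiniteDimensional

variable {M : Type*} [TopologicalSpace M] [ChartedSpace (EuclideanSpace ℝ (Fin n)) M]

theorem raise_smul_self (g : BilinField n M) (c : ℝ) (x : M) (hg : ∀ v, v ≠ 0 → 0 < g x v v) :
    raise g (fun y ↦ c • g y) x = c • ContinuousLinearMap.id ℝ (TangentSpace (𝓡 n) x) := by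
  rw [← raise_comp g (fun y ↦ c • ContinuousLinearMap.id ℝ (TangentSpace (𝓡 n) y)) x hg]
  simp [raise]

variable [IsManifold (𝓡 n) ∞ M] {r : WithTop ℕ∞} {g k : ℝ → BilinField n M} {φ : ℝ → M → ℝ}

theorem tr_eq_sum (K : EndField n M) (x : M) :
    tr K x = ∑ a, coordForm x a x (K x (coordField x a x)) :=
  tr_eq_trace_compMatrix K x x (mem_chart_source _ x)

theorem tr_smul_id (c : ℝ) (x : M) :
    tr (fun y : M ↦ c • ContinuousLinearMap.id ℝ (TangentSpace (𝓡 n) y)) x = c * n := by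
  simp [tr_eq_sum, coordForm_coordField, mul_comm]

/-- The coefficients satisfy `1 - m/(m-1) + 1/(m-1) = 0`. It is used with `m = n`: the stress tensor
is `ρ g`, with trace `n ρ`. -/
theorem stress_terms_cancel {V : Type*} [AddCommGroup V] [Module ℝ V] (u v : V) (ρ : ℝ) {m : ℝ}
    (hm : m - 1 ≠ 0) : u - (ρ • v - (ρ * m / (m - 1)) • v) - (ρ / (m - 1)) • v = u := by
  have : ρ = ρ * m / (m - 1) - ρ / (m - 1) := by
    field_simp
  rw [← sub_smul, sub_sub, ← add_smul]
  conv_rhs => rw [← sub_zero u]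
  rw [show ρ - ρ * m / (m - 1) + ρ / (m - 1) = 0 by linarith, zero_smul]

/-- The matter terms in the evolution equation for the Weingarten map cancel. -/
theorem evolution_rhs_eq (hn : 3 ≤ n) {t : ℝ} {x : M} (hpos : ∀ v, v ≠ 0 → 0 < g t x v v)
    (φ : ℝ → M → ℝ) (u v : TangentSpace (𝓡 n) x) :
    u - (raise (g t) (stress g φ t) x v
        - (tr (raise (g t) (stress g φ t)) x / ((n : ℝ) - 1)) • v)
      - (energyDensity φ t x / ((n : ℝ) - 1)) • v = u := by
  have h1 : raise (g t) (stress g φ t) x = ((1 / 2) * (deriv (fun s ↦ φ s x) t) ^ 2) •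
      ContinuousLinearMap.id ℝ (TangentSpace (𝓡 n) x) :=
    raise_smul_self (g t) _ x hpos
  have h2 : tr (raise (g t) (stress g φ t)) x =
      ((1 / 2) * (deriv (fun s ↦ φ s x) t) ^ 2) * n := by
    rw [← tr_smul_id _ x]
    exact congrArg (fun A : TangentSpace (𝓡 n) x →L[ℝ] TangentSpace (𝓡 n) x ↦
      LinearMap.trace ℝ (TangentSpace (𝓡 n) x) A) h1
  have hn' : (n : ℝ) - 1 ≠ 0 := by
    have : (3 : ℝ) ≤ n := by exact_mod_cast hn
    linarith
  rw [h1, h2, energyDensity, _root_.smul_apply, ContinuousLinearMap.id_apply,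
    stress_terms_cancel _ _ _ hn']

/-- The evolution equation for the Weingarten map. -/
theorem IsSolution.hasDerivAt_weingarten (hn : 3 ≤ n) (h : IsSolution r g k φ) {t : ℝ} (ht : 0 < t)
    (x : M) (v : TangentSpace (𝓡 n) x) :
    HasDerivAt (fun s ↦ weingarten g k s x v)
      (tr (weingarten g k t) x • weingarten g k t x v) t := by
  have h3 := h.evol_k t ht x v
  rwa [evolution_rhs_eq hn (h.pos_g t ht x)] at h3

/-- Trace of the evolution equation: a Riccati equation that no longer contains the matter. -/
theorem IsSolution.hasDerivAt_tr (hn : 3 ≤ n) (h : IsSolution r g k φ) {t : ℝ} (ht : 0 < t)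
    (x : M) : HasDerivAt (fun s ↦ tr (weingarten g k s) x) (tr (weingarten g k t) x ^ 2) t := by
  simp only [tr_eq_sum _ x]
  have : (∑ a, coordForm x a x (weingarten g k t x (coordField x a x))) ^ 2 =
      ∑ a, coordForm x a x (tr (weingarten g k t) x • weingarten g k t x (coordField x a x)) := by
    rw [tr_eq_sum]
    simp only [map_smul, smul_eq_mul, ← Finset.mul_sum]
    ring
  rw [this]
  refine HasDerivAt.fun_sum fun a _ ↦ ?_
  exact hasDerivAt_clm_comp (F := 𝔼) (coordForm x a x)
    (h.hasDerivAt_weingarten hn ht x (coordField x a x))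

/-- The function `C` with `tr k = -(t - C)⁻¹`. -/
def timeShift (g k : ℝ → BilinField n M) (x : M) : ℝ := 1 + (tr (weingarten g k 1) x)⁻¹

/-- The rescaled Weingarten map. -/
def rescaledWeingarten (g k : ℝ → BilinField n M) : EndField n M :=
  fun x ↦ (timeShift g k x - 1) • weingarten g k 1 x

/-- By the Riccati equation, `s + 1/θ` has zero derivative; `timeShift` is its value at `s = 1`. -/
theorem IsSolution.inv_tr (hn : 3 ≤ n) (h : IsSolution r g k φ)
    (hθ : ∀ t > 0, ∀ x, tr (weingarten g k t) x ≠ 0) {t : ℝ} (ht : 0 < t) (x : M) :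
    (tr (weingarten g k t) x)⁻¹ = timeShift g k x - t := by
  have : ∀ s > 0, HasDerivAt (fun s ↦ s + (tr (weingarten g k s) x)⁻¹) 0 s := by
    intro s hs
    have h1 := (hasDerivAt_id s).add ((h.hasDerivAt_tr hn hs x).inv (hθ s hs x))
    convert! h1 using 1
    have := hθ s hs x
    field_simp
    ring
  have := eq_of_hasDerivAt_zero this ht one_pos
  rw [timeShift]
  linarith

/-- If `C > 0`, then `t = C` is an admissible time at which `1/θ = 0`. With the convention `0⁻¹ = 0`
this says `θ = 0`, which is excluded. -/
theorem IsSolution.timeShift_nonpos (hn : 3 ≤ n) (h : IsSolution r g k φ)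
    (hθ : ∀ t > 0, ∀ x, tr (weingarten g k t) x ≠ 0) (x : M) : timeShift g k x ≤ 0 := by
  by_contra! hC
  have h1 := h.inv_tr hn hθ hC x
  rw [sub_self, inv_eq_zero] at h1
  exact hθ _ hC x h1

theorem IsSolution.tr_eq (hn : 3 ≤ n) (h : IsSolution r g k φ)
    (hθ : ∀ t > 0, ∀ x, tr (weingarten g k t) x ≠ 0) {t : ℝ} (ht : 0 < t) (x : M) :
    tr (weingarten g k t) x = -(t - timeShift g k x)⁻¹ := by
  rw [← inv_inj, h.inv_tr hn hθ ht, inv_neg, inv_inv, neg_sub]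

theorem IsSolution.weingarten_eq (hn : 3 ≤ n) (h : IsSolution r g k φ)
    (hθ : ∀ t > 0, ∀ x, tr (weingarten g k t) x ≠ 0) {t : ℝ} (ht : 0 < t) (x : M) :
    weingarten g k t x = -(t - timeShift g k x)⁻¹ • rescaledWeingarten g k x := by
  ext1 v
  refine eq_smul_of_hasDerivAt (F := 𝔼) (W := fun s ↦ (weingarten g k s x v : 𝔼))
    (h.timeShift_nonpos hn hθ x) (fun s hs ↦ ?_) ht
  have := h.hasDerivAt_weingarten hn hs x v
  rwa [h.tr_eq hn hθ hs] at this

theorem IsSolution.tr_rescaledWeingarten (hn : 3 ≤ n) (h : IsSolution r g k φ)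
    (hθ : ∀ t > 0, ∀ x, tr (weingarten g k t) x ≠ 0) (x : M) : tr (rescaledWeingarten g k) x = 1 := by
  have h1 := h.tr_eq hn hθ one_pos x
  have hC := h.timeShift_nonpos hn hθ x
  have h2 : tr (rescaledWeingarten g k) x = (timeShift g k x - 1) * tr (weingarten g k 1) x := by
    simp [tr_eq_sum, rescaledWeingarten, Finset.mul_sum]
  rw [h2, h1]
  have : 1 - timeShift g k x ≠ 0 := by linarith
  field_simp
  ring

theorem IsSolution.rescaledWeingarten_selfAdjoint (h : IsSolution r g k φ) (x : M)
    (v w : TangentSpace (𝓡 n) x) :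
    g 1 x (rescaledWeingarten g k x v) w = g 1 x v (rescaledWeingarten g k x w) := by
  have h1 : ∀ v w, g 1 x (weingarten g k 1 x v) w = k 1 x v w :=
    raise_apply (g 1) (k 1) x (h.pos_g 1 one_pos x)
  simp only [rescaledWeingarten, _root_.smul_apply, map_smul, smul_eq_mul]
  rw [h1, h.symm_g 1 one_pos x v, h1, h.symm_k 1 one_pos]

/-- The metric is determined by its value at `t = 1` and the rescaled Weingarten map. -/
theorem IsSolution.metric_eq (hn : 3 ≤ n) (h : IsSolution r g k φ)
    (hθ : ∀ t > 0, ∀ x, tr (weingarten g k t) x ≠ 0) {t : ℝ} (ht : 0 < t) (x : M) :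
    g t x = expMetric (g 1) (fun y ↦ 2 * (Real.log (t - timeShift g k y) -
      Real.log (1 - timeShift g k y))) (rescaledWeingarten g k) x := by
  ext v w
  refine bilin_eq_of_hasDerivAt (V := 𝔼) (b := fun s ↦ g s x) (K := rescaledWeingarten g k x)
    (h.timeShift_nonpos hn hθ x) (fun s hs v w ↦ ?_) ht v w
  have h1 := h.evol_g s hs x v w
  have h2 : g s x (weingarten g k s x v) w = k s x v w :=
    raise_apply (g s) (k s) x (h.pos_g s hs x) v w
  have h3 : g s x (weingarten g k s x v) w =
      -(s - timeShift g k x)⁻¹ * g s x (rescaledWeingarten g k x v) w := by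
    rw [h.weingarten_eq hn hθ hs x]
    exact (congrFun (congrArg DFunLike.coe ((g s x).map_smul _ _)) w)
  have h4 : ∀ a b : ℝ, -2 * (-a * b) = 2 * a * b := fun a b ↦ by ring
  rw [← h2, h3, h4] at h1
  exact h1

end Evolution

/-! ### Integration of the scalar field equation and the Hamiltonian constraint. -/

section ScalarField

variable {n : ℕ} {M : Type*} [TopologicalSpace M] [ChartedSpace (EuclideanSpace ℝ (Fin n)) M]
  [IsManifold (𝓡 n) ∞ M] {r : WithTop ℕ∞} {g k : ℝ → BilinField n M} {φ : ℝ → M → ℝ}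

theorem IsSolution.contDiffOn_scalar (h : IsSolution r g k φ) (x : M) :
    ContDiffOn ℝ r (fun s ↦ φ s x) (Ioi 0) := by
  rw [← contMDiffOn_iff_contDiffOn]
  exact h.regular_φ.comp (f := fun s : ℝ ↦ (s, x))
    (contMDiffOn_id.prodMk contMDiffOn_const) fun s hs ↦ ⟨hs, mem_univ _⟩

theorem IsSolution.hasDerivAt_scalar (hr : 2 ≤ r) (h : IsSolution r g k φ) {t : ℝ} (ht : 0 < t)
    (x : M) : HasDerivAt (fun s ↦ φ s x) (deriv (fun s ↦ φ s x) t) t :=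
  (((h.contDiffOn_scalar x).differentiableOn (by
    rintro rfl; simp at hr)).differentiableAt (Ioi_mem_nhds ht)).hasDerivAt

theorem IsSolution.hasDerivAt_deriv_scalar (hr : 2 ≤ r) (h : IsSolution r g k φ) {t : ℝ}
    (ht : 0 < t) (x : M) : HasDerivAt (fun s ↦ deriv (fun u ↦ φ u x) s)
      (tr (weingarten g k t) x * deriv (fun s ↦ φ s x) t) t := by
  have h1 : ContDiffOn ℝ 1 (deriv fun s ↦ φ s x) (Ioi 0) :=
    (h.contDiffOn_scalar x).deriv_of_isOpen isOpen_Ioi (by simpa [one_add_one_eq_two] using hr)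
  have h2 := ((h1.differentiableOn one_ne_zero).differentiableAt (Ioi_mem_nhds ht)).hasDerivAt
  rw [← sub_eq_zero.1 (h.evol_φ t ht x)]
  exact h2

/-- The rescaled velocity `(t - C) ∂_t φ` of the scalar field. -/
def scalarVelocity (g k : ℝ → BilinField n M) (φ : ℝ → M → ℝ) (x : M) : ℝ :=
  (1 - timeShift g k x) * deriv (fun s ↦ φ s x) 1

/-- The wave equation reads `φ'' = -φ'/(t - C)`, so `(t - C) φ'` is conserved. -/
theorem IsSolution.hasDerivAt_scalarVelocity (hn : 3 ≤ n) (hr : 2 ≤ r) (h : IsSolution r g k φ)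
    (hθ : ∀ t > 0, ∀ x, tr (weingarten g k t) x ≠ 0) {t : ℝ} (ht : 0 < t) (x : M) :
    HasDerivAt (fun s ↦ (s - timeShift g k x) * deriv (fun u ↦ φ u x) s) 0 t := by
  have hC := h.timeShift_nonpos hn hθ x
  have h1 := ((hasDerivAt_id t).sub_const (timeShift g k x)).mul (h.hasDerivAt_deriv_scalar hr ht x)
  rw [h.tr_eq hn hθ ht] at h1
  convert! h1 using 1
  have : t - timeShift g k x ≠ 0 := by linarith
  simp only [id]
  field_simp
  ring

theorem IsSolution.deriv_scalar (hn : 3 ≤ n) (hr : 2 ≤ r) (h : IsSolution r g k φ)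
    (hθ : ∀ t > 0, ∀ x, tr (weingarten g k t) x ≠ 0) {t : ℝ} (ht : 0 < t) (x : M) :
    deriv (fun s ↦ φ s x) t = scalarVelocity g k φ x * (t - timeShift g k x)⁻¹ := by
  have hC := h.timeShift_nonpos hn hθ x
  have h1 : (t - timeShift g k x) * deriv (fun s ↦ φ s x) t = scalarVelocity g k φ x :=
    eq_of_hasDerivAt_zero (fun s hs ↦ h.hasDerivAt_scalarVelocity hn hr hθ hs x) ht one_pos
  have : t - timeShift g k x ≠ 0 := by linarith
  rw [← h1]
  field_simp

theorem IsSolution.scalar_eq (hn : 3 ≤ n) (hr : 2 ≤ r) (h : IsSolution r g k φ)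
    (hθ : ∀ t > 0, ∀ x, tr (weingarten g k t) x ≠ 0) {t : ℝ} (ht : 0 < t) (x : M) :
    φ t x = φ 1 x + scalarVelocity g k φ x *
      (Real.log (t - timeShift g k x) - Real.log (1 - timeShift g k x)) := by
  have hC := h.timeShift_nonpos hn hθ x
  have h0 : ∀ s > 0, HasDerivAt (fun s ↦ φ s x - scalarVelocity g k φ x *
      Real.log (s - timeShift g k x)) 0 s := by
    intro s hs
    have hne : s - timeShift g k x ≠ 0 := by linarith
    have h1 := (h.hasDerivAt_scalar hr hs x).sub
      ((((hasDerivAt_id s).sub_const (timeShift g k x)).log hne).const_mul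
        (scalarVelocity g k φ x))
    convert! h1 using 1
    rw [h.deriv_scalar hn hr hθ hs]
    simp only [id]
    field_simp
    ring
  have := eq_of_hasDerivAt_zero h0 ht one_pos
  linarith

/-- This is the Hamiltonian constraint at `t = 1` multiplied by `(1 - C)²`. -/
theorem IsSolution.trSq_rescaledWeingarten (hn : 3 ≤ n) (h : IsSolution r g k φ)
    (hθ : ∀ t > 0, ∀ x, tr (weingarten g k t) x ≠ 0) (x : M) :
    trSq (rescaledWeingarten g k) x + scalarVelocity g k φ x ^ 2 = 1 := by
  have h1 := h.hamiltonian 1 one_pos x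
  have h2 : trSq (rescaledWeingarten g k) x =
      (timeShift g k x - 1) ^ 2 * trSq (weingarten g k 1) x := by
    simp [trSq, tr_eq_sum, rescaledWeingarten, Finset.mul_sum, pow_two, mul_assoc]
  have hC := h.timeShift_nonpos hn hθ x
  have hne : 1 - timeShift g k x ≠ 0 := by linarith
  rw [h.tr_eq hn hθ one_pos, energyDensity] at h1
  rw [h2, scalarVelocity]
  have h3 : (1 - timeShift g k x) ^ 2 * ((1 - timeShift g k x)⁻¹) ^ 2 = 1 := by
    field_simp
  linear_combination (-(1 - timeShift g k x) ^ 2) * h1 + h3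

end ScalarField

/-! ### Regularity of index raising, traces and twisted metrics. -/

section Regularity

variable {n : ℕ} {M : Type*} [TopologicalSpace M] [ChartedSpace (EuclideanSpace ℝ (Fin n)) M]

theorem source_mem_nhds (x : M) : ∀ᶠ y in 𝓝 x,
    y ∈ (chartAt (EuclideanSpace ℝ (Fin n)) x).source :=
  (chartAt (EuclideanSpace ℝ (Fin n)) x).open_source.mem_nhds (mem_chart_source _ x)

variable [IsManifold (𝓡 n) ∞ M] {r : WithTop ℕ∞}

theorem regularFamily_iff (b : ℝ → BilinField n M) : RegularFamily r b ↔
    ∀ t > 0, ∀ x, ∀ i j, ContMDiffWithinAt (𝓘(ℝ, ℝ).prod (𝓡 n)) 𝓘(ℝ, ℝ) r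
      (fun q : ℝ × M ↦ gram (b q.1) x q.2 i j) (Ioi 0 ×ˢ univ) (t, x) := by
  constructor
  · intro h t ht x
    exact (contMDiffWithinAt_bilin_iff (N := ℝ × M) (I := 𝓘(ℝ, ℝ).prod (𝓡 n)) (f := Prod.snd)
      (g := fun q ↦ b q.1 q.2) (q₀ := (t, x)) contMDiffWithinAt_snd).1 (h (t, x) ⟨ht, mem_univ _⟩)
  · rintro h ⟨t, x⟩ ⟨ht, -⟩
    exact (contMDiffWithinAt_bilin_iff (N := ℝ × M) (I := 𝓘(ℝ, ℝ).prod (𝓡 n)) (f := Prod.snd)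
      (g := fun q ↦ b q.1 q.2) (q₀ := (t, x)) contMDiffWithinAt_snd).2 (h t ht x)

theorem BilinField.regular_iff (b : BilinField n M) : b.Regular r ↔
    ∀ x i j, ContMDiffAt (𝓡 n) 𝓘(ℝ, ℝ) r (fun y ↦ gram b x y i j) x := by
  refine forall_congr' fun x ↦ ?_
  simp only [← contMDiffWithinAt_univ]
  exact contMDiffWithinAt_bilin_iff contMDiffWithinAt_id

theorem EndField.regular_iff (K : EndField n M) : K.Regular r ↔
    ∀ x i j, ContMDiffAt (𝓡 n) 𝓘(ℝ, ℝ) r (fun y ↦ comp K x y i j) x := by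
  refine forall_congr' fun x ↦ ?_
  simp only [← contMDiffWithinAt_univ]
  exact contMDiffWithinAt_end_iff contMDiffWithinAt_id

theorem RegularFamily.regular {b : ℝ → BilinField n M} (h : RegularFamily r b) {t : ℝ}
    (ht : 0 < t) : (b t).Regular r := by
  rw [BilinField.regular_iff]
  intro x i j
  have h1 := (regularFamily_iff b).1 h t ht x i j
  rw [← contMDiffWithinAt_univ]
  exact h1.comp (f := fun y : M ↦ (t, y)) x
    (contMDiffWithinAt_const.prodMk contMDiffWithinAt_id) fun y _ ↦ ⟨ht, mem_univ _⟩

/-- The transposed component matrix is `gram b * (gram g)⁻¹`, and matrix inversion is regular at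
invertible matrices. -/
theorem regular_raise {g b : BilinField n M} (hg : IsRiemannianMetric r g) (hb : b.Regular r) :
    (raise g b).Regular r := by
  rw [EndField.regular_iff]
  intro x i j
  have hg' := (BilinField.regular_iff g).1 hg.regular
  have hb' := (BilinField.regular_iff b).1 hb
  have hu : ∀ y ∈ (chartAt (EuclideanSpace ℝ (Fin n)) x).source, IsUnit (gram g x y) :=
    fun y hy ↦ (gram_posDef g x y (hg.symm y) (hg.pos y) hy).isUnit
  have h1 := contMDiffWithinAt_matrix_inv (I := 𝓡 n) (s := univ) (q₀ := x) (r := r)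
    (A := fun y ↦ gram g x y) (fun i j ↦ (hg' x i j).contMDiffWithinAt)
    (hu x (mem_chart_source _ x))
  have h2 := contMDiffWithinAt_matrix_mul (I := 𝓡 n) (s := univ) (q₀ := x) (r := r)
    (A := fun y ↦ gram b x y) (fun i j ↦ (hb' x i j).contMDiffWithinAt) h1 j i
  refine (contMDiffWithinAt_univ.1 h2).congr_of_eventuallyEq ?_
  filter_upwards [source_mem_nhds (n := n) x] with y hy
  have h3 : b = fun z ↦ g z ∘L raise g b z := by
    funext z
    ext v w
    exact (raise_apply g b z (hg.pos z) v w).symm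
  have h4 : gram b x y = (compMatrix (raise g b) x y).transpose * gram g x y := by
    conv_lhs => rw [h3]
    exact gram_comp g (raise g b) x y hy
  rw [h4, Matrix.mul_nonsing_inv_cancel_right _ _ ((Matrix.isUnit_iff_isUnit_det _).1 (hu y hy))]
  rfl

theorem contMDiff_tr {K : EndField n M} (hK : K.Regular r) : ContMDiff (𝓡 n) 𝓘(ℝ, ℝ) r (tr K) := by
  intro x
  have h1 : ContMDiffAt (𝓡 n) 𝓘(ℝ, ℝ) r (fun y ↦ ∑ i, comp K x y i i) x :=
    ContMDiffAt.sum fun i _ ↦ (EndField.regular_iff K).1 hK x i i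
  refine h1.congr_of_eventuallyEq ?_
  filter_upwards [source_mem_nhds (n := n) x] with y hy
  rw [tr_eq_trace_compMatrix K x y hy]
  rfl

theorem EndField.Regular.smul {K : EndField n M} (hK : K.Regular r) {f : M → ℝ}
    (hf : ContMDiff (𝓡 n) 𝓘(ℝ, ℝ) r f) : EndField.Regular r (fun x ↦ f x • K x) := by
  rw [EndField.regular_iff] at hK ⊢
  intro x i j
  have : (fun y ↦ comp (fun x ↦ f x • K x) x y i j) = fun y ↦ f y * comp K x y i j := by
    funext y
    simp [comp]
  rw [this]
  exact (hf x).mul (hK x i j)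

section Family

variable {F : Type*} [NormedAddCommGroup F] [NormedSpace ℝ F] {H : Type*} [TopologicalSpace H]
  {I : ModelWithCorners ℝ F H} {N : Type*} [TopologicalSpace N] [ChartedSpace H N]

/-- The parameter space `N` covers two uses: `N = ℝ × M` for joint regularity in time and space, and
`N = M` for a single metric. Near `q₀` only the values `f q (p q)` of the exponent matter. -/
theorem contMDiffWithinAt_gram_expMetric {h : BilinField n M} {K : EndField n M}
    (hh : h.Regular r) (hK : K.Regular r) {p : N → M} {f : N → M → ℝ} {s : Set N} {q₀ : N}
    (hp : ContMDiffWithinAt I (𝓡 n) r p s q₀)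
    (hf : ContMDiffWithinAt I 𝓘(ℝ, ℝ) r (fun q ↦ f q (p q)) s q₀) (hq : q₀ ∈ s) (i j : Fin n) :
    ContMDiffWithinAt I 𝓘(ℝ, ℝ) r (fun q ↦ gram (expMetric h (f q) K) (p q₀) (p q) i j) s q₀ := by
  have hh' := fun i j ↦ ((BilinField.regular_iff h).1 hh (p q₀) i j).comp_contMDiffWithinAt q₀ hp
  have hK' := fun i j ↦ ((EndField.regular_iff K).1 hK (p q₀) i j).comp_contMDiffWithinAt q₀ hp
  have h1 := contMDiffWithinAt_matrix_exp (I := I) (s := s) (q₀ := q₀) (r := r)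
    (A := fun q ↦ f q (p q) • compMatrix K (p q₀) (p q)) (fun i j ↦ hf.mul (hK' i j))
  have h2 := contMDiffWithinAt_matrix_mul (I := I) (s := s) (q₀ := q₀) (r := r)
    (A := fun q ↦ (NormedSpace.exp (f q (p q) • compMatrix K (p q₀) (p q))).transpose)
    (B := fun q ↦ gram h (p q₀) (p q)) (fun i j ↦ h1 j i) hh' i j
  refine h2.congr_of_eventuallyEq_of_mem ?_ hq
  filter_upwards [hp.continuousWithinAt.eventually (source_mem_nhds (n := n) (p q₀))] with q hq
  rw [gram_expMetric h (f q) K _ _ hq]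

end Family

theorem isRiemannianMetric_expMetric {h : BilinField n M} {K : EndField n M} {f : M → ℝ}
    (hh : IsRiemannianMetric r h) (hK : K.Regular r) (hf : ContMDiff (𝓡 n) 𝓘(ℝ, ℝ) r f)
    (hself : ∀ x v w, h x (K x v) w = h x v (K x w)) :
    IsRiemannianMetric r (expMetric h f K) where
  regular := by
    rw [BilinField.regular_iff]
    intro x i j
    rw [← contMDiffWithinAt_univ]
    exact contMDiffWithinAt_gram_expMetric (f := fun _ ↦ f) hh.regular hK contMDiffWithinAt_id
      (hf x).contMDiffWithinAt (mem_univ x) i j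
  symm x := expMetric_symm h f K x (hh.symm x) (hself x)
  pos x := expMetric_pos h f K x (hh.pos x) (hself x)

theorem IsSolution.isRiemannianMetric {g k : ℝ → BilinField n M} {φ : ℝ → M → ℝ}
    (h : IsSolution r g k φ) {t : ℝ} (ht : 0 < t) : IsRiemannianMetric r (g t) :=
  ⟨h.regular_g.regular ht, h.symm_g t ht, h.pos_g t ht⟩

end Regularity

/-! ### The solution determined by data on the singularity. -/

section ModelSolution

variable {n : ℕ} {M : Type*} [TopologicalSpace M] [ChartedSpace (EuclideanSpace ℝ (Fin n)) M]

/-- The metrics `h (t ^ (2 K) ·, ·)`. -/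
def modelMetric (h : BilinField n M) (K : EndField n M) (t : ℝ) : BilinField n M :=
  expMetric h (fun _ ↦ 2 * Real.log t) K

/-- The second fundamental forms of the metrics `h (t ^ (2 K) ·, ·)`. -/
def modelForm (h : BilinField n M) (K : EndField n M) (t : ℝ) : BilinField n M :=
  fun x ↦ modelMetric h K t x ∘L (-t⁻¹ • K x)

theorem hasDerivAt_bilin_exp_log {V : Type*} [NormedAddCommGroup V] [NormedSpace ℝ V]
    [CompleteSpace V] (b : V →L[ℝ] V →L[ℝ] ℝ) (K : V →L[ℝ] V) {t : ℝ} (ht : 0 < t) (v w : V) :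
    HasDerivAt (fun s ↦ b (NormedSpace.exp ((2 * Real.log s) • K) v) w)
      (-2 * b (NormedSpace.exp ((2 * Real.log t) • K) ((-t⁻¹ • K) v)) w) t := by
  have h1 := hasDerivAt_exp_smul_apply K ((Real.hasDerivAt_log ht.ne').const_mul 2) v
  have h2 := hasDerivAt_clm_comp (b.flip w) h1
  have h3 : NormedSpace.exp ((2 * Real.log t) • K) (K v) =
      K (NormedSpace.exp ((2 * Real.log t) • K) v) :=
    congrArg (fun B : V →L[ℝ] V ↦ B v) (exp_smul_mul_comm K _)
  convert! h2 using 1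
  rw [_root_.smul_apply, map_smul, h3]
  simp
  ring

theorem hasDerivAt_neg_inv_smul {V : Type*} [NormedAddCommGroup V] [NormedSpace ℝ V] {t : ℝ}
    (ht : t ≠ 0) (v : V) : HasDerivAt (fun s : ℝ ↦ -s⁻¹ • v) ((-t⁻¹ * 1) • -t⁻¹ • v) t := by
  convert! (hasDerivAt_inv ht).neg.smul_const v using 1
  rw [smul_smul]
  congr 1
  field_simp

theorem contMDiffWithinAt_log_fst {r : WithTop ℕ∞} {t : ℝ} (ht : 0 < t) (x : M) :
    ContMDiffWithinAt (𝓘(ℝ, ℝ).prod (𝓡 n)) 𝓘(ℝ, ℝ) r (fun q : ℝ × M ↦ Real.log q.1)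
      (Ioi 0 ×ˢ univ) (t, x) :=
  (Real.contDiffAt_log.2 ht.ne').contMDiffAt.comp_contMDiffWithinAt (t, x) contMDiffWithinAt_fst

theorem modelForm_symm {h : BilinField n M} {K : EndField n M} (hsymm : ∀ x v w, h x v w = h x w v)
    (hself : ∀ x v w, h x (K x v) w = h x v (K x w)) (t : ℝ) (x : M) (v w : TangentSpace (𝓡 n) x) :
    modelForm h K t x v w = modelForm h K t x w v := by
  have h1 : ∀ v w, modelForm h K t x v w = -t⁻¹ * modelMetric h K t x (K x v) w :=
    fun v w ↦ by simp [modelForm]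
  rw [h1, h1]
  congr 1
  rw [modelMetric, expMetric_selfAdjoint _ _ _ _ (hself x), expMetric_symm h _ K x (hsymm x) (hself x)]

variable [IsManifold (𝓡 n) ∞ M] {r : WithTop ℕ∞} {h : BilinField n M} {K : EndField n M}
  {Φa Φb : M → ℝ}

theorem modelMetric_pos (hh : IsRiemannianMetric r h)
    (hself : ∀ x v w, h x (K x v) w = h x v (K x w)) (t : ℝ) (x : M) (v : TangentSpace (𝓡 n) x)
    (hv : v ≠ 0) : 0 < modelMetric h K t x v v :=
  expMetric_pos h _ K x (hh.pos x) (hself x) v hv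

theorem weingarten_model (hh : IsRiemannianMetric r h)
    (hself : ∀ x v w, h x (K x v) w = h x v (K x w)) (t : ℝ) :
    weingarten (modelMetric h K) (modelForm h K) t = fun x ↦ -t⁻¹ • K x := by
  funext x
  exact raise_comp (modelMetric h K t) (fun x ↦ -t⁻¹ • K x) x (modelMetric_pos hh hself t x)

theorem tr_smul (c : ℝ) (K : EndField n M) (x : M) : tr (fun y ↦ c • K y) x = c * tr K x := by
  simp [tr_eq_sum, Finset.mul_sum]

theorem trSq_smul (c : ℝ) (K : EndField n M) (x : M) :
    trSq (fun y ↦ c • K y) x = c ^ 2 * trSq K x := by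
  simp [trSq, tr_eq_sum, Finset.mul_sum, pow_two, mul_assoc]

theorem hasDerivAt_modelScalar {N : Type*} (Φa Φb : N → ℝ) (x : N) {t : ℝ} (ht : 0 < t) :
    HasDerivAt (fun s ↦ Φa x * Real.log s + Φb x) (Φa x * t⁻¹) t :=
  ((Real.hasDerivAt_log ht.ne').const_mul (Φa x)).add_const (Φb x)

theorem regularFamily_modelMetric (hh : IsRiemannianMetric r h) (hK : K.Regular r) :
    ∀ t > 0, ∀ x, ∀ i j, ContMDiffWithinAt (𝓘(ℝ, ℝ).prod (𝓡 n)) 𝓘(ℝ, ℝ) r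
      (fun q : ℝ × M ↦ gram (modelMetric h K q.1) x q.2 i j) (Ioi 0 ×ˢ univ) (t, x) := by
  intro t ht x i j
  exact contMDiffWithinAt_gram_expMetric (N := ℝ × M) (p := Prod.snd) (q₀ := (t, x))
    (s := Ioi (0 : ℝ) ×ˢ univ)
    (f := fun q _ ↦ 2 * Real.log q.1) hh.regular hK contMDiffWithinAt_snd
    (contMDiffWithinAt_const.mul (contMDiffWithinAt_log_fst ht x)) ⟨ht, mem_univ _⟩ i j

theorem mvfderiv_eq_of_hasDerivAt {f : M → ℝ} {x : M} {θ : TangentSpace (𝓡 n) x →L[ℝ] ℝ}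
    (hf : MDifferentiableAt (𝓡 n) 𝓘(ℝ, ℝ) f x)
    (hθ : ∀ a, HasDerivAt (fun ε ↦ f (coordLine x a ε)) (θ (coordField x a x)) 0) :
    mvfderiv (𝓡 n) f x = θ :=
  oneForm_ext fun a ↦ partialD_eq_of_hasDerivAt x a hf (hθ a)

/-- The Hamiltonian constraint `tr K² = 1 - Φa²` is differentiated; this trades the term `d(tr K²)`
of `divergence_expMetric` for the scalar field. -/
theorem mvfderiv_trSq {x : M} (ha : MDifferentiableAt (𝓡 n) 𝓘(ℝ, ℝ) Φa x)
    (hK : MDifferentiableAt (𝓡 n) 𝓘(ℝ, ℝ) (trSq K) x) (hham : ∀ y, trSq K y + Φa y ^ 2 = 1) :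
    mvfderiv (𝓡 n) (trSq K) x = (-(2 * Φa x)) • mvfderiv (𝓡 n) Φa x := by
  refine mvfderiv_eq_of_hasDerivAt hK fun a ↦ ?_
  have h1 : trSq K = fun y ↦ 1 - Φa y ^ 2 := funext fun y ↦ eq_sub_of_add_eq (hham y)
  rw [h1]
  convert! ((hasDerivAt_coordLine x a ha).pow 2).const_sub 1 using 1
  simp [coordLine_zero, partialD]

theorem mvfderiv_mul_const_add {x : M} (ha : MDifferentiableAt (𝓡 n) 𝓘(ℝ, ℝ) Φa x)
    (hb : MDifferentiableAt (𝓡 n) 𝓘(ℝ, ℝ) Φb x) (c : ℝ) :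
    mvfderiv (𝓡 n) (fun y ↦ Φa y * c + Φb y) x =
      c • mvfderiv (𝓡 n) Φa x + mvfderiv (𝓡 n) Φb x := by
  refine mvfderiv_eq_of_hasDerivAt ((ha.mul mdifferentiableAt_const).add hb) fun a ↦ ?_
  convert! ((hasDerivAt_coordLine x a ha).mul_const c).add (hasDerivAt_coordLine x a hb) using 1
  simp [partialD, mul_comm]

/-- A solution with prescribed data at the singularity. -/
theorem isSolution_model (hn : 3 ≤ n) (hr : 1 ≤ r) (hh : IsRiemannianMetric r h)
    (hK : K.Regular r) (ha : ContMDiff (𝓡 n) 𝓘(ℝ, ℝ) r Φa) (hb : ContMDiff (𝓡 n) 𝓘(ℝ, ℝ) r Φb)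
    (htr : ∀ x, tr K x = 1) (hself : ∀ x v w, h x (K x v) w = h x v (K x w))
    (hham : ∀ x, trSq K x + Φa x ^ 2 = 1)
    (hmom : ∀ x, divergence h K x = Φa x • mvfderiv (𝓡 n) Φb x) :
    IsSolution r (modelMetric h K) (modelForm h K) (fun t x ↦ Φa x * Real.log t + Φb x) where
  regular_g := by
    exact (regularFamily_iff _).2 (regularFamily_modelMetric hh hK)
  regular_k := by
    rw [regularFamily_iff]
    intro t ht x i j
    have h1 := regularFamily_modelMetric hh hK t ht x
    have h2 := contMDiffWithinAt_matrix_mul (I := 𝓘(ℝ, ℝ).prod (𝓡 n)) (s := Ioi (0 : ℝ) ×ˢ univ)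
      (q₀ := (t, x)) (r := r) (A := fun q ↦ (compMatrix K x q.2).transpose)
      (B := fun q ↦ gram (modelMetric h K q.1) x q.2)
      (fun i j ↦ ((EndField.regular_iff K).1 hK x j i).comp_contMDiffWithinAt (t, x)
        contMDiffWithinAt_snd) h1 i j
    have h3 : ContMDiffWithinAt (𝓘(ℝ, ℝ).prod (𝓡 n)) 𝓘(ℝ, ℝ) r
        (fun q : ℝ × M ↦ -(q.1)⁻¹) (Ioi 0 ×ˢ univ) (t, x) :=
      ContMDiffAt.comp_contMDiffWithinAt (t, x) (g := fun s : ℝ ↦ -s⁻¹)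
        ((contDiffAt_inv ℝ (ne_of_gt ht)).neg.contMDiffAt) contMDiffWithinAt_fst
    refine (h3.mul h2).congr_of_eventuallyEq_of_mem ?_ ⟨ht, mem_univ _⟩
    filter_upwards [(continuous_snd.continuousWithinAt (s := Ioi (0 : ℝ) ×ˢ univ)
      (x := (t, x))).eventually (source_mem_nhds (n := n) x)] with q hq
    have h4 := congrFun (congrFun (gram_comp (modelMetric h K q.1) K x q.2 hq) i) j
    change gram (modelForm h K q.1) x q.2 i j = -(q.1)⁻¹ *
      (((compMatrix K x q.2).transpose * gram (modelMetric h K q.1) x q.2 :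
        Matrix (Fin n) (Fin n) ℝ) i j)
    rw [← h4]
    simp [gram, modelForm]
  regular_φ := by
    rintro ⟨t, x⟩ ⟨ht, -⟩
    exact (((ha x).comp_contMDiffWithinAt (t, x) contMDiffWithinAt_snd).mul
      (contMDiffWithinAt_log_fst ht x)).add
      ((hb x).comp_contMDiffWithinAt (t, x) contMDiffWithinAt_snd)
  symm_g t _ x := expMetric_symm h _ K x (hh.symm x) (hself x)
  pos_g t _ x := modelMetric_pos hh hself t x
  symm_k t _ := modelForm_symm hh.symm hself t
  hamiltonian t ht x := by
    rw [weingarten_model hh hself t, tr_smul, trSq_smul, htr, energyDensity,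
      (hasDerivAt_modelScalar Φa Φb x ht).deriv]
    linear_combination (-(t⁻¹) ^ 2) * hham x
  momentum t ht x := by
    have hr0 : r ≠ 0 := fun h0 ↦ by simp [h0] at hr
    have hcomp := (EndField.regular_iff K).1 hK x
    have hda := (ha x).mdifferentiableAt hr0
    have hdK := fun a b ↦ (hcomp a b).mdifferentiableAt hr0
    -- The exponent `2 log t` is constant in space, so the only correction is `-½ log t d(tr K²) =
    -- log t Φa dΦa`. Added to `Φa dΦb` it gives `Φa d(Φa log t + Φb)`, as required.
    rw [weingarten_model hh hself t, divergence_smul _ _ (fun _ ↦ -t⁻¹) x mdifferentiableAt_const hdK,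
      modelMetric, divergence_expMetric h _ K x (hh.symm x) (hh.pos x) (hself x) htr
        (fun a b ↦ ((BilinField.regular_iff h).1 hh.regular x a b).of_le hr) contMDiffAt_const
        (fun a b ↦ (hcomp a b).of_le hr), hmom,
      mvfderiv_trSq hda (mdifferentiableAt_trSq K x hdK) hham, momentumDensity,
      (hasDerivAt_modelScalar Φa Φb x ht).deriv,
      mvfderiv_mul_const_add hda ((hb x).mdifferentiableAt hr0)]
    have h1 : tr (fun x ↦ -t⁻¹ • K x) = fun _ ↦ -t⁻¹ := by
      funext y
      rw [tr_smul, htr, mul_one]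
    rw [h1]
    refine oneForm_ext fun b ↦ ?_
    simp [mvfderiv_const]
    ring
  evol_g t ht x v w := by
    exact hasDerivAt_bilin_exp_log (V := EuclideanSpace ℝ (Fin n)) (h x) (K x) ht v w
  evol_k t ht x v := by
    rw [evolution_rhs_eq hn (modelMetric_pos hh hself t x)]
    simp only [weingarten_model hh hself, tr_smul, htr]
    exact hasDerivAt_neg_inv_smul (V := EuclideanSpace ℝ (Fin n)) ht.ne' (K x v)
  evol_φ t ht x := by
    rw [weingarten_model hh hself t, tr_smul, htr, (hasDerivAt_modelScalar Φa Φb x ht).deriv]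
    have h1 : HasDerivAt (fun s ↦ deriv (fun u ↦ Φa x * Real.log u + Φb x) s)
        (Φa x * (-(t ^ 2)⁻¹)) t := by
      refine ((hasDerivAt_inv ht.ne').const_mul (Φa x)).congr_of_eventuallyEq ?_
      filter_upwards [Ioi_mem_nhds ht] with s hs
      exact (hasDerivAt_modelScalar Φa Φb x hs).deriv
    rw [h1.deriv]
    field_simp
    ring

end ModelSolution

/-! ### Data on the singularity for a general solution, and the shift of time. -/

section Normalisation

theorem bilin_exp_smul_exp_smul {V : Type*} [NormedAddCommGroup V] [NormedSpace ℝ V]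
    [CompleteSpace V] (b : V →L[ℝ] V →L[ℝ] ℝ) (K : V →L[ℝ] V) (s t : ℝ) :
    (b ∘L NormedSpace.exp (s • K)) ∘L NormedSpace.exp (t • K) =
      b ∘L NormedSpace.exp ((s + t) • K) := by
  let _ : NormedAlgebra ℚ (V →L[ℝ] V) := NormedAlgebra.restrictScalars ℚ ℝ (V →L[ℝ] V)
  have h1 : Commute (s • K) (t • K) := ((Commute.refl K).smul_left s).smul_right t
  rw [add_smul, NormedSpace.exp_add_of_commute h1]
  rfl

variable {n : ℕ} {M : Type*} [TopologicalSpace M] [ChartedSpace (EuclideanSpace ℝ (Fin n)) M]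

theorem expMetric_expMetric (h : BilinField n M) (K : EndField n M) (f₁ f₂ : M → ℝ) (x : M) :
    expMetric (expMetric h f₁ K) f₂ K x = expMetric h (fun y ↦ f₁ y + f₂ y) K x :=
  bilin_exp_smul_exp_smul (V := EuclideanSpace ℝ (Fin n)) (h x) (K x) (f₁ x) (f₂ x)

theorem expMetric_congr (h : BilinField n M) (K : EndField n M) {f₁ f₂ : M → ℝ} {x : M}
    (hf : f₁ x = f₂ x) : expMetric h f₁ K x = expMetric h f₂ K x := by
  simp only [expMetric, expField, hf]

theorem contMDiff_log {r : WithTop ℕ∞} {f : M → ℝ} (hf : ContMDiff (𝓡 n) 𝓘(ℝ, ℝ) r f)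
    (h0 : ∀ x, f x ≠ 0) :
    ContMDiff (𝓡 n) 𝓘(ℝ, ℝ) r (fun x ↦ Real.log (f x)) :=
  fun x ↦ ContMDiffAt.comp x (g := Real.log) (Real.contDiffAt_log.2 (h0 x)).contMDiffAt (hf x)

variable [IsManifold (𝓡 n) ∞ M] {r : WithTop ℕ∞} {g k : ℝ → BilinField n M} {φ : ℝ → M → ℝ}

theorem IsSolution.contMDiff_scalar (h : IsSolution r g k φ) {t : ℝ} (ht : 0 < t) :
    ContMDiff (𝓡 n) 𝓘(ℝ, ℝ) r (φ t) := by
  rw [← contMDiffOn_univ]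
  exact h.regular_φ.comp (f := fun x : M ↦ (t, x))
    (contMDiffOn_const.prodMk contMDiffOn_id) fun x _ ↦ ⟨ht, mem_univ _⟩

theorem IsSolution.regular_weingarten (h : IsSolution r g k φ) {t : ℝ} (ht : 0 < t) :
    (weingarten g k t).Regular r :=
  regular_raise (h.isRiemannianMetric ht) (h.regular_k.regular ht)

theorem IsSolution.contMDiff_timeShift (h : IsSolution r g k φ)
    (hθ : ∀ t > 0, ∀ x, tr (weingarten g k t) x ≠ 0) :
    ContMDiff (𝓡 n) 𝓘(ℝ, ℝ) r (timeShift g k) :=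
  contMDiff_const.add ((contMDiff_tr (h.regular_weingarten one_pos)).inv₀ (hθ 1 one_pos))

theorem IsSolution.regular_rescaledWeingarten (h : IsSolution r g k φ)
    (hθ : ∀ t > 0, ∀ x, tr (weingarten g k t) x ≠ 0) : (rescaledWeingarten g k).Regular r :=
  (h.regular_weingarten one_pos).smul ((h.contMDiff_timeShift hθ).sub contMDiff_const)

theorem IsSolution.contMDiff_log_sub (hn : 3 ≤ n) (h : IsSolution r g k φ)
    (hθ : ∀ t > 0, ∀ x, tr (weingarten g k t) x ≠ 0) {t : ℝ} (ht : 0 < t) :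
    ContMDiff (𝓡 n) 𝓘(ℝ, ℝ) r (fun x ↦ Real.log (t - timeShift g k x)) :=
  contMDiff_log (contMDiff_const.sub (h.contMDiff_timeShift hθ)) fun x ↦ by
    linarith [h.timeShift_nonpos hn hθ x]

/-- The definition contains a time derivative, which could cost an order of regularity. Solving
`scalar_eq` at `t = 2` expresses the velocity through `φ 1`, `φ 2` and `C` instead. -/
theorem IsSolution.contMDiff_scalarVelocity (hn : 3 ≤ n) (hr : 2 ≤ r) (h : IsSolution r g k φ)
    (hθ : ∀ t > 0, ∀ x, tr (weingarten g k t) x ≠ 0) :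
    ContMDiff (𝓡 n) 𝓘(ℝ, ℝ) r (scalarVelocity g k φ) := by
  have hne : ∀ x, Real.log (2 - timeShift g k x) - Real.log (1 - timeShift g k x) ≠ 0 := fun x ↦ by
    have hC := h.timeShift_nonpos hn hθ x
    have := Real.log_lt_log (by linarith : 0 < 1 - timeShift g k x)
      (by linarith : 1 - timeShift g k x < 2 - timeShift g k x)
    linarith
  have h1 : scalarVelocity g k φ = fun x ↦ (φ 2 x - φ 1 x) *
      (Real.log (2 - timeShift g k x) - Real.log (1 - timeShift g k x))⁻¹ := by
    funext x
    rw [h.scalar_eq hn hr hθ two_pos x, add_sub_cancel_left, mul_assoc, mul_inv_cancel₀ (hne x),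
      mul_one]
  rw [h1]
  exact ((h.contMDiff_scalar two_pos).sub (h.contMDiff_scalar one_pos)).mul
    (((h.contMDiff_log_sub hn hθ two_pos).sub (h.contMDiff_log_sub hn hθ one_pos)).inv₀ hne)

/-- The metric on the singularity. -/
def dataMetric (g k : ℝ → BilinField n M) : BilinField n M :=
  expMetric (g 1) (fun x ↦ -2 * Real.log (1 - timeShift g k x)) (rescaledWeingarten g k)

/-- The value of the scalar field on the singularity. -/
def dataScalar (g k : ℝ → BilinField n M) (φ : ℝ → M → ℝ) (x : M) : ℝ :=
  φ 1 x - scalarVelocity g k φ x * Real.log (1 - timeShift g k x)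

/-- With `f = -2 log (1 - C)`, the term `½ df∘𝒦` cancels the `dC∘K` produced by the Leibniz rule for
`𝒦 = (C - 1) K`. The derivative of `tr K = -(1 - C)⁻¹` and the term `-½ (tr 𝒦²) df` combine to `Φa²
(1 - C)⁻¹ dC`. Together with `(C - 1) j = Φa dφ` and `-¼ f d(tr 𝒦²) = -Φa log (1 - C) dΦa`, this is
exactly `Φa dΦb`. -/
theorem IsSolution.divergence_dataMetric (hn : 3 ≤ n) (hr : 2 ≤ r) (h : IsSolution r g k φ)
    (hθ : ∀ t > 0, ∀ x, tr (weingarten g k t) x ≠ 0) (x : M) :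
    divergence (dataMetric g k) (rescaledWeingarten g k) x =
      scalarVelocity g k φ x • mvfderiv (𝓡 n) (dataScalar g k φ) x := by
  have hr1 : 1 ≤ r := le_trans one_le_two hr
  have hr0 : r ≠ 0 := fun h0 ↦ by simp [h0] at hr1
  have hC := h.timeShift_nonpos hn hθ x
  have hW := (EndField.regular_iff _).1 (h.regular_weingarten one_pos) x
  have hK := (EndField.regular_iff _).1 (h.regular_rescaledWeingarten hθ) x
  have hg := (BilinField.regular_iff _).1 (h.isRiemannianMetric one_pos).regular x
  have hCd := (h.contMDiff_timeShift hθ x).mdifferentiableAt hr0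
  have hΦd := (h.contMDiff_scalarVelocity hn hr hθ x).mdifferentiableAt hr0
  have hφd := (h.contMDiff_scalar one_pos x).mdifferentiableAt hr0
  have hℓ := h.contMDiff_log_sub hn hθ one_pos x
  have hne : 1 - timeShift g k x ≠ 0 := by linarith
  have d1 : mvfderiv (𝓡 n) (fun y ↦ timeShift g k y - 1) x = mvfderiv (𝓡 n) (timeShift g k) x := by
    refine mvfderiv_eq_of_hasDerivAt (hCd.sub mdifferentiableAt_const) fun a ↦ ?_
    exact (hasDerivAt_coordLine x a hCd).sub_const 1
  have d2 : mvfderiv (𝓡 n) (tr (weingarten g k 1)) x =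
      (-((1 - timeShift g k x) ^ 2)⁻¹) • mvfderiv (𝓡 n) (timeShift g k) x := by
    have h1 : tr (weingarten g k 1) = fun y ↦ -(1 - timeShift g k y)⁻¹ :=
      funext (h.tr_eq hn hθ one_pos)
    refine mvfderiv_eq_of_hasDerivAt ((contMDiff_tr (h.regular_weingarten one_pos)
      x).mdifferentiableAt hr0) fun a ↦ ?_
    rw [h1]
    convert! (((hasDerivAt_coordLine x a hCd).const_sub 1).inv (by rwa [coordLine_zero])).neg using 1
    simp [coordLine_zero, partialD]
    ring
  have d3 : mvfderiv (𝓡 n) (fun y ↦ -2 * Real.log (1 - timeShift g k y)) x =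
      (2 * (1 - timeShift g k x)⁻¹) • mvfderiv (𝓡 n) (timeShift g k) x := by
    refine mvfderiv_eq_of_hasDerivAt
      ((contMDiffAt_const.mul hℓ).mdifferentiableAt hr0) fun a ↦ ?_
    convert! (((hasDerivAt_coordLine x a hCd).const_sub 1).log
      (by rwa [coordLine_zero])).const_mul (-2) using 1
    simp [coordLine_zero, partialD]
    ring
  have d4 : mvfderiv (𝓡 n) (dataScalar g k φ) x = mvfderiv (𝓡 n) (φ 1) x
      - Real.log (1 - timeShift g k x) • mvfderiv (𝓡 n) (scalarVelocity g k φ) x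
      + (scalarVelocity g k φ x * (1 - timeShift g k x)⁻¹) • mvfderiv (𝓡 n) (timeShift g k) x := by
    refine mvfderiv_eq_of_hasDerivAt
      (hφd.sub (hΦd.mul (hℓ.mdifferentiableAt hr0))) fun a ↦ ?_
    convert! (hasDerivAt_coordLine x a hφd).sub ((hasDerivAt_coordLine x a hΦd).mul
      (((hasDerivAt_coordLine x a hCd).const_sub 1).log (by rwa [coordLine_zero]))) using 1
    simp [coordLine_zero, partialD]
    ring
  have m1 : divergence (g 1) (weingarten g k 1) x = _ :=
    eq_add_of_sub_eq (h.momentum 1 one_pos x)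
  have m2 : divergence (g 1) (rescaledWeingarten g k) x = _ :=
    divergence_smul (g 1) (weingarten g k 1) (fun y ↦ timeShift g k y - 1) x
      (hCd.sub mdifferentiableAt_const) fun a b ↦ (hW a b).mdifferentiableAt hr0
  rw [dataMetric, divergence_expMetric (g 1)
    (fun y ↦ -2 * Real.log (1 - timeShift g k y)) _ x (h.symm_g 1 one_pos x) (h.pos_g 1 one_pos x)
    (h.rescaledWeingarten_selfAdjoint x) (h.tr_rescaledWeingarten hn hθ)
    (fun a b ↦ (hg a b).of_le hr1) ((contMDiffAt_const.mul hℓ).of_le hr1)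
    (fun a b ↦ (hK a b).of_le hr1), m2, m1, d1, d2, d3, d4,
    mvfderiv_trSq hΦd (mdifferentiableAt_trSq _ x fun a b ↦ (hK a b).mdifferentiableAt hr0)
      (h.trSq_rescaledWeingarten hn hθ), momentumDensity,
    eq_sub_of_add_eq (h.trSq_rescaledWeingarten hn hθ x)]
  refine oneForm_ext fun b ↦ ?_
  have h5 : deriv (fun s ↦ φ s x) 1 = scalarVelocity g k φ x * (1 - timeShift g k x)⁻¹ :=
    h.deriv_scalar hn hr hθ one_pos x
  rw [h5]
  simp only [rescaledWeingarten, _root_.add_apply, _root_.sub_apply, _root_.smul_apply,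
    ContinuousLinearMap.comp_apply, map_smul, smul_eq_mul]
  field_simp
  ring

theorem IsSolution.form_eq (h : IsSolution r g k φ) {t : ℝ} (ht : 0 < t) (x : M) :
    k t x = g t x ∘L weingarten g k t x := by
  ext v w
  exact (raise_apply (g t) (k t) x (h.pos_g t ht x) v w).symm

/-- The shift `t ↦ t - C(x)` depends on `x`, so the momentum constraint does not transfer by
substitution. The shifted solution is therefore constructed from the data on the singularity and
then compared with the given one. -/
theorem IsSolution.exists_normalisation (hn : 3 ≤ n) (hr : 2 ≤ r) (h : IsSolution r g k φ)
    (hθ : ∀ t > 0, ∀ x, tr (weingarten g k t) x ≠ 0) :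
    ∃ (C : M → ℝ) (g' k' : ℝ → BilinField n M) (φ' : ℝ → M → ℝ),
      ContMDiff (𝓡 n) 𝓘(ℝ, ℝ) r C ∧ (∀ x, C x ≤ 0) ∧ IsSolution r g' k' φ' ∧
      (∀ t > 0, ∀ x, tr (weingarten g' k' t) x = -t⁻¹) ∧
      ∀ t > 0, ∀ x, g t x = g' (t - C x) x ∧ k t x = k' (t - C x) x ∧ φ t x = φ' (t - C x) x := by
  have hK := h.regular_rescaledWeingarten hθ
  have hself1 := h.rescaledWeingarten_selfAdjoint
  have hh : IsRiemannianMetric r (dataMetric g k) :=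
    isRiemannianMetric_expMetric (h.isRiemannianMetric one_pos) hK
      (contMDiff_const.mul (h.contMDiff_log_sub hn hθ one_pos)) hself1
  have hself : ∀ x v w, dataMetric g k x (rescaledWeingarten g k x v) w =
      dataMetric g k x v (rescaledWeingarten g k x w) :=
    fun x ↦ expMetric_selfAdjoint (g 1) _ _ x (hself1 x)
  have hgt : ∀ t > 0, ∀ x, g t x =
      modelMetric (dataMetric g k) (rescaledWeingarten g k) (t - timeShift g k x) x := by
    intro t ht x
    rw [h.metric_eq hn hθ ht x, modelMetric, dataMetric, expMetric_expMetric]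
    -- The exponents `-2 log (1 - C)` and `2 log (t - C)` add up to that of `metric_eq`.
    exact expMetric_congr _ _ (by ring)
  refine ⟨timeShift g k, modelMetric (dataMetric g k) (rescaledWeingarten g k),
    modelForm (dataMetric g k) (rescaledWeingarten g k),
    fun t x ↦ scalarVelocity g k φ x * Real.log t + dataScalar g k φ x,
    h.contMDiff_timeShift hθ, h.timeShift_nonpos hn hθ, ?_, fun t _ x ↦ ?_,
    fun t ht x ↦ ⟨hgt t ht x, ?_, ?_⟩⟩
  · exact isSolution_model hn (le_trans one_le_two hr) hh hK (h.contMDiff_scalarVelocity hn hr hθ)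
      ((h.contMDiff_scalar one_pos).sub ((h.contMDiff_scalarVelocity hn hr hθ).mul
        (h.contMDiff_log_sub hn hθ one_pos))) (h.tr_rescaledWeingarten hn hθ) hself
      (h.trSq_rescaledWeingarten hn hθ) (h.divergence_dataMetric hn hr hθ)
  · rw [weingarten_model hh hself, tr_smul, h.tr_rescaledWeingarten hn hθ, mul_one]
  · rw [h.form_eq ht x, hgt t ht x, h.weingarten_eq hn hθ ht x]
    rfl
  · rw [h.scalar_eq hn hr hθ ht x]
    simp only [dataScalar]
    ring

end Normalisation

/-! ### Real and simple eigenvalues. -/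

section LinearAlgebra

open Polynomial

theorem sq_sub_smul_add_smul {R : Type*} [Ring R] [Algebra ℂ R] (A : R) {a b c d : ℂ}
    (h1 : a + b = 2 * c) (h2 : a * b = c ^ 2 + d) :
    (A - c • 1) * (A - c • 1) + d • (1 : R) = (a • 1 - A) * (b • 1 - A) := by
  obtain rfl : b = 2 * c - a := eq_sub_of_add_eq' h1
  obtain rfl : d = a * (2 * c - a) - c ^ 2 := eq_sub_of_add_eq' h2.symm
  simp only [sub_mul, mul_sub, smul_mul_assoc, mul_smul_comm, one_mul, mul_one]
  module

/-- A root `z` makes the real operator `(K - re z)² + (im z)²` singular, its complexification being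
`(z - K)(z̄ - K)`. Pairing a kernel vector `v` with itself gives `b u u + (im z)² b v v = 0` for `u
= (K - re z) v`, which contradicts positivity unless `im z = 0`. -/
theorem im_eq_zero_of_isRoot_charpoly {V : Type*} [NormedAddCommGroup V] [NormedSpace ℝ V]
    [FiniteDimensional ℝ V] (b : V →L[ℝ] V →L[ℝ] ℝ) (K : V →L[ℝ] V)
    (hpos : ∀ v, v ≠ 0 → 0 < b v v) (hself : ∀ v w, b (K v) w = b v (K w)) {z : ℂ}
    (hz : ((LinearMap.charpoly (K : V →ₗ[ℝ] V)).map (algebraMap ℝ ℂ)).IsRoot z) : z.im = 0 := by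
  by_contra hq
  set B := Module.finBasis ℝ V
  set T : Module.End ℝ V := (K : V →ₗ[ℝ] V)
  set A := LinearMap.toMatrixAlgEquiv B T with hA
  set L : Module.End ℝ V := (T - z.re • 1) * (T - z.re • 1) + (z.im ^ 2) • 1 with hL
  have hdet : (LinearMap.toMatrixAlgEquiv B L).det = 0 := by
    have h1 : LinearMap.toMatrixAlgEquiv B L =
        (A - z.re • 1) * (A - z.re • 1) + (z.im ^ 2) • 1 := by
      simp [hL, hA]
    have h2 : (algebraMap ℝ ℂ).mapMatrix (LinearMap.toMatrixAlgEquiv B L) =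
        (Matrix.scalar _ z - (algebraMap ℝ ℂ).mapMatrix A) *
          (Matrix.scalar _ ((starRingEnd ℂ) z) - (algebraMap ℝ ℂ).mapMatrix A) := by
      rw [h1]
      have h3 : ∀ c : ℝ, (algebraMap ℝ ℂ).mapMatrix (c • (1 : Matrix _ _ ℝ)) =
          (c : ℂ) • (1 : Matrix (Fin (Module.finrank ℝ V)) _ ℂ) := by
        intro c
        ext i j
        by_cases hij : i = j <;> simp [hij]
      have h4 : ∀ c : ℂ, Matrix.scalar (Fin (Module.finrank ℝ V)) c = c • (1 : Matrix _ _ ℂ) := by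
        intro c
        ext i j
        simp [Matrix.one_apply, Matrix.diagonal_apply]
      have h5 : z + (starRingEnd ℂ) z = 2 * (z.re : ℂ) := by
        exact Complex.ext (by simp [two_mul]) (by simp)
      have h6 : z * (starRingEnd ℂ) z = (z.re : ℂ) ^ 2 + (z.im : ℂ) ^ 2 := by
        exact Complex.ext (by simp [pow_two]) (by simp [pow_two, mul_comm])
      rw [map_add, map_mul, map_sub, h3, h3, h4, h4, Complex.ofReal_pow]
      exact sq_sub_smul_add_smul _ h5 h6
    have h3 : (Matrix.scalar _ z - (algebraMap ℝ ℂ).mapMatrix A).det = 0 := by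
      rw [← Matrix.eval_charpoly]
      have h4 : ((algebraMap ℝ ℂ).mapMatrix A).charpoly = T.charpoly.map (algebraMap ℝ ℂ) := by
        rw [← LinearMap.charpoly_toMatrix T B]
        exact Matrix.charpoly_map _ _
      rw [h4]
      exact hz
    have h4 : (algebraMap ℝ ℂ) (LinearMap.toMatrixAlgEquiv B L).det = 0 := by
      rw [RingHom.map_det, h2, Matrix.det_mul, h3, zero_mul]
    simpa using h4
  have hdet' : LinearMap.det L = 0 := by
    rw [← LinearMap.det_toMatrix B L]
    exact hdet
  obtain ⟨v, hv, hv0⟩ := Submodule.exists_mem_ne_zero_of_ne_bot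
    (LinearMap.bot_lt_ker_of_det_eq_zero hdet').ne'
  set u : V := K v - z.re • v with hu
  have h1 : K u - z.re • u + (z.im ^ 2) • v = 0 := hv
  have h2 : b (K u - z.re • u + (z.im ^ 2) • v) v = b u u + z.im ^ 2 * b v v := by
    have h3 : b (K u - z.re • u) v = b u u := by
      rw [map_sub, map_smul, _root_.sub_apply, _root_.smul_apply, hself, hu]
      simp [hself v v]
    rw [map_add, map_smul, _root_.add_apply, _root_.smul_apply, h3, smul_eq_mul]
  rw [h1] at h2
  have h3 : 0 ≤ b u u := by
    rcases eq_or_ne u 0 with h | h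
    · simp [h]
    · exact (hpos u h).le
  have h4 : 0 < z.im ^ 2 * b v v := mul_pos (by positivity) (hpos v hv0)
  simp at h2
  linarith

theorem charpoly_eq_prod_of_hasEigenvalue {V : Type*} [AddCommGroup V] [Module ℝ V]
    [Module.Finite ℝ V] {ι : Type*} [Fintype ι] (hι : Fintype.card ι = Module.finrank ℝ V)
    (T : Module.End ℝ V) {p : ι → ℝ} (hp : Function.Injective p)
    (h : ∀ A, T.HasEigenvalue (p A)) : LinearMap.charpoly T = ∏ A, (X - C (p A)) := by
  have hm : (∏ A, (X - C (p A))).Monic := monic_prod_of_monic _ _ fun A _ ↦ monic_X_sub_C _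
  refine eq_of_monic_of_dvd_of_natDegree_le hm (LinearMap.charpoly_monic T) ?_ ?_
  · refine Finset.prod_dvd_of_coprime ((pairwise_coprime_X_sub_C hp).set_pairwise _) fun A _ ↦ ?_
    rw [dvd_iff_isRoot]
    exact (Module.End.hasEigenvalue_iff_isRoot_charpoly T _).1 (h A)
  · rw [LinearMap.charpoly_natDegree, natDegree_prod_of_monic _ _ fun A _ ↦ monic_X_sub_C _]
    simp [hι]

theorem eval_derivative_charpoly_ne_zero {V : Type*} [AddCommGroup V] [Module ℝ V]
    [Module.Finite ℝ V] {ι : Type*} [Fintype ι] (hι : Fintype.card ι = Module.finrank ℝ V)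
    (T : Module.End ℝ V) {p : ι → ℝ} (hp : Function.Injective p)
    (h : ∀ A, T.HasEigenvalue (p A)) (A : ι) :
    (derivative (LinearMap.charpoly T)).eval (p A) ≠ 0 := by
  rw [charpoly_eq_prod_of_hasEigenvalue hι T hp h]
  refine (separable_prod_X_sub_C_iff.2 hp).eval₂_derivative_ne_zero (RingHom.id ℝ) ?_
  rw [eval₂_id, eval_prod]
  exact Finset.prod_eq_zero (Finset.mem_univ A) (by simp)

/-- Multiplying by the missing factor `T - p_A` completes the characteristic polynomial, which
annihilates everything by Cayley–Hamilton. -/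
theorem aeval_prod_mem_ker {V : Type*} [AddCommGroup V] [Module ℝ V]
    [Module.Finite ℝ V] {ι : Type*} [Fintype ι] [DecidableEq ι]
    (hι : Fintype.card ι = Module.finrank ℝ V)
    (T : Module.End ℝ V) {p : ι → ℝ} (hp : Function.Injective p)
    (h : ∀ A, T.HasEigenvalue (p A)) (A : ι) (v : V) :
    T (aeval T (∏ B ∈ Finset.univ.erase A, (X - C (p B))) v) =
      p A • aeval T (∏ B ∈ Finset.univ.erase A, (X - C (p B))) v := by
  rw [← sub_eq_zero]
  have h1 : aeval T ((X - C (p A)) * ∏ B ∈ Finset.univ.erase A, (X - C (p B))) v = 0 := by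
    rw [Finset.mul_prod_erase _ (fun B ↦ X - C (p B)) (Finset.mem_univ A),
      ← charpoly_eq_prod_of_hasEigenvalue hι T hp h, LinearMap.aeval_self_charpoly]
    rfl
  rw [map_mul] at h1
  simpa [sub_eq_add_neg] using h1

/-- On the `p_A`-eigenvector the product acts as the nonzero scalar `∏ (p_A - p_B)`, `B ≠ A`. -/
theorem aeval_prod_apply_ne_zero {V : Type*} [AddCommGroup V] [Module ℝ V] {ι : Type*} [Fintype ι]
    [DecidableEq ι] (T : Module.End ℝ V) {p : ι → ℝ} (hp : Function.Injective p) (A : ι) {v : V}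
    (hv : T.HasEigenvector (p A) v) :
    aeval T (∏ B ∈ Finset.univ.erase A, (X - C (p B))) v ≠ 0 := by
  rw [Module.End.aeval_apply_of_hasEigenvector hv, eval_prod]
  refine smul_ne_zero (Finset.prod_ne_zero_iff.2 fun B hB ↦ ?_) hv.2
  simpa [sub_eq_zero] using fun h ↦ (Finset.ne_of_mem_erase hB) (hp h).symm

theorem contDiff_det {n : ℕ} {F : Type*} [NormedAddCommGroup F] [NormedSpace ℝ F]
    {r : WithTop ℕ∞} {A : F → Matrix (Fin n) (Fin n) ℝ}
    (hA : ∀ i j, ContDiff ℝ r fun q ↦ A q i j) : ContDiff ℝ r fun q ↦ (A q).det := by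
  simp only [Matrix.det_apply]
  exact ContDiff.sum fun σ _ ↦ (contDiff_prod fun i _ ↦ hA _ _).const_smul _

/-- Simple eigenvalues of a matrix depend regularly on the matrix. -/
theorem exists_contDiffAt_eigenvalue {n : ℕ} (m₀ : Fin n → Fin n → ℝ) {c : ℝ}
    (h0 : (Matrix.charpoly (Matrix.of m₀)).eval c = 0)
    (h1 : (derivative (Matrix.charpoly (Matrix.of m₀))).eval c ≠ 0) {r : WithTop ℕ∞} (hr : r ≠ 0) :
    ∃ ℓ : (Fin n → Fin n → ℝ) → ℝ, ContDiffAt ℝ r ℓ m₀ ∧ ℓ m₀ = c ∧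
      ∀ᶠ m in 𝓝 m₀, (Matrix.charpoly (Matrix.of m)).eval (ℓ m) = 0 := by
  set f : (Fin n → Fin n → ℝ) × ℝ → ℝ := fun q ↦ (Matrix.charpoly (Matrix.of q.1)).eval q.2
  have hf : ContDiff ℝ r f := by
    simp only [f, Matrix.eval_charpoly]
    refine contDiff_det fun i j ↦ ?_
    simp only [Matrix.sub_apply, Matrix.of_apply]
    refine ContDiff.sub ?_ (by fun_prop)
    rcases eq_or_ne i j with rfl | hij
    · simpa using contDiff_snd
    · simpa [Matrix.diagonal_apply_ne _ hij] using contDiff_const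
  -- The derivative in the second variable is the derivative of the characteristic polynomial at
  -- `c`, nonzero for a simple root, so the implicit function theorem applies.
  have hd : fderiv ℝ f (m₀, c) ∘L .inr ℝ (Fin n → Fin n → ℝ) ℝ =
      (Units.mk0 _ h1 : ℝ) • ContinuousLinearMap.id ℝ ℝ := by
    ext
    have h2 : HasDerivAt (fun s : ℝ ↦ f (m₀, s)) (fderiv ℝ f (m₀, c) (0, 1)) c :=
      (hf.differentiable hr (m₀, c)).hasFDerivAt.comp_hasDerivAt c
        ((hasDerivAt_const c m₀).prodMk (hasDerivAt_id c))
    have h3 := h2.unique ((Matrix.charpoly (Matrix.of m₀)).hasDerivAt c)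
    simpa using h3
  have hinv : (fderiv ℝ f (m₀, c) ∘L .inr ℝ (Fin n → Fin n → ℝ) ℝ).IsInvertible := by
    refine ⟨ContinuousLinearEquiv.smulLeft (Units.mk0 _ h1), ?_⟩
    rw [hd]
    rfl
  refine ⟨hf.contDiffAt.implicitFunction hr hinv, hf.contDiffAt.contDiffAt_implicitFunction hr hinv,
    hf.contDiffAt.implicitFunction_apply_self hr hinv, ?_⟩
  filter_upwards [hf.contDiffAt.eventually_apply_implicitFunction hr hinv] with m hm
  exact hm.trans h0

end LinearAlgebra

/-! ### Solutions with `tr k = -1/t`. -/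

section Normalised

variable {n : ℕ} {M : Type*} [TopologicalSpace M] [ChartedSpace (EuclideanSpace ℝ (Fin n)) M]

theorem hasRealEigenvalues_of_selfAdjoint (g : BilinField n M) (K : EndField n M)
    (hpos : ∀ x v, v ≠ 0 → 0 < g x v v) (hself : ∀ x v w, g x (K x v) w = g x v (K x w)) :
    HasRealEigenvalues K := fun x _ hz ↦
  im_eq_zero_of_isRoot_charpoly (V := EuclideanSpace ℝ (Fin n)) (g x) (K x) (hpos x) (hself x) hz

theorem bilin_comp_exp_zero_smul {V : Type*} [NormedAddCommGroup V] [NormedSpace ℝ V]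
    [CompleteSpace V] (b : V →L[ℝ] V →L[ℝ] ℝ) (K : V →L[ℝ] V) :
    b ∘L NormedSpace.exp ((0 : ℝ) • K) = b := by
  ext v w
  simp

variable {g k : ℝ → BilinField n M}

theorem tr_ne_zero_of_eq (hθ : ∀ t > 0, ∀ x, tr (weingarten g k t) x = -t⁻¹) :
    ∀ t > 0, ∀ x, tr (weingarten g k t) x ≠ 0 := fun t ht x ↦ by
  rw [hθ t ht]
  exact neg_ne_zero.2 (inv_ne_zero (ne_of_gt ht))

theorem timeShift_eq_zero (hθ : ∀ t > 0, ∀ x, tr (weingarten g k t) x = -t⁻¹) (x : M) :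
    timeShift g k x = 0 := by
  simp [timeShift, hθ 1 one_pos]

theorem dataMetric_eq (hθ : ∀ t > 0, ∀ x, tr (weingarten g k t) x = -t⁻¹) :
    dataMetric g k = g 1 := by
  funext x
  rw [dataMetric, expMetric_congr (f₂ := fun _ ↦ 0) _ _ (by simp [timeShift_eq_zero hθ])]
  exact bilin_comp_exp_zero_smul (V := EuclideanSpace ℝ (Fin n)) (g 1 x)
    (rescaledWeingarten g k x)

theorem dataScalar_eq (φ : ℝ → M → ℝ) (hθ : ∀ t > 0, ∀ x, tr (weingarten g k t) x = -t⁻¹) :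
    dataScalar g k φ = φ 1 := by
  funext x
  simp [dataScalar, timeShift_eq_zero hθ]

variable [IsManifold (𝓡 n) ∞ M] {r : WithTop ℕ∞} {φ : ℝ → M → ℝ}

theorem IsSolution.metric_eq_modelMetric (hn : 3 ≤ n) (h : IsSolution r g k φ)
    (hθ : ∀ t > 0, ∀ x, tr (weingarten g k t) x = -t⁻¹) {t : ℝ} (ht : 0 < t) (x : M) :
    g t x = modelMetric (g 1) (rescaledWeingarten g k) t x := by
  rw [h.metric_eq hn (tr_ne_zero_of_eq hθ) ht]
  exact expMetric_congr _ _ (by simp [timeShift_eq_zero hθ])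

theorem IsSolution.neg_smul_weingarten (hn : 3 ≤ n) (h : IsSolution r g k φ)
    (hθ : ∀ t > 0, ∀ x, tr (weingarten g k t) x = -t⁻¹) {t : ℝ} (ht : 0 < t) (x : M) :
    -t • weingarten g k t x = rescaledWeingarten g k x := by
  rw [h.weingarten_eq hn (tr_ne_zero_of_eq hθ) ht, timeShift_eq_zero hθ, smul_smul]
  simp [ht.ne']

theorem IsSolution.scalar_eq_log (hn : 3 ≤ n) (hr : 2 ≤ r) (h : IsSolution r g k φ)
    (hθ : ∀ t > 0, ∀ x, tr (weingarten g k t) x = -t⁻¹) {t : ℝ} (ht : 0 < t) (x : M) :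
    φ t x = scalarVelocity g k φ x * Real.log t + φ 1 x := by
  rw [h.scalar_eq hn hr (tr_ne_zero_of_eq hθ) ht, timeShift_eq_zero hθ]
  simp [add_comm]

theorem IsSolution.hasDerivAt_mul_deriv_scalar (hn : 3 ≤ n) (hr : 2 ≤ r) (h : IsSolution r g k φ)
    (hθ : ∀ t > 0, ∀ x, tr (weingarten g k t) x = -t⁻¹) {t : ℝ} (ht : 0 < t) (x : M) :
    HasDerivAt (fun s ↦ s * deriv (fun u ↦ φ u x) s) 0 t := by
  have := h.hasDerivAt_scalarVelocity hn hr (tr_ne_zero_of_eq hθ) ht x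
  simpa [timeShift_eq_zero hθ] using this

end Normalised

/-! ### Regular eigenvalues and local eigenframes. -/

section Eigenframes

open Polynomial

variable {n : ℕ} {M : Type*} [TopologicalSpace M] [ChartedSpace (EuclideanSpace ℝ (Fin n)) M]

theorem card_eq_finrank_tangentSpace (x : M) :
    Fintype.card (Fin n) = Module.finrank ℝ (TangentSpace (𝓡 n) x) := by
  rw [Fintype.card_fin]
  exact (finrank_euclideanSpace_fin (𝕜 := ℝ) (n := n)).symm

variable [IsManifold (𝓡 n) ∞ M] {r : WithTop ℕ∞} {K : EndField n M} {p : Fin n → M → ℝ}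

/-- Distinct eigenvalues of a regular field of endomorphisms are regular functions. -/
theorem HasDistinctEigenvalues.contMDiff (hp : HasDistinctEigenvalues K p) (hK : K.Regular r)
    (hr : r ≠ 0) (A : Fin n) : ContMDiff (𝓡 n) 𝓘(ℝ, ℝ) r (p A) := by
  intro x₀
  set μ : M → Fin n → Fin n → ℝ := fun y ↦ comp K x₀ y with hμ
  have hμr : ContMDiffAt (𝓡 n) 𝓘(ℝ, Fin n → Fin n → ℝ) r μ x₀ :=
    contMDiffAt_pi_space.2 fun i ↦ contMDiffAt_pi_space.2 fun j ↦ (EndField.regular_iff K).1 hK x₀ i j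
  have hchar : ∀ y ∈ (chartAt (EuclideanSpace ℝ (Fin n)) x₀).source,
      Matrix.charpoly (Matrix.of (μ y)) =
        LinearMap.charpoly (K y : TangentSpace (𝓡 n) y →ₗ[ℝ] TangentSpace (𝓡 n) y) := by
    intro y hy
    rw [← LinearMap.charpoly_toMatrix _ (frame x₀ y hy), ← compMatrix_eq_toMatrix K x₀ y hy]
    rfl
  have hx₀ := mem_chart_source (EuclideanSpace ℝ (Fin n)) x₀
  have hex : ∀ B, ∃ ℓ : (Fin n → Fin n → ℝ) → ℝ, ContDiffAt ℝ r ℓ (μ x₀) ∧ ℓ (μ x₀) = p B x₀ ∧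
      ∀ᶠ m in 𝓝 (μ x₀), (Matrix.charpoly (Matrix.of m)).eval (ℓ m) = 0 := by
    intro B
    refine exists_contDiffAt_eigenvalue (μ x₀) ?_ ?_ hr
    · rw [hchar x₀ hx₀]
      exact (Module.End.hasEigenvalue_iff_isRoot_charpoly _ _).1 (hp.eigenvalue B x₀)
    · rw [hchar x₀ hx₀]
      exact eval_derivative_charpoly_ne_zero (card_eq_finrank_tangentSpace x₀) _
        (hp.strictMono x₀).injective (fun B ↦ hp.eigenvalue B x₀) B
  choose ℓ hℓr hℓ0 hℓ using hex
  have hℓμ : ∀ B, ContMDiffAt (𝓡 n) 𝓘(ℝ, ℝ) r (fun y ↦ ℓ B (μ y)) x₀ :=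
    fun B ↦ (hℓr B).contMDiffAt.comp x₀ hμr
  have hmono : ∀ᶠ y in 𝓝 x₀, ∀ B C, B < C → ℓ B (μ y) < ℓ C (μ y) := by
    simp only [eventually_all]
    intro B C hBC
    refine (hℓμ B).continuousAt.eventually_lt (hℓμ C).continuousAt ?_
    rw [hℓ0, hℓ0]
    exact hp.strictMono x₀ hBC
  have hroot : ∀ᶠ y in 𝓝 x₀, ∀ B, (Matrix.charpoly (Matrix.of (μ y))).eval (ℓ B (μ y)) = 0 :=
    eventually_all.2 fun B ↦ hμr.continuousAt.eventually (hℓ B)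
  refine (hℓμ A).congr_of_eventuallyEq ?_
  filter_upwards [hmono, hroot, source_mem_nhds (n := n) x₀] with y hm hr hy
  -- The local roots stay strictly ordered by continuity, hence they are `n` distinct eigenvalues
  -- and exhaust the spectrum. Two increasing enumerations of the same set agree.
  have h1 : StrictMono fun B ↦ ℓ B (μ y) := fun B C hBC ↦ hm B C hBC
  have h2 : range (fun B ↦ ℓ B (μ y)) ⊆ range fun B ↦ p B y := by
    rintro - ⟨B, rfl⟩
    have h3 := hr B
    rw [hchar y hy, charpoly_eq_prod_of_hasEigenvalue (card_eq_finrank_tangentSpace y) _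
      (hp.strictMono y).injective (fun B ↦ hp.eigenvalue B y), eval_prod,
      Finset.prod_eq_zero_iff] at h3
    obtain ⟨C, -, hC⟩ := h3
    exact ⟨C, (sub_eq_zero.1 (by simpa using hC)).symm⟩
  have h3 : range (fun B ↦ p B y) = range fun B ↦ ℓ B (μ y) := by
    refine (Set.eq_of_subset_of_ncard_le h2 ?_ (finite_range _)).symm
    rw [← image_univ, ← image_univ, ncard_image_of_injective _ h1.injective,
      ncard_image_of_injective _ (hp.strictMono y).injective]
  exact congrFun (((hp.strictMono y).range_inj h1).1 h3) A

theorem regularOn_aeval_prod (hK : K.Regular r) (hp : ∀ A, ContMDiff (𝓡 n) 𝓘(ℝ, ℝ) r (p A))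
    {X : VecField n M} {U : Set M} (hX : X.RegularOn r U) (s : Finset (Fin n)) :
    VecField.RegularOn r (fun y ↦ aeval (R := ℝ) (A := Module.End ℝ (TangentSpace (𝓡 n) y))
      (K y : TangentSpace (𝓡 n) y →ₗ[ℝ] TangentSpace (𝓡 n) y) (∏ B ∈ s, (Polynomial.X - C (p B y)))
        (X y)) U := by
  classical
  induction s using Finset.induction_on with
  | empty => simpa using hX
  | insert A s hA ih =>
    have h1 := ContMDiffOn.sub_section
      (ContMDiffOn.clm_bundle_apply hK.contMDiffOn ih)
      (((hp A).contMDiffOn (s := U)).smul_section ih)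
    refine h1.congr fun y _ ↦ ?_
    simp [Finset.prod_insert hA]

variable [ContMDiffVectorBundle r (EuclideanSpace ℝ (Fin n)) (TangentSpace (𝓡 n) : M → Type _) (𝓡 n)]

theorem regularOn_symmL (x₀ : M) (c : EuclideanSpace ℝ (Fin n)) :
    VecField.RegularOn r (fun y ↦ (trivializationAt (EuclideanSpace ℝ (Fin n))
      (TangentSpace (𝓡 n)) x₀).symmL ℝ y c)
      (trivializationAt (EuclideanSpace ℝ (Fin n)) (TangentSpace (𝓡 n)) x₀).baseSet := by
  refine (Trivialization.contMDiffOn_section_baseSet_iff _).2 ?_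
  refine (contMDiffOn_const (c := c)).congr fun y hy ↦ ?_
  set e := trivializationAt (EuclideanSpace ℝ (Fin n)) (TangentSpace (𝓡 n)) x₀
  exact (congrFun (e.coe_continuousLinearEquivAt_eq (R := ℝ) hy) (e.symmL ℝ y c)).trans
    (e.continuousLinearMapAt_symmL (R := ℝ) hy c)

theorem isOpen_ne_zero {X : VecField n M} (x₀ : M) (hX : X.RegularOn r
    (trivializationAt (EuclideanSpace ℝ (Fin n)) (TangentSpace (𝓡 n)) x₀).baseSet) :
    IsOpen {y ∈ (trivializationAt (EuclideanSpace ℝ (Fin n)) (TangentSpace (𝓡 n)) x₀).baseSet |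
      X y ≠ 0} := by
  set e := trivializationAt (EuclideanSpace ℝ (Fin n)) (TangentSpace (𝓡 n)) x₀
  have h1 := ((e.contMDiffOn_section_baseSet_iff).1 hX).continuousOn.isOpen_inter_preimage
    e.open_baseSet (isOpen_compl_singleton (x := (0 : EuclideanSpace ℝ (Fin n))))
  convert! h1 using 1
  ext y
  refine and_congr_right fun hy ↦ ?_
  exact ((e.continuousLinearEquivAt ℝ y hy).map_ne_zero_iff).symm

theorem HasDistinctEigenvalues.exists_isEigenframe (hp : HasDistinctEigenvalues K p)
    (hK : K.Regular r) (hr : r ≠ 0) (x₀ : M) :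
    ∃ (U : Set M) (X : Fin n → VecField n M), x₀ ∈ U ∧ IsEigenframe r K p X U := by
  set e := trivializationAt (EuclideanSpace ℝ (Fin n)) (TangentSpace (𝓡 n)) x₀ with he
  have hx₀ : x₀ ∈ e.baseSet := mem_baseSet_trivializationAt _ _ x₀
  choose v hv using fun A ↦ (hp.eigenvalue A x₀).exists_hasEigenvector
  -- An eigenvector at `x₀` is extended with constant components in the trivialisation, then
  -- projected onto the eigenspace by the product of the `K - p_B`, `B ≠ A`. The result is an
  -- eigenvector wherever it does not vanish.
  set X : Fin n → VecField n M := fun A y ↦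
    aeval (R := ℝ) (A := Module.End ℝ (TangentSpace (𝓡 n) y))
      (K y : TangentSpace (𝓡 n) y →ₗ[ℝ] TangentSpace (𝓡 n) y)
      (∏ B ∈ Finset.univ.erase A, (Polynomial.X - C (p B y)))
      (e.symmL ℝ y (e.continuousLinearMapAt ℝ x₀ (v A)))
  have hX : ∀ A, (X A).RegularOn r e.baseSet := fun A ↦
    regularOn_aeval_prod hK (hp.contMDiff hK hr) (regularOn_symmL x₀ _) _
  have hX0 : ∀ A, X A x₀ ≠ 0 := by
    intro A
    have h1 : e.symmL ℝ x₀ (e.continuousLinearMapAt ℝ x₀ (v A)) = v A :=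
      e.symmL_continuousLinearMapAt hx₀ (v A)
    simp only [X, h1]
    exact aeval_prod_apply_ne_zero _ (hp.strictMono x₀).injective A (hv A)
  refine ⟨e.baseSet ∩ ⋂ A, {y ∈ e.baseSet | X A y ≠ 0}, X,
    ⟨hx₀, mem_iInter.2 fun A ↦ ⟨hx₀, hX0 A⟩⟩, ?_, fun A ↦ (hX A).mono inter_subset_left,
    fun A x hx ↦ (mem_iInter.1 hx.2 A).2, fun A x _ ↦ ?_⟩
  · exact e.open_baseSet.inter (isOpen_iInter_of_finite fun A ↦ isOpen_ne_zero x₀ (hX A))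
  · exact aeval_prod_mem_ker (card_eq_finrank_tangentSpace x) _ (hp.strictMono x).injective
      (fun B ↦ hp.eigenvalue B x) A _

end Eigenframes

/-! ### Simultaneous diagonalisation and the conditions on the data. -/

section Diagonalisation

theorem eigenvector_orthogonal {V : Type*} [NormedAddCommGroup V] [NormedSpace ℝ V]
    (b : V →L[ℝ] V →L[ℝ] ℝ) (K : V →L[ℝ] V) (hself : ∀ v w, b (K v) w = b v (K w)) {v w : V}
    {c d : ℝ} (hcd : c ≠ d) (hv : K v = c • v) (hw : K w = d • w) : b v w = 0 := by
  have h1 := hself v w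
  rw [hv, hw, map_smul, map_smul, _root_.smul_apply, smul_eq_mul, smul_eq_mul] at h1
  have h2 : (c - d) * b v w = 0 := by linarith
  exact (mul_eq_zero.1 h2).resolve_left (sub_ne_zero.2 hcd)

/-- Duality makes the `X A` linearly independent, and the dimension count makes them a basis whose
coordinate functions are the `Y A`. -/
theorem eq_sum_of_dual {V : Type*} [AddCommGroup V] [Module ℝ V] [Module.Finite ℝ V] {ι : Type*}
    [Fintype ι] [DecidableEq ι] (hι : Fintype.card ι = Module.finrank ℝ V) {X : ι → V}
    {Y : ι → V →ₗ[ℝ] ℝ} (hXY : ∀ A B, Y A (X B) = if A = B then 1 else 0) (v : V) :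
    v = ∑ A, Y A v • X A := by
  have key : ∀ (c : ι → ℝ) A, Y A (∑ B, c B • X B) = c A := by
    intro c A
    simp [hXY]
  have hli : LinearIndependent ℝ X := by
    rw [Fintype.linearIndependent_iff]
    intro c hc A
    rw [← key c A, hc, map_zero]
  rcases isEmpty_or_nonempty ι with h | h
  · have : Subsingleton V := Module.finrank_zero_iff.1 (by rw [← hι]; simp)
    exact Subsingleton.elim _ _
  · set B := basisOfLinearIndependentOfCardEqFinrank hli hι
    have h1 : ∑ A, B.repr v A • X A = v := by
      simpa [B] using B.sum_repr v
    have h2 : ∀ A, Y A v = B.repr v A := fun A ↦ by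
      conv_lhs => rw [← h1]
      exact key _ A
    simp only [h2]
    exact h1.symm

/-- Eigenvectors for different eigenvalues are orthogonal, so the double sum over the frame
collapses, and the exponential acts on each `X A` by a scalar. -/
theorem bilin_exp_eq_sum {V : Type*} [NormedAddCommGroup V] [NormedSpace ℝ V]
    [FiniteDimensional ℝ V] {ι : Type*} [Fintype ι] [DecidableEq ι]
    (hι : Fintype.card ι = Module.finrank ℝ V) (b : V →L[ℝ] V →L[ℝ] ℝ) (K : V →L[ℝ] V)
    (hself : ∀ v w, b (K v) w = b v (K w)) {X : ι → V} {Y : ι → V →L[ℝ] ℝ} {p : ι → ℝ}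
    (hp : Function.Injective p) (hX : ∀ A, K (X A) = p A • X A)
    (hXY : ∀ A B, Y A (X B) = if A = B then 1 else 0) (c : ℝ) (v w : V) :
    b (NormedSpace.exp (c • K) v) w =
      ∑ A, b (X A) (X A) * Real.exp (c * p A) * (Y A v * Y A w) := by
  have : CompleteSpace V := FiniteDimensional.complete ℝ V
  have hexp : ∀ A, NormedSpace.exp (c • K) (X A) = Real.exp (c * p A) • X A := fun A ↦
    exp_apply_eigenvector (c • K)
      (by rw [_root_.smul_apply, hX, smul_smul])
  have hd := eq_sum_of_dual hι (X := X) (Y := fun A ↦ (Y A : V →ₗ[ℝ] ℝ)) hXY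
  have horth : ∀ A B, A ≠ B → b (X A) (X B) = 0 := fun A B hAB ↦
    eigenvector_orthogonal b K hself (hp.ne hAB) (hX A) (hX B)
  conv_lhs => rw [hd v, hd w]
  simp only [map_sum, map_smul, hexp, _root_.sum_apply, _root_.smul_apply, smul_eq_mul]
  refine Finset.sum_congr rfl fun A _ ↦ ?_
  rw [Finset.sum_eq_single A (fun B _ hB ↦ by rw [horth B A hB]; simp) (by simp)]
  simp only [ContinuousLinearMap.coe_coe]
  ring

variable {n : ℕ} {M : Type*} [TopologicalSpace M] [ChartedSpace (EuclideanSpace ℝ (Fin n)) M]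
  [IsManifold (𝓡 n) ∞ M] {r : WithTop ℕ∞}

theorem contMDiffOn_bilin_apply {h : BilinField n M} (hh : h.Regular r) {X Z : VecField n M}
    {U : Set M} (hX : X.RegularOn r U) (hZ : Z.RegularOn r U) :
    ContMDiffOn (𝓡 n) 𝓘(ℝ, ℝ) r (fun x ↦ h x (X x) (Z x)) U := by
  intro x hx
  have h1 : ContMDiffWithinAt (𝓡 n) ((𝓡 n).prod 𝓘(ℝ, ℝ)) r
      (fun y ↦ TotalSpace.mk' ℝ (E := Bundle.Trivial M ℝ) y (h y (X y) (Z y))) U x :=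
    ContMDiffWithinAt.clm_bundle_apply₂ (F₁ := EuclideanSpace ℝ (Fin n))
      (F₂ := EuclideanSpace ℝ (Fin n)) (hh x).contMDiffWithinAt (hX x hx) (hZ x hx)
  simp only [contMDiffWithinAt_totalSpace] at h1
  exact h1.2

theorem expMetric_eq_diagForm {h : BilinField n M} {K : EndField n M} {p : Fin n → M → ℝ}
    (hp : HasDistinctEigenvalues K p) (hself : ∀ x v w, h x (K x v) w = h x v (K x w)) {U : Set M}
    {X : Fin n → VecField n M} {Y : Fin n → OneForm n M} (hX : IsEigenframe r K p X U)
    (hXY : IsDualCoframe X Y U) (f : M → ℝ) {x : M} (hx : x ∈ U) (v w : TangentSpace (𝓡 n) x) :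
    expMetric h f K x v w =
      diagForm (fun A ↦ h x (X A x) (X A x) * Real.exp (f x * p A x)) Y x v w :=
  bilin_exp_eq_sum (V := EuclideanSpace ℝ (Fin n)) (by simp) (h x) (K x) (hself x)
    (hp.strictMono x).injective (fun A ↦ hX.eigen A x hx) (hXY x hx) (f x) v w

theorem exists_diagonalisation {h : BilinField n M} {K : EndField n M} {p : Fin n → M → ℝ}
    (hh : IsRiemannianMetric r h) (hp : HasDistinctEigenvalues K p)
    (hself : ∀ x v w, h x (K x v) w = h x v (K x w)) {U : Set M}
    {X : Fin n → VecField n M} {Y : Fin n → OneForm n M} (hX : IsEigenframe r K p X U)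
    (hXY : IsDualCoframe X Y U) : ∃ α : Fin n → M → ℝ,
      (∀ A, ContMDiffOn (𝓡 n) 𝓘(ℝ, ℝ) r (α A) U) ∧ (∀ A, ∀ x ∈ U, 0 < α A x) ∧
      (∀ t > 0, ∀ x ∈ U, ∀ v w, modelMetric h K t x v w =
        diagForm (fun A ↦ α A x ^ 2 * t ^ (2 * p A x)) Y x v w) ∧
      (∀ x ∈ U, ∀ v w, h x v w = diagForm (fun A ↦ α A x ^ 2) Y x v w) := by
  have hpos : ∀ A, ∀ x ∈ U, 0 < h x (X A x) (X A x) :=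
    fun A x hx ↦ hh.pos x _ (hX.ne_zero A x hx)
  have hsq : ∀ A, ∀ x ∈ U, √(h x (X A x) (X A x)) ^ 2 = h x (X A x) (X A x) :=
    fun A x hx ↦ Real.sq_sqrt (hpos A x hx).le
  -- `α_A` is the `h`-length of `X_A`; positivity under the root keeps it regular.
  refine ⟨fun A x ↦ √(h x (X A x) (X A x)), fun A x hx ↦ ?_, fun A x hx ↦
    Real.sqrt_pos.2 (hpos A x hx), fun t ht x hx v w ↦ ?_, fun x hx v w ↦ ?_⟩
  · exact ContMDiffAt.comp_contMDiffWithinAt x (g := Real.sqrt)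
      (Real.contDiffAt_sqrt (hpos A x hx).ne').contMDiffAt
      (contMDiffOn_bilin_apply hh.regular (hX.regular A) (hX.regular A) x hx)
  · rw [modelMetric, expMetric_eq_diagForm hp hself hX hXY _ hx]
    refine Finset.sum_congr rfl fun A _ ↦ ?_
    simp only [hsq A x hx, Real.rpow_def_of_pos ht]
    ring_nf
  · have h1 : h x v w = expMetric h (fun _ ↦ 0) K x v w := by
      have := bilin_comp_exp_zero_smul (V := EuclideanSpace ℝ (Fin n)) (h x) (K x)
      exact congrArg (fun b : EuclideanSpace ℝ (Fin n) →L[ℝ] EuclideanSpace ℝ (Fin n) →L[ℝ] ℝ ↦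
        b v w) this.symm
    rw [h1, expMetric_eq_diagForm hp hself hX hXY _ hx]
    refine Finset.sum_congr rfl fun A _ ↦ ?_
    simp only [hsq A x hx, zero_mul, Real.exp_zero, mul_one]

theorem add_le_of_strictMono {p : Fin n → ℝ} (hp : StrictMono p) {i j B C : Fin n}
    (hi : i.val + 2 = n) (hj : j.val + 1 = n) (hBC : B ≠ C) : p B + p C ≤ p i + p j := by
  wlog h : B < C generalizing B C
  · rw [add_comm]
    exact this hBC.symm (lt_of_le_of_ne (not_lt.1 h) hBC.symm)
  · refine add_le_add (hp.monotone ?_) (hp.monotone ?_)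
    · rw [Fin.le_def]
      have := Fin.lt_def.1 h
      have := C.2
      omega
    · rw [Fin.le_def]
      have := C.2
      omega

/-- For `B ≠ C` the sum `p_B + p_C` is at most that of the two largest eigenvalues, so `1 + p_A -
p_B - p_C > 0` and nothing is required of the bracket. For `B = C` the bracket vanishes identically.
-/
theorem isQuiescentData_of_pos (hn : 3 ≤ n) (hr : ∞ ≤ r) {h : BilinField n M} {K : EndField n M}
    {Φa Φb : M → ℝ} {p : Fin n → M → ℝ} (hh : IsRiemannianMetric r h) (hK : K.Regular r)
    (ha : ContMDiff (𝓡 n) 𝓘(ℝ, ℝ) r Φa) (hb : ContMDiff (𝓡 n) 𝓘(ℝ, ℝ) r Φb)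
    (htr : ∀ x, tr K x = 1) (hself : ∀ x v w, h x (K x v) w = h x v (K x w))
    (hham : ∀ x, trSq K x + Φa x ^ 2 = 1)
    (hmom : ∀ x, divergence h K x = Φa x • mvfderiv (𝓡 n) Φb x) (hp : HasDistinctEigenvalues K p)
    {l i j : Fin n} (hl : l.val = 0) (hi : i.val + 2 = n) (hj : j.val + 1 = n)
    (hpos : ∀ x, 0 < 1 + p l x - p i x - p j x) :
    IsQuiescentData h K Φa Φb where
  dim := hn
  metric := ⟨ContMDiff.of_le hh.regular hr, hh.symm, hh.pos⟩
  regular_K := ContMDiff.of_le hK hr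
  regular_Φa := ha.of_le hr
  regular_Φb := hb.of_le hr
  trace := htr
  symm := hself
  hamiltonian := hham
  momentum := hmom
  eigenvalues := by
    refine ⟨p, hp, fun U X Y _ _ _ A B C x _ hx ↦ ?_⟩
    rcases eq_or_ne B C with rfl | hBC
    · refine Eventually.of_forall fun y ↦ ?_
      simp [VectorField.mlieBracket_self]
    · have h1 := add_le_of_strictMono (hp.strictMono x) hi hj hBC
      have h2 : p l x ≤ p A x :=
        (hp.strictMono x).monotone (Fin.le_def.2 (hl.trans_le (Nat.zero_le _)))
      linarith [hpos x]

end Diagonalisation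

/-! ### The smooth and analytic cases, and the proof of the theorem. -/

section Main

variable {n : ℕ} {M : Type*} [TopologicalSpace M] [ChartedSpace (EuclideanSpace ℝ (Fin n)) M]
  [IsManifold (𝓡 n) ∞ M] {r : WithTop ℕ∞} {g k : ℝ → BilinField n M} {φ : ℝ → M → ℝ}

theorem contMDiffVectorBundle_tangent (hr : r = ∞ ∨ r = ω) [IsManifold (𝓡 n) r M] :
    ContMDiffVectorBundle r (EuclideanSpace ℝ (Fin n)) (TangentSpace (𝓡 n) : M → Type _) (𝓡 n) := by
  rcases hr with rfl | rfl <;> infer_instance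

theorem infty_le_of_eq (hr : r = ∞ ∨ r = ω) : ∞ ≤ r := by
  rcases hr with rfl | rfl
  · exact le_rfl
  · exact le_top

theorem two_le_of_infty_le (hr : ∞ ≤ r) : 2 ≤ r :=
  le_trans (WithTop.coe_le_coe.2 (le_top : (2 : ℕ∞) ≤ ⊤)) hr

end Main

end VelocityDominated

end

theorem mainTheorem11 {n : ℕ} (hn : 3 ≤ n) {r : WithTop ℕ∞} (hr : r = ∞ ∨ r = ω)
    {M : Type*} [TopologicalSpace M] [ChartedSpace (EuclideanSpace ℝ (Fin n)) M]
    [IsManifold (𝓡 n) ∞ M] [IsManifold (𝓡 n) r M] :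
    -- normalisation: after a change of the origin of time, `tr k = -1/t`
    (∀ (g k : ℝ → VelocityDominated.BilinField n M) (φ : ℝ → M → ℝ),
      VelocityDominated.IsSolution r g k φ →
      (∀ t > 0, ∀ x, VelocityDominated.tr (VelocityDominated.weingarten g k t) x ≠ 0) →
      ∃ (C : M → ℝ) (g' k' : ℝ → VelocityDominated.BilinField n M) (φ' : ℝ → M → ℝ),
        ContMDiff (𝓡 n) 𝓘(ℝ, ℝ) r C ∧ (∀ x, C x ≤ 0) ∧
        VelocityDominated.IsSolution r g' k' φ' ∧
        (∀ t > 0, ∀ x, VelocityDominated.tr (VelocityDominated.weingarten g' k' t) x = -t⁻¹) ∧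
        ∀ t > 0, ∀ x, g t x = g' (t - C x) x ∧ k t x = k' (t - C x) x ∧ φ t x = φ' (t - C x) x) ∧
    -- the normalised solutions
    (∀ (g k : ℝ → VelocityDominated.BilinField n M) (φ : ℝ → M → ℝ),
      VelocityDominated.IsSolution r g k φ →
      (∀ t > 0, ∀ x, VelocityDominated.tr (VelocityDominated.weingarten g k t) x = -t⁻¹) →
      ∃ K : VelocityDominated.EndField n M,
        K.Regular r ∧
        (∀ t > 0, ∀ x, -t • VelocityDominated.weingarten g k t x = K x) ∧
        VelocityDominated.HasRealEigenvalues K ∧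
        (∀ t > 0, ∀ x, HasDerivAt (fun s ↦ s * deriv (fun u ↦ φ u x) s) 0 t) ∧
        ∃ Φa Φb : M → ℝ,
          ContMDiff (𝓡 n) 𝓘(ℝ, ℝ) r Φa ∧ ContMDiff (𝓡 n) 𝓘(ℝ, ℝ) r Φb ∧
          (∀ t > 0, ∀ x, φ t x = Φa x * Real.log t + Φb x) ∧
          ∀ p : Fin n → M → ℝ, VelocityDominated.HasDistinctEigenvalues K p →
            -- local eigenframes exist near every point
            (∀ x, ∃ (U : Set M) (X : Fin n → VelocityDominated.VecField n M),
              x ∈ U ∧ VelocityDominated.IsEigenframe r K p X U) ∧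
            ∃ h : VelocityDominated.BilinField n M,
              VelocityDominated.IsRiemannianMetric r h ∧
              (∀ (U : Set M) (X : Fin n → VelocityDominated.VecField n M)
                (Y : Fin n → VelocityDominated.OneForm n M),
                VelocityDominated.IsEigenframe r K p X U →
                VelocityDominated.IsDualCoframe X Y U →
                ∃ α : Fin n → M → ℝ,
                  (∀ A, ContMDiffOn (𝓡 n) 𝓘(ℝ, ℝ) r (α A) U) ∧
                  (∀ A, ∀ x ∈ U, 0 < α A x) ∧
                  (∀ t > 0, ∀ x ∈ U, ∀ v w, g t x v w =
                    VelocityDominated.diagForm (fun A ↦ α A x ^ 2 * t ^ (2 * p A x)) Y x v w) ∧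
                  (∀ x ∈ U, ∀ v w, h x v w =
                    VelocityDominated.diagForm (fun A ↦ α A x ^ 2) Y x v w)) ∧
              ((∀ x, 0 < 1 + p ⟨0, by omega⟩ x - p ⟨n - 2, by omega⟩ x - p ⟨n - 1, by omega⟩ x) →
                VelocityDominated.IsQuiescentData h K Φa Φb)) := by
  have hr' := VelocityDominated.infty_le_of_eq hr
  have hr2 := VelocityDominated.two_le_of_infty_le hr'
  have hr0 : r ≠ 0 := fun h0 ↦ by simp [h0] at hr2
  have := VelocityDominated.contMDiffVectorBundle_tangent (n := n) (M := M) hr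
  refine ⟨fun g k φ h hθ ↦ h.exists_normalisation hn hr2 hθ, fun g k φ h hθ ↦ ?_⟩
  have hθ' := VelocityDominated.tr_ne_zero_of_eq hθ
  have hK := h.regular_rescaledWeingarten hθ'
  have hself := h.rescaledWeingarten_selfAdjoint
  have hh := h.isRiemannianMetric one_pos
  have ha := h.contMDiff_scalarVelocity hn hr2 hθ'
  have hb := h.contMDiff_scalar one_pos
  have hmom := h.divergence_dataMetric hn hr2 hθ'
  -- Here `C = 0`, and at `t = 1` both `t^(2𝒦)` is the identity and `log t = 0`. Hence the metric
  -- and `Φb` on the singularity are simply `g 1` and `φ 1`.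
  rw [VelocityDominated.dataMetric_eq hθ, VelocityDominated.dataScalar_eq φ hθ] at hmom
  refine ⟨VelocityDominated.rescaledWeingarten g k, hK,
    fun t ht x ↦ h.neg_smul_weingarten hn hθ ht x,
    VelocityDominated.hasRealEigenvalues_of_selfAdjoint (g 1) _ hh.pos hself,
    fun t ht x ↦ h.hasDerivAt_mul_deriv_scalar hn hr2 hθ ht x,
    VelocityDominated.scalarVelocity g k φ, φ 1, ha, hb,
    fun t ht x ↦ h.scalar_eq_log hn hr2 hθ ht x, fun p hp ↦
    ⟨hp.exists_isEigenframe hK hr0, g 1, hh, fun U X Y hX hXY ↦ ?_, fun hpos ↦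
      VelocityDominated.isQuiescentData_of_pos hn hr' hh hK ha hb
        (h.tr_rescaledWeingarten hn hθ') hself (h.trSq_rescaledWeingarten hn hθ') hmom hp rfl
        (Nat.sub_add_cancel (by lia)) (Nat.sub_add_cancel (by lia)) hpos⟩⟩
  obtain ⟨α, hα, hα0, hαt, hα1⟩ := VelocityDominated.exists_diagonalisation hh hp hself hX hXY
  refine ⟨α, hα, hα0, fun t ht x hx v w ↦ ?_, hα1⟩
  rw [h.metric_eq_modelMetric hn hθ ht x]
  exact hαt t ht x hx v w
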